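/- Let $k$ be $\mathbb R$ or $\mathbb C$, and let $G$ be a Lie group over $k$ with Lie algebra $\mathfrak g$, together with a $G$-invariant nondegenerate symmetric $k$-bilinear form $B$ on $\mathfrak g$ (such a form exists, for instance, on every connected reductive algebraic Lie group over $k$). Let $X$ be a compact connected oriented $C^\infty$ surface, $D\subset X$ a nonempty finite subset, $X_0=X\setminus D$, and $x_0\in X_0$. Let $\rho:\pi_1(X_0,x_0)\to G$ be a homomorphism, let $\mathrm{ad}(E^\rho_G)$ be the flat vector bundle on $X_0$ with fibre $\mathfrak g$ and monodromy $\mathrm{Ad}\circ\rho$, and let $\underline{\mathrm{ad}}$ be the local system of its flat sections. Let $H^1(X_0,\underline{\mathrm{ad}})$ and $H^1_c(X_0,\underline{\mathrm{ad}})$ be its first cohomology and its first cohomology with compact supports, computed by the de Rham complexes of smooth forms, respectively of smooth forms with compact support, with values in the flat bundle $\mathrm{ad}(E^\rho_G)$. If $\rho$ is completely reducible, then $T_\rho\mathcal R=H^1(X_0,\underline{\mathrm{ad}})$ is the tangent space at $\rho$ of the character variety $\mathcal R$ of $X_0$ and $G$. In general, write $T_\rho\mathcal R$ for $H^1(X_0,\underline{\mathrm{ad}})$.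 The formula $\langle[\alpha],[\beta]\rangle=\int_{X_0}B(\alpha\wedge\beta)$ (cup product, contraction with $B$, and $H^2_c(X_0,k)=k$) gives a well-defined bilinear pairing $$\langle\cdot,\cdot\rangle:\ H^1_c(X_0,\underline{\mathrm{ad}})\times H^1(X_0,\underline{\mathrm{ad}})\to k .$$ Let $\widetilde\Phi_\rho:H^1_c(X_0,\underline{\mathrm{ad}})\to H^1(X_0,\underline{\mathrm{ad}})$ be the natural map, induced by the inclusion of the compactly supported forms into all forms. Then $$\langle\alpha,\widetilde\Phi_\rho(\beta)\rangle=-\langle\beta,\widetilde\Phi_\rho(\alpha)\rangle\qquad\text{for all }\alpha,\beta\in H^1_c(X_0,\underline{\mathrm{ad}}).$$ There is exactly one element $\Phi_\rho\in T_\rho\mathcal R\otimes_k T_\rho\mathcal R$ which defines the map $\widetilde\Phi_\rho$, that is, such that $(\langle\alpha,\cdot\rangle\otimes\mathrm{id})(\Phi_\rho)=\widetilde\Phi_\rho(\alpha)$ for all $\alpha\in H^1_c(X_0,\underline{\mathrm{ad}})$. This $\Phi_\rho$ is skew-symmetric: it lies in the subspace $\wedge^2T_\rho\mathcal R\subset T_\rho\mathcal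 R\otimes_k T_\rho\mathcal R$ spanned by the elements $v\otimes w-w\otimes v$. -/

import Mathlib

open scoped Manifold ContDiff TensorProduct

noncomputable section

namespace FlatSurface

/-- The model space `ℝ²` of surfaces. -/
abbrev Plane : Type := EuclideanSpace ℝ (Fin 2)

/-! ### The adjoint representation of a Lie group -/

section Adjoint

variable (k : Type*) [RCLike k] {F : Type*} [NormedAddCommGroup F] [NormedSpace k F]
  {G : Type*} [TopologicalSpace G] [ChartedSpace F G] [Group G]

/-- `Ad g`: the derivative at the identity of the conjugation `h ↦ g h g⁻¹`. The Lie algebra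
`GroupLieAlgebra 𝓘(k, F) G`, the tangent space at `1` of a Lie group `G` modelled on `F`, is by
definition the vector space `F`. -/
def adFun (g : G) : F →L[k] F :=
  mfderiv 𝓘(k, F) 𝓘(k, F) (fun h : G => g * h * g⁻¹) 1

variable [LieGroup 𝓘(k, F) ∞ G]

lemma mdifferentiable_conj (g : G) :
    MDifferentiable 𝓘(k, F) 𝓘(k, F) (fun h : G => g * h * g⁻¹) := by
  have h : ContMDiff 𝓘(k, F) 𝓘(k, F) ∞ (fun h : G => g * h * g⁻¹) :=
    (contMDiff_const.mul contMDiff_id).mul contMDiff_const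
  exact h.mdifferentiable (by simp)

/-- The adjoint representation of `G` on its Lie algebra. -/
def Ad : G →* (F →L[k] F) where
  toFun := adFun k
  map_one' := by
    have : (fun h : G => 1 * h * (1 : G)⁻¹) = id := by ext h; simp
    rw [adFun, this]
    exact mfderiv_id
  map_mul' g g' := by
    have hc : (fun h : G => g * g' * h * (g * g')⁻¹) =
        (fun h : G => g * h * g⁻¹) ∘ (fun h : G => g' * h * g'⁻¹) := by
      ext h; simp [mul_assoc]
    have key := mfderiv_comp (I := 𝓘(k, F)) (I' := 𝓘(k, F)) (I'' := 𝓘(k, F)) (1 : G)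
      (mdifferentiable_conj (F := F) k g (g' * 1 * g'⁻¹)) (mdifferentiable_conj (F := F) k g' 1)
    have h2 : ∀ z : G, z = 1 →
        adFun (F := F) k g = (mfderiv 𝓘(k, F) 𝓘(k, F) (fun h : G => g * h * g⁻¹) z : F →L[k] F) := by
      rintro _ rfl; rfl
    have h3 := h2 (g' * 1 * g'⁻¹) (by simp)
    rw [h3]
    unfold adFun
    rw [hc]
    exact key

end Adjoint

/-! ### Surfaces -/

/-- The charts of `X` form an oriented atlas: all coordinate changes preserve the orientation of
the plane. A surface with such an atlas is an oriented surface. -/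
def IsOrientedAtlas (X : Type*) [TopologicalSpace X] [ChartedSpace Plane X] : Prop :=
  ∀ e ∈ atlas Plane X, ∀ e' ∈ atlas Plane X, ∀ v ∈ (e.symm.trans e').source,
    0 < (fderiv ℝ (e.symm.trans e') v).det

/-- The complement of finitely many points, as an open subset (hence again a surface). -/
def punctured (X : Type*) [TopologicalSpace X] [T2Space X] (D : Finset X) :
    TopologicalSpace.Opens X :=
  ⟨(D : Set X)ᶜ, D.finite_toSet.isClosed.isOpen_compl⟩

lemma punctured_sigmaCompact (X : Type*) [TopologicalSpace X] [T2Space X] [CompactSpace X]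
    [ChartedSpace Plane X] (D : Finset X) : SigmaCompactSpace (punctured X D) := by
  have : SecondCountableTopology X := ChartedSpace.secondCountable_of_sigmaCompact Plane X
  have : LocallyCompactSpace (punctured X D) := ChartedSpace.locallyCompactSpace Plane _
  infer_instance

instance (X : Type*) [TopologicalSpace X] [T2Space X] [CompactSpace X]
    [ChartedSpace Plane X] (D : Finset X) : SigmaCompactSpace (punctured X D) :=
  punctured_sigmaCompact X D

/-! ### Differential forms with values in a flat vector bundle

Let `M` be a surface with base point `x₀`, and let `σ` be a representation of `π₁(M, x₀)` on a
vector space `V`. The universal cover of `M` is the set of pairs `(y, p)` with `y ∈ M` and `p` a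
homotopy class of paths from `x₀` to `y`. The fundamental group acts on it on the right by
`(y, p) γ = (y, γ ⌢ p)` (in Mathlib, the product `γ * γ'` in the fundamental group is `γ'` followed
by `γ`). The flat bundle of `σ` is the quotient of the product of the universal cover with `V`
which identifies `((y, p), v)` with `((y, p) γ, σ(γ)⁻¹ v)`; so its sections, and the
differential forms with values in it, are the `V`-valued functions and the horizontal `V`-valued
forms on the universal cover that have the corresponding equivariance. -/

section Forms

set_option linter.unusedSectionVars false

variable {k : Type*} [RCLike k] {V : Type*} [NormedAddCommGroup V] [NormedSpace ℝ V]
  [NormedSpace k V] [IsScalarTower ℝ k V]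
  {M : Type*} [TopologicalSpace M] [ChartedSpace Plane M] {x₀ : M}

/-- `V`-valued functions on the universal cover. -/
abbrev CoverFun (x₀ : M) (V : Type*) : Type _ :=
  ∀ y : M, Path.Homotopic.Quotient x₀ y → V

/-- (Not necessarily continuous) `V`-valued 1-forms on the universal cover; the tangent space of
the universal cover at `(y, p)` is the tangent space of `M` at `y`. -/
abbrev CoverForm (x₀ : M) (V : Type*) [NormedAddCommGroup V] [NormedSpace ℝ V] : Type _ :=
  ∀ y : M, Path.Homotopic.Quotient x₀ y → TangentSpace 𝓘(ℝ, Plane) y →L[ℝ] V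

/-- `s` is over `U` a continuous lift of `U` to the universal cover: it is compatible with the
lifting of paths that stay in `U`. (Its values outside of `U` do not matter.) -/
def IsLift {M : Type*} [TopologicalSpace M] {x₀ : M} (U : Set M)
    (s : ∀ y : M, Path.Homotopic.Quotient x₀ y) : Prop :=
  ∀ ⦃y z : M⦄ (r : Path y z), (∀ t, r t ∈ U) →
    s z = (s y).trans (Path.Homotopic.Quotient.mk r)

/-- A `V`-valued 1-form `θ` on `M` in a chart `e`: its pull-back under the inverse of `e`. -/
def inChart (e : OpenPartialHomeomorph M Plane)
    (θ : ∀ y : M, TangentSpace 𝓘(ℝ, Plane) y →L[ℝ] V) (v : Plane) : Plane →L[ℝ] V :=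
  (θ (e.symm v)).comp (mfderiv 𝓘(ℝ, Plane) 𝓘(ℝ, Plane) e.symm v)

/-- Smoothness of a function on the universal cover: it is smooth along all local lifts. -/
def CoverFun.IsSmooth (f : CoverFun x₀ V) : Prop :=
  ∀ (U : Set M) (s : ∀ y : M, Path.Homotopic.Quotient x₀ y), IsOpen U → IsLift U s →
    ContMDiffOn 𝓘(ℝ, Plane) 𝓘(ℝ, V) ∞ (fun y => f y (s y)) U

/-- Smoothness of a 1-form on the universal cover: smoothness in all charts, along all local
lifts. -/
def CoverForm.IsSmooth (η : CoverForm x₀ V) : Prop :=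
  ∀ (U : Set M) (s : ∀ y : M, Path.Homotopic.Quotient x₀ y), IsOpen U → IsLift U s →
    ∀ e ∈ atlas Plane M,
      ContDiffOn ℝ ∞ (inChart e (fun y => η y (s y))) (e.target ∩ e.symm ⁻¹' U)

/-- `dη = 0`, that is, `∂ₐ η(b) = ∂_b η(a)` in all charts, along all local lifts. -/
def CoverForm.IsClosed (η : CoverForm x₀ V) : Prop :=
  ∀ (U : Set M) (s : ∀ y : M, Path.Homotopic.Quotient x₀ y), IsOpen U → IsLift U s →
    ∀ e ∈ atlas Plane M, ∀ v ∈ e.target ∩ e.symm ⁻¹' U, ∀ a b : Plane,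
      fderiv ℝ (inChart e (fun y => η y (s y))) v a b =
        fderiv ℝ (inChart e (fun y => η y (s y))) v b a

/-- `η = df`. On equivariant `f`, this `d` is the flat connection of the flat bundle. -/
def IsDifferential (f : CoverFun x₀ V) (η : CoverForm x₀ V) : Prop :=
  ∀ (U : Set M) (s : ∀ y : M, Path.Homotopic.Quotient x₀ y), IsOpen U → IsLift U s →
    ∀ y ∈ U, η y (s y) = mfderiv 𝓘(ℝ, Plane) 𝓘(ℝ, V) (fun z => f z (s z)) y

/-- Smooth sections of the flat bundle of `σ`. -/
def IsBundleSection (σ : FundamentalGroup M x₀ →* (V →L[k] V)) (f : CoverFun x₀ V) : Prop :=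
  f.IsSmooth ∧ ∀ (γ : FundamentalGroup M x₀) (y : M) (p : Path.Homotopic.Quotient x₀ y),
    f y (γ.toPath.trans p) = σ γ⁻¹ (f y p)

/-- Smooth 1-forms with values in the flat bundle of `σ`. -/
def IsBundleForm (σ : FundamentalGroup M x₀ →* (V →L[k] V)) (η : CoverForm x₀ V) : Prop :=
  η.IsSmooth ∧ ∀ (γ : FundamentalGroup M x₀) (y : M) (p : Path.Homotopic.Quotient x₀ y)
    (a : TangentSpace 𝓘(ℝ, Plane) y), η y (γ.toPath.trans p) a = σ γ⁻¹ (η y p a)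

/-- The support of a function or form (on the universal cover) has relatively compact image in
`M`. -/
def HasCompactSupp {M : Type*} [TopologicalSpace M] {x₀ : M}
    {W : M → Type*} [∀ y, Zero (W y)] (η : ∀ y : M, Path.Homotopic.Quotient x₀ y → W y) : Prop :=
  ∃ K : Set M, IsCompact K ∧ ∀ y ∉ K, ∀ p, η y p = 0

/-! ### De Rham cohomology of the flat bundle -/

variable (σ : FundamentalGroup M x₀ →* (V →L[k] V))

lemma inChart_add (e : OpenPartialHomeomorph M Plane)
    (θ θ' : ∀ y : M, TangentSpace 𝓘(ℝ, Plane) y →L[ℝ] V) :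
    inChart e (fun y => θ y + θ' y) = inChart e θ + inChart e θ' := by
  funext v; exact ContinuousLinearMap.add_comp _ _ _

lemma inChart_smul (e : OpenPartialHomeomorph M Plane) (c : k)
    (θ : ∀ y : M, TangentSpace 𝓘(ℝ, Plane) y →L[ℝ] V) :
    inChart e (fun y => c • θ y) = c • inChart e θ := by
  funext v; exact ContinuousLinearMap.smul_comp _ _ _

lemma inChart_zero (e : OpenPartialHomeomorph M Plane) :
    inChart e (fun y => (0 : TangentSpace 𝓘(ℝ, Plane) y →L[ℝ] V)) = 0 := by
  funext v; exact ContinuousLinearMap.zero_comp _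

lemma CoverForm.IsSmooth.differentiableAt {η : CoverForm x₀ V} (h : η.IsSmooth) {U : Set M}
    {s : ∀ y : M, Path.Homotopic.Quotient x₀ y} (hU : IsOpen U) (hs : IsLift U s)
    {e : OpenPartialHomeomorph M Plane} (he : e ∈ atlas Plane M) {v : Plane}
    (hv : v ∈ e.target ∩ e.symm ⁻¹' U) :
    DifferentiableAt ℝ (inChart e (fun y => η y (s y))) v := by
  have ho : IsOpen (e.target ∩ e.symm ⁻¹' U) := e.isOpen_inter_preimage_symm hU
  exact ((h U s hU hs e he).differentiableOn (by simp)).differentiableAt (ho.mem_nhds hv)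

/-- The space `Z¹` of closed smooth 1-forms with values in the flat bundle. -/
def closedForms : Submodule k (CoverForm x₀ V) where
  carrier := {η | IsBundleForm σ η ∧ η.IsClosed}
  zero_mem' := by
    refine ⟨⟨fun U s hU hs e he => ?_, fun γ y p a => ?_⟩, fun U s hU hs e he v hv a b => ?_⟩
    · simp only [Pi.zero_apply]; rw [inChart_zero]; exact contDiffOn_const
    · exact (map_zero (σ γ⁻¹)).symm
    · simp only [Pi.zero_apply]; rw [inChart_zero]; simp
  add_mem' := by
    rintro η η' ⟨⟨h1, h2⟩, h3⟩ ⟨⟨h1', h2'⟩, h3'⟩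
    refine ⟨⟨fun U s hU hs e he => ?_, fun γ y p a => ?_⟩, fun U s hU hs e he v hv a b => ?_⟩
    · simp only [Pi.add_apply]; rw [inChart_add]
      exact (h1 U s hU hs e he).add (h1' U s hU hs e he)
    · change η y _ a + η' y _ a = σ γ⁻¹ (η y p a + η' y p a)
      rw [h2, h2', map_add]
    · simp only [Pi.add_apply]; rw [inChart_add]
      rw [fderiv_add (h1.differentiableAt hU hs he hv) (h1'.differentiableAt hU hs he hv)]
      simp only [_root_.add_apply]
      rw [h3 U s hU hs e he v hv a b, h3' U s hU hs e he v hv a b]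
  smul_mem' := by
    rintro c η ⟨⟨h1, h2⟩, h3⟩
    refine ⟨⟨fun U s hU hs e he => ?_, fun γ y p a => ?_⟩, fun U s hU hs e he v hv a b => ?_⟩
    · simp only [Pi.smul_apply]; rw [inChart_smul]
      exact (h1 U s hU hs e he).const_smul c
    · change c • η y _ a = σ γ⁻¹ (c • η y p a)
      rw [h2, map_smul]
    · simp only [Pi.smul_apply]; rw [inChart_smul]
      rw [fderiv_const_smul (h1.differentiableAt hU hs he hv)]
      simp only [_root_.smul_apply]
      rw [h3 U s hU hs e he v hv a b]

lemma isBundleSection_zero : IsBundleSection σ (0 : CoverFun x₀ V) :=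
  ⟨fun _ _ _ _ => contMDiffOn_const, fun γ _ _ => (map_zero (σ γ⁻¹)).symm⟩

variable {σ} in
lemma IsBundleSection.add {f f' : CoverFun x₀ V} (h : IsBundleSection σ f)
    (h' : IsBundleSection σ f') : IsBundleSection σ (f + f') :=
  ⟨fun U s hU hs => (h.1 U s hU hs).add (h'.1 U s hU hs), fun γ y p => by
    simp only [Pi.add_apply]; rw [h.2, h'.2, map_add]⟩

variable {σ} in
lemma IsBundleSection.smul {f : CoverFun x₀ V} (h : IsBundleSection σ f) (c : k) :
    IsBundleSection σ (c • f) := by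
  refine ⟨fun U s hU hs => ?_, fun γ y p => by simp only [Pi.smul_apply]; rw [h.2, map_smul]⟩
  have hc : ContDiff ℝ ∞ (fun v : V => c • v) := contDiff_id.const_smul c
  exact hc.contMDiff.comp_contMDiffOn (h.1 U s hU hs)

lemma CoverFun.IsSmooth.mdifferentiableAt {f : CoverFun x₀ V} (h : f.IsSmooth) {U : Set M}
    {s : ∀ y : M, Path.Homotopic.Quotient x₀ y} (hU : IsOpen U) (hs : IsLift U s) {y : M}
    (hy : y ∈ U) : MDifferentiableAt 𝓘(ℝ, Plane) 𝓘(ℝ, V) (fun z => f z (s z)) y :=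
  ((h U s hU hs).contMDiffAt (hU.mem_nhds hy)).mdifferentiableAt (by simp)

lemma isDifferential_zero : IsDifferential (0 : CoverFun x₀ V) (0 : CoverForm x₀ V) :=
  fun _ _ _ _ _ _ => mfderiv_const.symm

lemma IsDifferential.add {f f' : CoverFun x₀ V} {η η' : CoverForm x₀ V}
    (h : IsDifferential f η) (hf : f.IsSmooth) (hf' : f'.IsSmooth) (h' : IsDifferential f' η') :
    IsDifferential (f + f') (η + η') := by
  intro U s hU hs y hy
  have := mfderiv_add (hf.mdifferentiableAt hU hs hy) (hf'.mdifferentiableAt hU hs hy)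
  refine Eq.trans ?_ this.symm
  rw [← h U s hU hs y hy, ← h' U s hU hs y hy]
  rfl

lemma IsDifferential.smul {f : CoverFun x₀ V} {η : CoverForm x₀ V}
    (h : IsDifferential f η) (hf : f.IsSmooth) (c : k) : IsDifferential (c • f) (c • η) := by
  intro U s hU hs y hy
  have h1 := (hf.mdifferentiableAt hU hs hy).hasMFDerivAt
  have hc : HasFDerivAt (fun v : V => c • v) (c • ContinuousLinearMap.id ℝ V) (f y (s y)) :=
    (hasFDerivAt_id _).const_smul c
  have h2 := (hc.hasMFDerivAt.comp y h1).mfderiv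
  refine Eq.trans ?_ h2.symm
  rw [← h U s hU hs y hy]
  rfl

lemma hasCompactSupp_zero {W : M → Type*} [∀ y, Zero (W y)] :
    HasCompactSupp (0 : ∀ y : M, Path.Homotopic.Quotient x₀ y → W y) :=
  ⟨∅, isCompact_empty, fun _ _ _ => rfl⟩

lemma HasCompactSupp.add {W : M → Type*} [∀ y, AddMonoid (W y)]
    {η η' : ∀ y : M, Path.Homotopic.Quotient x₀ y → W y}
    (h : HasCompactSupp η) (h' : HasCompactSupp η') : HasCompactSupp (η + η') := by
  obtain ⟨K, hK, h⟩ := h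
  obtain ⟨K', hK', h'⟩ := h'
  refine ⟨K ∪ K', hK.union hK', fun y hy p => ?_⟩
  simp only [Set.mem_union, not_or] at hy
  simp [h y hy.1, h' y hy.2]

lemma HasCompactSupp.smul {R : Type*} [Zero R] {W : M → Type*} [∀ y, Zero (W y)]
    [∀ y, SMulZeroClass R (W y)] {η : ∀ y : M, Path.Homotopic.Quotient x₀ y → W y}
    (h : HasCompactSupp η) (c : R) : HasCompactSupp (c • η) := by
  obtain ⟨K, hK, h⟩ := h
  exact ⟨K, hK, fun y hy p => by simp [h y hy]⟩

/-- The exact 1-forms `B¹`: the differentials of the smooth sections of the flat bundle. -/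
def exactForms : Submodule k (CoverForm x₀ V) where
  carrier := {η | ∃ f : CoverFun x₀ V, IsBundleSection σ f ∧ IsDifferential f η}
  zero_mem' := ⟨0, isBundleSection_zero σ, isDifferential_zero⟩
  add_mem' := by
    rintro η η' ⟨f, hf, h⟩ ⟨f', hf', h'⟩
    exact ⟨f + f', hf.add hf', h.add hf.1 hf'.1 h'⟩
  smul_mem' := by
    rintro c η ⟨f, hf, h⟩
    exact ⟨c • f, hf.smul c, h.smul hf.1 c⟩

/-- The closed smooth 1-forms with compact support. -/
def closedFormsCpt : Submodule k (CoverForm x₀ V) where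
  carrier := {η | η ∈ closedForms σ ∧ HasCompactSupp η}
  zero_mem' := ⟨zero_mem _, hasCompactSupp_zero⟩
  add_mem' h h' := ⟨add_mem h.1 h'.1, h.2.add h'.2⟩
  smul_mem' c _ h := ⟨Submodule.smul_mem _ c h.1, h.2.smul c⟩

/-- The differentials of the smooth sections of the flat bundle with compact support. -/
def exactFormsCpt : Submodule k (CoverForm x₀ V) where
  carrier := {η | ∃ f : CoverFun x₀ V,
    IsBundleSection σ f ∧ HasCompactSupp f ∧ IsDifferential f η}
  zero_mem' := ⟨0, isBundleSection_zero σ, hasCompactSupp_zero, isDifferential_zero⟩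
  add_mem' := by
    rintro η η' ⟨f, hf, hc, h⟩ ⟨f', hf', hc', h'⟩
    exact ⟨f + f', hf.add hf', hc.add hc', h.add hf.1 hf'.1 h'⟩
  smul_mem' := by
    rintro c η ⟨f, hf, hc, h⟩
    exact ⟨c • f, hf.smul c, hc.smul c, h.smul hf.1 c⟩

/-- `H¹(M, L)` for the local system `L` of flat sections: closed forms modulo exact forms. -/
def H1 : Type _ := ↥(closedForms σ) ⧸ (exactForms σ).submoduleOf (closedForms σ)

/-- `H¹_c(M, L)`: closed forms with compact support modulo the differentials of sections with
compact support. -/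
def H1c : Type _ := ↥(closedFormsCpt σ) ⧸ (exactFormsCpt σ).submoduleOf (closedFormsCpt σ)

instance : AddCommGroup (H1 σ) :=
  inferInstanceAs (AddCommGroup (↥(closedForms σ) ⧸ (exactForms σ).submoduleOf (closedForms σ)))

instance : Module k (H1 σ) :=
  inferInstanceAs (Module k (↥(closedForms σ) ⧸ (exactForms σ).submoduleOf (closedForms σ)))

instance : AddCommGroup (H1c σ) :=
  inferInstanceAs
    (AddCommGroup (↥(closedFormsCpt σ) ⧸ (exactFormsCpt σ).submoduleOf (closedFormsCpt σ)))

instance : Module k (H1c σ) :=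
  inferInstanceAs
    (Module k (↥(closedFormsCpt σ) ⧸ (exactFormsCpt σ).submoduleOf (closedFormsCpt σ)))

lemma closedFormsCpt_le : closedFormsCpt σ ≤ closedForms σ := fun _ h => h.1

lemma exactFormsCpt_le : exactFormsCpt σ ≤ exactForms σ := fun _ ⟨f, hf, _, h⟩ => ⟨f, hf, h⟩

/-- The class of a closed form. -/
def H1.mk : ↥(closedForms σ) →ₗ[k] H1 σ :=
  Submodule.mkQ ((exactForms σ).submoduleOf (closedForms σ))

/-- The class of a closed form with compact support. -/
def H1c.mk : ↥(closedFormsCpt σ) →ₗ[k] H1c σ :=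
  Submodule.mkQ ((exactFormsCpt σ).submoduleOf (closedFormsCpt σ))

/-- The natural map `H¹_c(M, L) → H¹(M, L)`, induced by the inclusion of the forms with compact
support into all forms. -/
def forgetSupport : H1c σ →ₗ[k] H1 σ :=
  Submodule.mapQ ((exactFormsCpt σ).submoduleOf (closedFormsCpt σ))
    ((exactForms σ).submoduleOf (closedForms σ)) (Submodule.inclusion (closedFormsCpt_le σ))
    (fun _ h => exactFormsCpt_le σ h)

/-! ### The pairing -/

/-- The 2-form `B(α ∧ β)` on `M`. For equivariant `α`, `β` and invariant `B`, it does not depend on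
the choice of the path class. -/
def wedge (B : LinearMap.BilinForm k V) (α β : CoverForm x₀ V) (y : M)
    (a b : TangentSpace 𝓘(ℝ, Plane) y) : k :=
  open scoped Classical in
  if h : Nonempty (Path.Homotopic.Quotient x₀ y) then
    B (α y h.some a) (β y h.some b) - B (α y h.some b) (β y h.some a)
  else 0

/-- A smooth partition of unity on `M` that is subordinate to the sources of the charts. -/
def chartPartition (M : Type*) [TopologicalSpace M] [T2Space M] [SigmaCompactSpace M]
    [ChartedSpace Plane M] [IsManifold 𝓘(ℝ, Plane) ∞ M] :
    SmoothPartitionOfUnity M 𝓘(ℝ, Plane) M Set.univ :=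
  (SmoothPartitionOfUnity.exists_isSubordinate_chartAt_source 𝓘(ℝ, Plane) M).choose

/-- The integral of a compactly supported `k`-valued 2-form over a surface `M` whose charts form an
oriented atlas. -/
def integral [T2Space M] [SigmaCompactSpace M] [IsManifold 𝓘(ℝ, Plane) ∞ M]
    (Θ : ∀ y : M, TangentSpace 𝓘(ℝ, Plane) y → TangentSpace 𝓘(ℝ, Plane) y → k) : k :=
  ∑ᶠ i : M, ∫ v in (chartAt Plane i).target,
    chartPartition M i ((chartAt Plane i).symm v) •
      Θ ((chartAt Plane i).symm v)
        (mfderiv 𝓘(ℝ, Plane) 𝓘(ℝ, Plane) (chartAt Plane i).symm v (EuclideanSpace.single 0 1))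
        (mfderiv 𝓘(ℝ, Plane) 𝓘(ℝ, Plane) (chartAt Plane i).symm v (EuclideanSpace.single 1 1))

end Forms

/-- The subspace `⋀² T ⊆ T ⊗ T`, spanned by the `v ∧ w = v ⊗ w - w ⊗ v`. -/
def wedgeSquare (k T : Type*) [CommRing k] [AddCommGroup T] [Module k T] :
    Submodule k (T ⊗[k] T) :=
  Submodule.span k {t | ∃ v w : T, t = v ⊗ₜ w - w ⊗ₜ v}

/-- The linear map `T* → T` defined by an element of `T ⊗ T`, through `v ⊗ w ↦ (ξ ↦ ξ(v) w)`. -/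
def contract {k T : Type*} [CommRing k] [AddCommGroup T] [Module k T] (Φ : T ⊗[k] T)
    (ξ : T →ₗ[k] k) : T :=
  TensorProduct.lid k T (LinearMap.rTensor T ξ Φ)

end FlatSurface

end

/-! Write `L` for the local system of flat sections. The pairing descends to cohomology by Stokes'
theorem, applied to a section with compact support or to a closed form with compact support. Its
skew-symmetry is already true for forms, because `B` is symmetric and the wedge product of 1-forms
is alternating. The remaining claims are linear algebra once two facts about the surface are known.

The first fact is one half of Poincaré duality: a closed form `β` orthogonal to all closed forms
with compact support is exact (`mem_exactForms_of_orthogonal`). For such a `β` the number `∫ B(η ∧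
β)` depends only on `dη`, for `η` with compact support, so it is `T(dη)` for a linear functional `T`
on 2-forms. This `T` plays the role of a distributional primitive of `β`. On a box, a 2-form with
compact support and integral zero is the differential of a 1-form with compact support
(`exists_curl_eq`). Hence `T` is there integration against a genuine primitive of `β`, whose
additive constant is fixed by the value of `T` on bump functions of integral one. Since `T` is
global and `B` is nondegenerate, the primitives on different boxes agree
(`representing_primitives_agree`), and they glue to a global primitive.

The second fact is that the image of `H¹_c(L)` in `H¹(L)` is finite dimensional
(`finiteDimensional_range_forgetSupport_punctured`). The surface has a finite cover by discs and
punctured discs. A closed form with compact support has a primitive on each of them; it vanishes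
near every puncture, so there is no monodromy around a puncture to obstruct this. Two primitives
differ by flat sections, and on relatively compact overlaps these are determined by their values at
finitely many points. If the differences vanish, then the primitives glue and the form is exact.

By the first fact the pairing separates the points of `H¹(L)`, so a tensor is determined by its
contractions (`eq_of_contract_eq`), which gives uniqueness. By the second the natural map has finite
rank. Dual bases for its image then produce the tensor, and skew-symmetry of the map makes it a
bivector (`exists_bivector`). Finiteness of `H¹(L)` itself and the other half of duality are not
needed. -/

noncomputable section

namespace FlatSurface

/-! ### Path classes and lifts -/

section Lifts

variable {M : Type*} [TopologicalSpace M] {x₀ : M}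

/-- The loop class `p q⁻¹`, for two path classes `p`, `q` from `x₀` to the same point. -/
def loopOf {y : M} (p q : Path.Homotopic.Quotient x₀ y) : FundamentalGroup M x₀ :=
  FundamentalGroup.fromPath (p.trans q.symm)

lemma loopOf_trans {y : M} (p q : Path.Homotopic.Quotient x₀ y) :
    (loopOf p q).toPath.trans q = p := by
  change (p.trans q.symm).trans q = p
  simp

lemma loopOf_eq {y : M} {p q : Path.Homotopic.Quotient x₀ y} {γ : FundamentalGroup M x₀}
    (h : γ.toPath.trans q = p) : loopOf p q = γ := by
  subst h
  change (Path.Homotopic.Quotient.trans γ q).trans q.symm = γ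
  simp

lemma loopOf_self {y : M} (p : Path.Homotopic.Quotient x₀ y) : loopOf p p = 1 := by
  change p.trans p.symm = Path.Homotopic.Quotient.refl x₀
  simp

/-- The factor `γ` appears on the right because the product in the fundamental group is
concatenation in the opposite order. After inversion `σ γ⁻¹` stands on the left, which is the
equivariance of sections. -/
lemma loopOf_mul {y : M} (p q : Path.Homotopic.Quotient x₀ y) (γ : FundamentalGroup M x₀) :
    loopOf (γ.toPath.trans p) q = loopOf p q * γ := by
  change (Path.Homotopic.Quotient.trans γ p).trans q.symm =
    Path.Homotopic.Quotient.trans γ (p.trans q.symm)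
  simp

lemma toPath_one_trans {y : M} (p : Path.Homotopic.Quotient x₀ y) :
    (1 : FundamentalGroup M x₀).toPath.trans p = p := by
  change (Path.Homotopic.Quotient.refl x₀).trans p = p
  simp

lemma toPath_mul_trans {y : M} (p : Path.Homotopic.Quotient x₀ y) (γ γ' : FundamentalGroup M x₀) :
    (γ * γ').toPath.trans p = γ'.toPath.trans (γ.toPath.trans p) := by
  change (Path.Homotopic.Quotient.trans γ' γ).trans p = Path.Homotopic.Quotient.trans γ' (Path.Homotopic.Quotient.trans γ p)
  simp

lemma IsLift.mono {U U' : Set M} {s : ∀ y : M, Path.Homotopic.Quotient x₀ y} (h : IsLift U s)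
    (hU : U' ⊆ U) : IsLift U' s := fun _ _ r hr => h r fun t => hU (hr t)

lemma IsLift.translate {U : Set M} {s : ∀ y : M, Path.Homotopic.Quotient x₀ y} (h : IsLift U s)
    (γ : FundamentalGroup M x₀) : IsLift U (fun y => γ.toPath.trans (s y)) := by
  intro y z r hr
  change γ.toPath.trans (s z) = (γ.toPath.trans (s y)).trans _
  rw [h r hr, Path.Homotopic.Quotient.trans_assoc]

/-- A lift is determined on a path-connected set by its value at one point, so the deck
transformation that matches the two lifts at `y₀` matches them everywhere on `N`. -/
lemma IsLift.eq_translate {U U' N : Set M} {s s' : ∀ y : M, Path.Homotopic.Quotient x₀ y}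
    (h : IsLift U s) (h' : IsLift U' s') (hN : N ⊆ U) (hN' : N ⊆ U') (hNc : IsPathConnected N) :
    ∃ γ : FundamentalGroup M x₀, ∀ y ∈ N, s' y = γ.toPath.trans (s y) := by
  obtain ⟨y₀, hy₀⟩ := hNc.nonempty
  refine ⟨loopOf (s' y₀) (s y₀), fun y hy => ?_⟩
  obtain ⟨r, hr⟩ := hNc.joinedIn y₀ hy₀ y hy
  rw [h r fun t => hN (hr t), h' r fun t => hN' (hr t), ← Path.Homotopic.Quotient.trans_assoc,
    loopOf_trans]

variable {E : Type*} [NormedAddCommGroup E] [NormedSpace ℝ E]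

lemma isPathConnected_chart_image (e : OpenPartialHomeomorph M E) {Q : Set E} (hQ : Convex ℝ Q)
    (hne : Q.Nonempty) (hQe : Q ⊆ e.target) : IsPathConnected (e.symm '' Q) :=
  (hQ.isPathConnected hne).image' (e.continuousOn_symm.mono hQe)

/-- Convex subsets of a chart have lifts to the universal cover, with any given value at a
point. -/
lemma exists_isLift [PathConnectedSpace M] (e : OpenPartialHomeomorph M E) {Q : Set E}
    (hQ : Convex ℝ Q) (hQe : Q ⊆ e.target) {y₀ : M} (hy₀ : y₀ ∈ e.symm '' Q)
    (p₀ : Path.Homotopic.Quotient x₀ y₀) :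
    ∃ s : ∀ y : M, Path.Homotopic.Quotient x₀ y, IsLift (e.symm '' Q) s ∧ s y₀ = p₀ := by
  classical
  have hpc := isPathConnected_chart_image e hQ (hy₀.imp fun _ h => h.1) hQe
  -- Paths inside the image of `Q` with the same ends are homotopic: they come from paths in the
  -- convex, hence simply connected, set `Q`. This makes the lift below independent of the chosen
  -- paths.
  have key : ∀ {y z : M} (r r' : Path y z), (∀ t, r t ∈ e.symm '' Q) →
      (∀ t, r' t ∈ e.symm '' Q) →
      Path.Homotopic.Quotient.mk r = Path.Homotopic.Quotient.mk r' := by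
    intro y z r r' hr hr'
    have hmem : ∀ y ∈ e.symm '' Q, y ∈ e.source ∧ e y ∈ Q := by
      rintro _ ⟨v, hv, rfl⟩
      exact ⟨e.map_target (hQe hv), by rwa [e.right_inv (hQe hv)]⟩
    have hy : y ∈ e.symm '' Q := by simpa using hr 0
    have hz : z ∈ e.symm '' Q := by simpa using hr 1
    have : ContractibleSpace Q := hQ.contractibleSpace (hy.imp fun _ h => h.1)
    let F : C(Q, M) := ⟨fun v => e.symm v, e.continuousOn_symm.comp_continuous
      continuous_subtype_val fun v => hQe v.2⟩
    let lift : ∀ r : Path y z, (∀ t, r t ∈ e.symm '' Q) →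
        Path (⟨e y, (hmem y hy).2⟩ : Q) ⟨e z, (hmem z hz).2⟩ := fun r hr =>
      { toFun := fun t => ⟨e (r t), (hmem _ (hr t)).2⟩
        continuous_toFun := (e.continuousOn.comp_continuous r.continuous
          fun t => (hmem _ (hr t)).1).subtype_mk _
        source' := by simp
        target' := by simp }
    have h1 : ∀ r hr, ((lift r hr).map F.continuous).cast
        (e.left_inv (hmem y hy).1).symm (e.left_inv (hmem z hz).1).symm = r := by
      intro r hr
      ext t
      exact e.left_inv (hmem _ (hr t)).1
    have h2 := (SimplyConnectedSpace.paths_homotopic (lift r hr) (lift r' hr')).map F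
    rw [← h1 r hr, ← h1 r' hr']
    exact Path.Homotopic.Quotient.eq.2 (h2.pathCast _ _)
  -- Outside of the disc the value is arbitrary, since `IsLift` only concerns paths that stay in the
  -- disc.
  let s : ∀ y : M, Path.Homotopic.Quotient x₀ y := fun y =>
    if h : y ∈ e.symm '' Q then
      p₀.trans (Path.Homotopic.Quotient.mk (hpc.joinedIn y₀ hy₀ y h).somePath)
    else Path.Homotopic.Quotient.mk (PathConnectedSpace.somePath x₀ y)
  have hs : ∀ y (r : Path y₀ y), (∀ t, r t ∈ e.symm '' Q) →
      s y = p₀.trans (Path.Homotopic.Quotient.mk r) := by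
    intro y r hr
    have hy : y ∈ e.symm '' Q := by simpa using hr 1
    simp only [s, dif_pos hy]
    rw [key _ r (hpc.joinedIn y₀ hy₀ y hy).somePath_mem hr]
  refine ⟨s, fun y z r hr => ?_, ?_⟩
  · have hy : y ∈ e.symm '' Q := by simpa using hr 0
    obtain ⟨r₁, hr₁⟩ := hpc.joinedIn y₀ hy₀ y hy
    rw [hs y r₁ hr₁, hs z (r₁.trans r), Path.Homotopic.Quotient.mk_trans,
      Path.Homotopic.Quotient.trans_assoc]
    intro t
    have : r₁.trans r t ∈ Set.range (r₁.trans r) := ⟨t, rfl⟩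
    rw [Path.trans_range] at this
    rcases this with ⟨t', h⟩ | ⟨t', h⟩ <;> rw [← h]
    exacts [hr₁ t', hr t']
  · rw [hs y₀ (Path.refl y₀) fun t => hy₀, Path.Homotopic.Quotient.mk_refl,
      Path.Homotopic.Quotient.trans_refl]

end Lifts

/-! ### Forms in charts -/

section Charts

set_option linter.unusedSectionVars false

open IsManifold Filter Topology

variable {V : Type*} [NormedAddCommGroup V] [NormedSpace ℝ V]
  {M : Type*} [TopologicalSpace M] [ChartedSpace Plane M] [IsManifold 𝓘(ℝ, Plane) ∞ M]
  {e e' : OpenPartialHomeomorph M Plane}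

lemma mdifferentiableAt_chart_symm (he : e ∈ maximalAtlas 𝓘(ℝ, Plane) ∞ M) {v : Plane}
    (hv : v ∈ e.target) : MDifferentiableAt 𝓘(ℝ, Plane) 𝓘(ℝ, Plane) e.symm v :=
  ((contMDiffOn_symm_of_mem_maximalAtlas he).contMDiffAt
    (e.open_target.mem_nhds hv)).mdifferentiableAt (by simp)

lemma mdifferentiableAt_chart (he : e ∈ maximalAtlas 𝓘(ℝ, Plane) ∞ M) {y : M}
    (hy : y ∈ e.source) : MDifferentiableAt 𝓘(ℝ, Plane) 𝓘(ℝ, Plane) e y :=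
  ((contMDiffOn_of_mem_maximalAtlas he).contMDiffAt
    (e.open_source.mem_nhds hy)).mdifferentiableAt (by simp)

lemma contDiffOn_transition (he : e ∈ maximalAtlas 𝓘(ℝ, Plane) ∞ M)
    (he' : e' ∈ maximalAtlas 𝓘(ℝ, Plane) ∞ M) :
    ContDiffOn ℝ ∞ (e ∘ e'.symm) (e'.target ∩ e'.symm ⁻¹' e.source) := by
  rw [← contMDiffOn_iff_contDiffOn]
  exact (contMDiffOn_of_mem_maximalAtlas he).comp
    ((contMDiffOn_symm_of_mem_maximalAtlas he').mono Set.inter_subset_left)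
    Set.inter_subset_right

lemma isOpen_transition (e e' : OpenPartialHomeomorph M Plane) :
    IsOpen (e'.target ∩ e'.symm ⁻¹' e.source) :=
  e'.isOpen_inter_preimage_symm e.open_source

lemma contDiffAt_transition (he : e ∈ maximalAtlas 𝓘(ℝ, Plane) ∞ M)
    (he' : e' ∈ maximalAtlas 𝓘(ℝ, Plane) ∞ M) {v : Plane}
    (hv : v ∈ e'.target ∩ e'.symm ⁻¹' e.source) : ContDiffAt ℝ ∞ (e ∘ e'.symm) v :=
  (contDiffOn_transition he he').contDiffAt ((isOpen_transition e e').mem_nhds hv)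

lemma mfderiv_chart_symm_transition (he : e ∈ maximalAtlas 𝓘(ℝ, Plane) ∞ M)
    (he' : e' ∈ maximalAtlas 𝓘(ℝ, Plane) ∞ M) {v : Plane}
    (hv : v ∈ e'.target ∩ e'.symm ⁻¹' e.source) :
    (mfderiv 𝓘(ℝ, Plane) 𝓘(ℝ, Plane) e'.symm v : Plane →L[ℝ] Plane) =
      (mfderiv 𝓘(ℝ, Plane) 𝓘(ℝ, Plane) e.symm (e (e'.symm v)) : Plane →L[ℝ] Plane).comp
        (fderiv ℝ (e ∘ e'.symm) v) := by
  have h1 : e'.symm =ᶠ[𝓝 v] e.symm ∘ (e ∘ e'.symm) := by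
    filter_upwards [(isOpen_transition e e').mem_nhds hv] with w hw
    exact (e.left_inv hw.2).symm
  have h2 := ((contDiffAt_transition he he' hv).differentiableAt (by simp)).mdifferentiableAt
  have h3 := mdifferentiableAt_chart_symm he (e.map_source hv.2)
  have h4 := mfderiv_comp (I := 𝓘(ℝ, Plane)) (I' := 𝓘(ℝ, Plane)) (I'' := 𝓘(ℝ, Plane)) v h3 h2
  rw [mfderiv_eq_fderiv] at h4
  exact h1.mfderiv_eq.trans h4

lemma inChart_transition (he : e ∈ maximalAtlas 𝓘(ℝ, Plane) ∞ M)
    (he' : e' ∈ maximalAtlas 𝓘(ℝ, Plane) ∞ M)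
    (θ : ∀ y : M, TangentSpace 𝓘(ℝ, Plane) y →L[ℝ] V) {v : Plane}
    (hv : v ∈ e'.target ∩ e'.symm ⁻¹' e.source) :
    inChart e' θ v = (inChart e θ (e (e'.symm v))).comp (fderiv ℝ (e ∘ e'.symm) v) := by
  have h : ∀ y, y = e'.symm v → (θ (e'.symm v) : Plane →L[ℝ] V) = θ y := by rintro _ rfl; rfl
  unfold inChart
  rw [mfderiv_chart_symm_transition he he' hv]
  change (θ (e'.symm v) : Plane →L[ℝ] V).comp _ = _
  rw [h _ (e.left_inv hv.2)]
  rfl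

/-- The derivatives of a chart and of its inverse are inverse to each other. -/
lemma mfderiv_chart_symm_comp (he : e ∈ maximalAtlas 𝓘(ℝ, Plane) ∞ M) {y : M}
    (hy : y ∈ e.source) :
    (mfderiv 𝓘(ℝ, Plane) 𝓘(ℝ, Plane) e.symm (e y) : Plane →L[ℝ] Plane).comp
      (mfderiv 𝓘(ℝ, Plane) 𝓘(ℝ, Plane) e y) = ContinuousLinearMap.id ℝ Plane := by
  have h1 : e.symm ∘ e =ᶠ[𝓝 y] id := by
    filter_upwards [e.open_source.mem_nhds hy] with z hz
    exact e.left_inv hz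
  have h3 := mdifferentiableAt_chart_symm he (e.map_source hy)
  have h4 := mfderiv_comp (I := 𝓘(ℝ, Plane)) (I' := 𝓘(ℝ, Plane)) (I'' := 𝓘(ℝ, Plane)) y h3
    (mdifferentiableAt_chart he hy)
  exact h4.symm.trans (h1.mfderiv_eq.trans mfderiv_id)

lemma mfderiv_chart_comp_symm (he : e ∈ maximalAtlas 𝓘(ℝ, Plane) ∞ M) {v : Plane}
    (hv : v ∈ e.target) :
    (mfderiv 𝓘(ℝ, Plane) 𝓘(ℝ, Plane) e (e.symm v) : Plane →L[ℝ] Plane).comp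
      (mfderiv 𝓘(ℝ, Plane) 𝓘(ℝ, Plane) e.symm v) = ContinuousLinearMap.id ℝ Plane := by
  have h1 : e ∘ e.symm =ᶠ[𝓝 v] id := by
    filter_upwards [e.open_target.mem_nhds hv] with z hz
    exact e.right_inv hz
  have h3 := mdifferentiableAt_chart he (e.map_target hv)
  have h4 := mfderiv_comp (I := 𝓘(ℝ, Plane)) (I' := 𝓘(ℝ, Plane)) (I'' := 𝓘(ℝ, Plane)) v h3
    (mdifferentiableAt_chart_symm he hv)
  exact h4.symm.trans (h1.mfderiv_eq.trans mfderiv_id)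

/-- The derivative of a function on `M`, computed in a chart. -/
lemma hasMFDerivAt_iff_chart (he : e ∈ maximalAtlas 𝓘(ℝ, Plane) ∞ M) {f : M → V} {y : M}
    (hy : y ∈ e.source) (θ : ∀ y : M, TangentSpace 𝓘(ℝ, Plane) y →L[ℝ] V) :
    HasMFDerivAt 𝓘(ℝ, Plane) 𝓘(ℝ, V) f y (θ y) ↔
      HasFDerivAt (f ∘ e.symm) (inChart e θ (e y)) (e y) := by
  have h : ∀ z, z = y → (θ z : Plane →L[ℝ] V) = θ y := by rintro _ rfl; rfl
  have h' : inChart e θ (e y) = (θ y : Plane →L[ℝ] V).comp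
      (mfderiv 𝓘(ℝ, Plane) 𝓘(ℝ, Plane) e.symm (e y)) := by
    unfold inChart
    change (θ (e.symm (e y)) : Plane →L[ℝ] V).comp _ = _
    rw [h _ (e.left_inv hy)]
    rfl
  rw [h']
  refine Iff.trans ?_ hasMFDerivAt_iff_hasFDerivAt
  constructor
  · intro hf
    have h2 := (mdifferentiableAt_chart_symm he (e.map_source hy)).hasMFDerivAt
    have h3 : ∀ z, z = y → HasMFDerivAt 𝓘(ℝ, Plane) 𝓘(ℝ, V) f z (θ y : Plane →L[ℝ] V) := by
      rintro _ rfl; exact hf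
    exact HasMFDerivAt.comp (e y) (h3 _ (e.left_inv hy)) h2
  · intro hf
    have h2 := (mdifferentiableAt_chart he hy).hasMFDerivAt
    have h3 := HasMFDerivAt.comp y hf h2
    have h4 : f =ᶠ[𝓝 y] (f ∘ e.symm) ∘ e := by
      filter_upwards [e.open_source.mem_nhds hy] with z hz
      exact congrArg f (e.left_inv hz).symm
    refine (h3.congr_of_eventuallyEq h4).congr_mfderiv ?_
    exact congrArg (ContinuousLinearMap.comp (θ y : Plane →L[ℝ] V)) (mfderiv_chart_symm_comp he hy)

/-- The coefficient `∂₀ζ₁ - ∂₁ζ₀` of the differential of a 1-form on the plane. -/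
def curl (ζ : Plane → Plane →L[ℝ] V) (v : Plane) : V :=
  fderiv ℝ ζ v (EuclideanSpace.single 0 1) (EuclideanSpace.single 1 1) -
    fderiv ℝ ζ v (EuclideanSpace.single 1 1) (EuclideanSpace.single 0 1)

lemma plane_eq (a : Plane) :
    a = a 0 • EuclideanSpace.single 0 (1 : ℝ) + a 1 • EuclideanSpace.single 1 (1 : ℝ) := by
  ext i; fin_cases i <;> simp

/-- The standard area form of the plane. -/
def area (a b : Plane) : ℝ := a 0 * b 1 - a 1 * b 0

/-- Alternating bilinear maps on the plane are multiples of the area form, so a single coefficient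
describes the differential of a 1-form. -/
lemma bilin_antisymm_plane (L : Plane →L[ℝ] Plane →L[ℝ] V) (a b : Plane) :
    L a b - L b a = area a b • (L (EuclideanSpace.single 0 1) (EuclideanSpace.single 1 1) -
      L (EuclideanSpace.single 1 1) (EuclideanSpace.single 0 1)) := by
  conv_lhs => rw [plane_eq a, plane_eq b]
  simp only [map_add, map_smul, add_apply, smul_apply, area]
  module

lemma area_map (T : Plane →L[ℝ] Plane) (a b : Plane) : area (T a) (T b) = T.det * area a b := by
  have hdet : T.det = T (EuclideanSpace.single 0 1) 0 * T (EuclideanSpace.single 1 1) 1 -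
      T (EuclideanSpace.single 1 1) 0 * T (EuclideanSpace.single 0 1) 1 := by
    rw [ContinuousLinearMap.det, ← LinearMap.det_toMatrix (EuclideanSpace.basisFun (Fin 2) ℝ).toBasis,
      Matrix.det_fin_two]
    simp [LinearMap.toMatrix_apply]
  rw [hdet]
  conv_lhs => rw [plane_eq a, plane_eq b]
  simp only [map_add, map_smul, area, PiLp.add_apply, PiLp.smul_apply, smul_eq_mul]
  ring

lemma curl_eq_zero_iff (ζ : Plane → Plane →L[ℝ] V) (v : Plane) :
    curl ζ v = 0 ↔ ∀ a b, fderiv ℝ ζ v a b = fderiv ℝ ζ v b a := by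
  refine ⟨fun h a b => ?_, fun h => sub_eq_zero.2 (h _ _)⟩
  have := bilin_antisymm_plane (fderiv ℝ ζ v) a b
  unfold curl at h
  rw [h, smul_zero] at this
  exact sub_eq_zero.1 this

/-- Curl of a pulled back 1-form. -/
lemma curl_pullback {ζ : Plane → Plane →L[ℝ] V} {τ : Plane → Plane} {v : Plane}
    (hζ : DifferentiableAt ℝ ζ (τ v)) (hτ : ContDiffAt ℝ ∞ τ v) :
    curl (fun w => (ζ (τ w)).comp (fderiv ℝ τ w)) v = (fderiv ℝ τ v).det • curl ζ (τ v) := by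
  have hτ1 : HasFDerivAt τ (fderiv ℝ τ v) v := (hτ.differentiableAt (by simp)).hasFDerivAt
  have hm : (1 + 1 : WithTop ℕ∞) ≤ ∞ := by
    rw [one_add_one_eq_two]; exact WithTop.coe_le_coe.2 le_top
  have hτ2 : HasFDerivAt (fderiv ℝ τ) (fderiv ℝ (fderiv ℝ τ) v) v :=
    ((hτ.fderiv_right (m := 1) hm).differentiableAt
      (by simp)).hasFDerivAt
  have hsymm : ∀ a b, fderiv ℝ (fderiv ℝ τ) v a b = fderiv ℝ (fderiv ℝ τ) v b a :=
    (hτ.isSymmSndFDerivAt (by simpa [one_add_one_eq_two] using hm)).eq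
  have h := (hζ.hasFDerivAt.comp v hτ1).clm_comp hτ2
  have h' : ∀ a b, fderiv ℝ (fun w => (ζ (τ w)).comp (fderiv ℝ τ w)) v a b =
      ζ (τ v) (fderiv ℝ (fderiv ℝ τ) v a b) +
        fderiv ℝ ζ (τ v) (fderiv ℝ τ v a) (fderiv ℝ τ v b) := by
    intro a b
    have h'' := h.fderiv
    simp only [Function.comp_apply] at h''
    rw [h'']
    simp
  -- The terms with second derivatives of `τ` are symmetric and cancel; what is left is the
  -- alternating part of `fderiv ℝ ζ`, which `τ` multiplies by its Jacobian determinant.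
  rw [curl, h', h', hsymm, add_sub_add_left_eq_sub, bilin_antisymm_plane, area_map]
  simp [area, curl]

lemma curl_congr {ζ ζ' : Plane → Plane →L[ℝ] V} {v : Plane} (h : ζ =ᶠ[𝓝 v] ζ') :
    curl ζ v = curl ζ' v := by
  rw [curl, curl, h.fderiv_eq]

variable {θ : ∀ y : M, TangentSpace 𝓘(ℝ, Plane) y →L[ℝ] V}

lemma inChart_transition_eventuallyEq (he : e ∈ maximalAtlas 𝓘(ℝ, Plane) ∞ M)
    (he' : e' ∈ maximalAtlas 𝓘(ℝ, Plane) ∞ M)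
    (θ : ∀ y : M, TangentSpace 𝓘(ℝ, Plane) y →L[ℝ] V) {v : Plane}
    (hv : v ∈ e'.target ∩ e'.symm ⁻¹' e.source) :
    inChart e' θ =ᶠ[𝓝 v]
      fun w => (inChart e θ ((e ∘ e'.symm) w)).comp (fderiv ℝ (e ∘ e'.symm) w) := by
  filter_upwards [(isOpen_transition e e').mem_nhds hv] with w hw
  exact inChart_transition he he' θ hw

lemma contDiffAt_inChart_transition (he : e ∈ maximalAtlas 𝓘(ℝ, Plane) ∞ M)
    (he' : e' ∈ maximalAtlas 𝓘(ℝ, Plane) ∞ M) {y : M} (hy : y ∈ e.source) (hy' : y ∈ e'.source)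
    (h : ContDiffAt ℝ ∞ (inChart e θ) (e y)) : ContDiffAt ℝ ∞ (inChart e' θ) (e' y) := by
  have hv : e' y ∈ e'.target ∩ e'.symm ⁻¹' e.source :=
    ⟨e'.map_source hy', by simpa [e'.left_inv hy'] using hy⟩
  have hτ := contDiffAt_transition he he' hv
  refine ContDiffAt.congr_of_eventuallyEq ?_ (inChart_transition_eventuallyEq he he' θ hv)
  have h' : ContDiffAt ℝ ∞ (inChart e θ) ((e ∘ e'.symm) (e' y)) := by
    simpa [e'.left_inv hy'] using h
  exact (h'.comp (e' y) hτ).clm_comp (hτ.fderiv_right (by simp))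

lemma curl_inChart_transition (he : e ∈ maximalAtlas 𝓘(ℝ, Plane) ∞ M)
    (he' : e' ∈ maximalAtlas 𝓘(ℝ, Plane) ∞ M) {v : Plane}
    (hv : v ∈ e'.target ∩ e'.symm ⁻¹' e.source)
    (h : DifferentiableAt ℝ (inChart e θ) (e (e'.symm v))) :
    curl (inChart e' θ) v =
      (fderiv ℝ (e ∘ e'.symm) v).det • curl (inChart e θ) (e (e'.symm v)) := by
  rw [curl_congr (inChart_transition_eventuallyEq he he' θ hv)]
  exact curl_pullback h (contDiffAt_transition he he' hv)

end Charts

/-! ### Local primitives -/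

section Primitives

set_option linter.unusedSectionVars false

open IsManifold Filter Topology

variable {k : Type*} [RCLike k] {V : Type*} [NormedAddCommGroup V] [NormedSpace ℝ V]
  [NormedSpace k V] [IsScalarTower ℝ k V]
  {M : Type*} [TopologicalSpace M] [ChartedSpace Plane M] [IsManifold 𝓘(ℝ, Plane) ∞ M] {x₀ : M}
  {σ : FundamentalGroup M x₀ →* (V →L[k] V)}
  {e e' : OpenPartialHomeomorph M Plane}

/-- A 1-form on the universal cover, along a lift, in a chart. -/
abbrev formIn (e : OpenPartialHomeomorph M Plane) (s : ∀ y : M, Path.Homotopic.Quotient x₀ y)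
    (η : CoverForm x₀ V) : Plane → Plane →L[ℝ] V :=
  inChart e (fun y => η y (s y))

/-- A function on the universal cover, along a lift, in a chart. -/
abbrev secIn (e : OpenPartialHomeomorph M Plane) (s : ∀ y : M, Path.Homotopic.Quotient x₀ y)
    (f : CoverFun x₀ V) : Plane → V :=
  fun v => f (e.symm v) (s (e.symm v))

variable (σ) in
/-- The monodromy of `γ⁻¹`, as a real linear map. -/
def mon (γ : FundamentalGroup M x₀) : V →L[ℝ] V := (σ γ⁻¹).restrictScalars ℝ

lemma mon_apply (γ : FundamentalGroup M x₀) (v : V) : mon σ γ v = σ γ⁻¹ v := rfl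

variable (σ) in
/-- Equivariance of a function on the universal cover, above `W`. -/
def EquivariantOn (W : Set M) (f : CoverFun x₀ V) : Prop :=
  ∀ (γ : FundamentalGroup M x₀), ∀ y ∈ W, ∀ p : Path.Homotopic.Quotient x₀ y,
    f y (γ.toPath.trans p) = σ γ⁻¹ (f y p)

variable (σ) in
/-- Equivariance of a 1-form on the universal cover. -/
def EquivariantForm (η : CoverForm x₀ V) : Prop :=
  ∀ (γ : FundamentalGroup M x₀) (y : M) (p : Path.Homotopic.Quotient x₀ y)
    (a : TangentSpace 𝓘(ℝ, Plane) y), η y (γ.toPath.trans p) a = σ γ⁻¹ (η y p a)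

lemma EquivariantForm.formIn_translate {η : CoverForm x₀ V} (hη : EquivariantForm σ η)
    {s s' : ∀ y : M, Path.Homotopic.Quotient x₀ y} {γ : FundamentalGroup M x₀} {v : Plane}
    (h : s' (e.symm v) = γ.toPath.trans (s (e.symm v))) :
    formIn e s' η v = (mon σ γ).comp (formIn e s η v) := by
  ext a
  change η _ (s' (e.symm v)) _ = σ γ⁻¹ (η _ (s (e.symm v)) _)
  rw [h, hη]

lemma isOpen_chart_image (e : OpenPartialHomeomorph M Plane) {Q : Set Plane} (hQo : IsOpen Q)
    (hQ : Q ⊆ e.target) : IsOpen (e.symm '' Q) :=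
  e.symm.isOpen_image_of_subset_source hQo hQ

lemma mem_chart_image {Q : Set Plane} (hQ : Q ⊆ e.target) {y : M} :
    y ∈ e.symm '' Q ↔ y ∈ e.source ∧ e y ∈ Q := by
  constructor
  · rintro ⟨v, hv, rfl⟩
    exact ⟨e.map_target (hQ hv), by rwa [e.right_inv (hQ hv)]⟩
  · rintro ⟨h, h'⟩
    exact ⟨e y, h', e.left_inv h⟩

lemma exists_ball_in_chart {y : M} (hy : y ∈ e.source) {W : Set M} (hW : IsOpen W)
    (hyW : y ∈ W) :
    ∃ r > 0, Metric.ball (e y) r ⊆ e.target ∧ e.symm '' Metric.ball (e y) r ⊆ W := by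
  have h : e.target ∩ e.symm ⁻¹' W ∈ 𝓝 (e y) :=
    (e.isOpen_inter_preimage_symm hW).mem_nhds
      ⟨e.map_source hy, by simpa [e.left_inv hy] using hyW⟩
  obtain ⟨r, hr, h⟩ := Metric.mem_nhds_iff.1 h
  exact ⟨r, hr, fun v hv => (h hv).1, by rintro _ ⟨v, hv, rfl⟩; exact (h hv).2⟩

lemma exists_pathConnected_nhds {y : M} {W : Set M} (hW : IsOpen W) (hyW : y ∈ W) :
    ∃ N ⊆ W, IsOpen N ∧ y ∈ N ∧ IsPathConnected N := by
  obtain ⟨r, hr, h1, h2⟩ := exists_ball_in_chart (mem_chart_source Plane y) hW hyW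
  exact ⟨_, h2, isOpen_chart_image _ Metric.isOpen_ball h1,
    (mem_chart_image h1).2 ⟨mem_chart_source Plane y, Metric.mem_ball_self hr⟩,
    isPathConnected_chart_image _ (convex_ball _ _) (Metric.nonempty_ball.2 hr) h1⟩

/-- Two lifts differ locally by a constant element of the fundamental group. -/
lemma IsLift.eventually_translate {U U' : Set M} {s s' : ∀ y : M, Path.Homotopic.Quotient x₀ y}
    (h : IsLift U s) (h' : IsLift U' s') (hU : IsOpen U) (hU' : IsOpen U') {y : M} (hy : y ∈ U)
    (hy' : y ∈ U') :
    ∃ γ : FundamentalGroup M x₀, ∀ᶠ z in 𝓝 y, s' z = γ.toPath.trans (s z) := by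
  obtain ⟨N, hN, hNo, hyN, hNc⟩ := exists_pathConnected_nhds (hU.inter hU') ⟨hy, hy'⟩
  obtain ⟨γ, hγ⟩ := h.eq_translate h' (hN.trans Set.inter_subset_left)
    (hN.trans Set.inter_subset_right) hNc
  exact ⟨γ, by filter_upwards [hNo.mem_nhds hyN] with z hz using hγ z hz⟩

lemma tendsto_chart_symm {y : M} (hy : y ∈ e.source) : Tendsto e.symm (𝓝 (e y)) (𝓝 y) := by
  simpa [ContinuousAt, e.left_inv hy] using e.continuousAt_symm (e.map_source hy)

/-- The coordinate expressions along two lifts differ near a point by a constant linear map.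
Smoothness and closedness can therefore be tested along one convenient lift. -/
lemma EquivariantForm.formIn_eventually {η : CoverForm x₀ V} (hη : EquivariantForm σ η)
    {U U' : Set M} {s s' : ∀ y : M, Path.Homotopic.Quotient x₀ y}
    (h : IsLift U s) (h' : IsLift U' s') (hU : IsOpen U) (hU' : IsOpen U') {y : M} (hy : y ∈ U)
    (hy' : y ∈ U') (he : y ∈ e.source) :
    ∃ γ : FundamentalGroup M x₀,
      formIn e s' η =ᶠ[𝓝 (e y)] fun v => (mon σ γ).comp (formIn e s η v) := by
  obtain ⟨γ, hγ⟩ := h.eventually_translate h' hU hU' hy hy'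
  exact ⟨γ, by filter_upwards [(tendsto_chart_symm he).eventually hγ] with v hv using
    hη.formIn_translate hv⟩

lemma CoverForm.IsSmooth.contDiffAt {η : CoverForm x₀ V} (h : η.IsSmooth) {U : Set M}
    {s : ∀ y : M, Path.Homotopic.Quotient x₀ y} (hU : IsOpen U) (hs : IsLift U s)
    (he : e ∈ maximalAtlas 𝓘(ℝ, Plane) ∞ M) {v : Plane} (hv : v ∈ e.target)
    (hvU : e.symm v ∈ U) : ContDiffAt ℝ ∞ (formIn e s η) v := by
  set y := e.symm v with hy
  have hye : y ∈ e.source := e.map_target hv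
  have h1 : ContDiffAt ℝ ∞ (formIn (chartAt Plane y) s η) (chartAt Plane y y) := by
    refine (h U s hU hs _ (chart_mem_atlas Plane y)).contDiffAt
      (((chartAt Plane y).isOpen_inter_preimage_symm hU).mem_nhds ⟨mem_chart_target Plane y, ?_⟩)
    simpa using hvU
  have h2 := contDiffAt_inChart_transition (chart_mem_maximalAtlas y) he
    (mem_chart_source Plane y) hye h1
  simpa [hy, e.right_inv hv] using h2

/-- An equivariant 1-form is smooth if it is so along some lift near every point. -/
lemma EquivariantForm.isSmooth {η : CoverForm x₀ V} (hη : EquivariantForm σ η)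
    (h : ∀ y : M, ∃ (N : Set M) (s : ∀ y : M, Path.Homotopic.Quotient x₀ y), IsOpen N ∧ y ∈ N ∧
      IsLift N s ∧ ∃ e ∈ maximalAtlas 𝓘(ℝ, Plane) ∞ M, y ∈ e.source ∧
        ContDiffAt ℝ ∞ (formIn e s η) (e y)) : η.IsSmooth := by
  intro U s' hU hs' e' he' v hv
  refine ContDiffAt.contDiffWithinAt ?_
  obtain ⟨N, s, hN, hyN, hs, e, he, hye, hsm⟩ := h (e'.symm v)
  have h1 := contDiffAt_inChart_transition he (subset_maximalAtlas he') hye (e'.map_target hv.1) hsm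
  obtain ⟨γ, hγ⟩ := hη.formIn_eventually hs hs' hN hU hyN hv.2 (e'.map_target hv.1)
  rw [e'.right_inv hv.1] at h1 hγ
  exact (contDiffAt_const.clm_comp h1).congr_of_eventuallyEq hγ

lemma curl_comp (L : V →L[ℝ] V) {ζ : Plane → Plane →L[ℝ] V} {v : Plane}
    (h : DifferentiableAt ℝ ζ v) : curl (fun v => L.comp (ζ v)) v = L (curl ζ v) := by
  have h1 := (hasFDerivAt_const L v).clm_comp h.hasFDerivAt
  have h2 : ∀ a b, fderiv ℝ (fun v => L.comp (ζ v)) v a b = L (fderiv ℝ ζ v a b) := by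
    intro a b; rw [h1.fderiv]; simp
  simp [curl, h2]

/-- A closed 1-form is closed in all charts of the maximal atlas. -/
lemma CoverForm.IsClosed.curl_eq_zero {η : CoverForm x₀ V} (hc : η.IsClosed) (h : η.IsSmooth)
    {U : Set M} {s : ∀ y : M, Path.Homotopic.Quotient x₀ y} (hU : IsOpen U) (hs : IsLift U s)
    (he : e ∈ maximalAtlas 𝓘(ℝ, Plane) ∞ M) {v : Plane} (hv : v ∈ e.target)
    (hvU : e.symm v ∈ U) : curl (formIn e s η) v = 0 := by
  have hv' : v ∈ e.target ∩ e.symm ⁻¹' (chartAt Plane (e.symm v)).source :=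
    ⟨hv, mem_chart_source Plane _⟩
  have hvU' : (chartAt Plane (e.symm v)).symm (chartAt Plane (e.symm v) (e.symm v)) ∈ U := by
    simpa using hvU
  rw [curl_inChart_transition (chart_mem_maximalAtlas (e.symm v)) he hv'
    ((h.contDiffAt hU hs (chart_mem_maximalAtlas _) (mem_chart_target Plane _) hvU').differentiableAt
      (by simp)),
    (curl_eq_zero_iff _ _).2 (hc U s hU hs _ (chart_mem_atlas Plane _) _
      ⟨mem_chart_target Plane _, hvU'⟩), smul_zero]

/-- An equivariant smooth 1-form is closed if it is so along some lift near every point. -/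
lemma EquivariantForm.isClosed {η : CoverForm x₀ V} (hη : EquivariantForm σ η)
    (hsm : η.IsSmooth)
    (h : ∀ y : M, ∃ (N : Set M) (s : ∀ y : M, Path.Homotopic.Quotient x₀ y), IsOpen N ∧ y ∈ N ∧
      IsLift N s ∧ ∃ e ∈ maximalAtlas 𝓘(ℝ, Plane) ∞ M, y ∈ e.source ∧
        curl (formIn e s η) (e y) = 0) : η.IsClosed := by
  intro U s' hU hs' e' he' v hv
  rw [← curl_eq_zero_iff]
  obtain ⟨N, s, hN, hyN, hs, e, he, hye, hc⟩ := h (e'.symm v)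
  have hy' := e'.map_target hv.1
  obtain ⟨γ, hγ⟩ := hη.formIn_eventually hs hs' hN hU hyN hv.2 hy'
  rw [e'.right_inv hv.1] at hγ
  refine (curl_congr hγ).trans ?_
  rw [curl_comp _ ((hsm.contDiffAt hN hs (subset_maximalAtlas he') hv.1 hyN).differentiableAt
    (by simp)), curl_inChart_transition he (subset_maximalAtlas he') ⟨hv.1, hye⟩
    ((hsm.contDiffAt hN hs he (e.map_source hye)
      (by simpa [e.left_inv hye] using hyN)).differentiableAt (by simp)), hc]
  simp

variable (σ) in
/-- `f` is above `W` an equivariant primitive of the 1-form `η`. -/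
def IsPrimitiveOn (W : Set M) (f : CoverFun x₀ V) (η : CoverForm x₀ V) : Prop :=
  EquivariantOn σ W f ∧
    ∀ (U : Set M) (s : ∀ y : M, Path.Homotopic.Quotient x₀ y), IsOpen U → IsLift U s → U ⊆ W →
      ∀ y ∈ U, HasMFDerivAt 𝓘(ℝ, Plane) 𝓘(ℝ, V) (fun z => f z (s z)) y (η y (s y))

lemma EquivariantOn.mono {W W' : Set M} {f : CoverFun x₀ V} (h : EquivariantOn σ W f)
    (hW : W' ⊆ W) : EquivariantOn σ W' f := fun γ y hy => h γ y (hW hy)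

lemma IsPrimitiveOn.mono {W W' : Set M} {f : CoverFun x₀ V} {η : CoverForm x₀ V}
    (h : IsPrimitiveOn σ W f η) (hW : W' ⊆ W) : IsPrimitiveOn σ W' f η :=
  ⟨h.1.mono hW, fun U s hU hs hUW => h.2 U s hU hs (hUW.trans hW)⟩

/-- An equivariant function is a primitive if it is so along some lift near every point. -/
lemma EquivariantOn.isPrimitiveOn {W : Set M} (hW : IsOpen W) {f : CoverFun x₀ V}
    {η : CoverForm x₀ V} (hf : EquivariantOn σ W f) (hη : EquivariantForm σ η)
    (h : ∀ y ∈ W, ∃ (N : Set M) (s : ∀ y : M, Path.Homotopic.Quotient x₀ y), IsOpen N ∧ y ∈ N ∧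
      IsLift N s ∧ HasMFDerivAt 𝓘(ℝ, Plane) 𝓘(ℝ, V) (fun z => f z (s z)) y (η y (s y))) :
    IsPrimitiveOn σ W f η := by
  refine ⟨hf, fun U s' hU hs' hUW y hy => ?_⟩
  obtain ⟨N, s, hN, hyN, hs, hd⟩ := h y (hUW hy)
  obtain ⟨γ, hγ⟩ := hs.eventually_translate hs' hN hU hyN hy
  have h1 : (fun z => f z (s' z)) =ᶠ[𝓝 y] fun z => mon σ γ (f z (s z)) := by
    filter_upwards [hγ, hW.mem_nhds (hUW hy)] with z hz hzW
    rw [hz, hf γ z hzW, mon_apply]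
  have h2 := ((mon σ γ).hasFDerivAt (x := f y (s y))).hasMFDerivAt.comp y hd
  refine (h2.congr_of_eventuallyEq h1).congr_mfderiv ?_
  ext a
  change σ γ⁻¹ (η y (s y) a) = η y (s' y) a
  rw [hγ.self_of_nhds, hη]

lemma IsPrimitiveOn.hasFDerivAt {W : Set M} {f : CoverFun x₀ V} {η : CoverForm x₀ V}
    (h : IsPrimitiveOn σ W f η) {U : Set M} {s : ∀ y : M, Path.Homotopic.Quotient x₀ y}
    (hU : IsOpen U) (hs : IsLift U s) (hUW : U ⊆ W) (he : e ∈ maximalAtlas 𝓘(ℝ, Plane) ∞ M)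
    {v : Plane} (hv : v ∈ e.target) (hvU : e.symm v ∈ U) :
    HasFDerivAt (secIn e s f) (formIn e s η v) v := by
  have h1 := (hasMFDerivAt_iff_chart he (e.map_target hv) (fun y => η y (s y))).1
    (h.2 U s hU hs hUW (e.symm v) hvU)
  rw [e.right_inv hv] at h1
  exact h1

/-- A primitive of a smooth form is automatically smooth, so `IsPrimitiveOn` need not require any
regularity. -/
lemma contDiffOn_of_hasFDerivAt {f : Plane → V} {ζ : Plane → Plane →L[ℝ] V} {U : Set Plane}
    (hU : IsOpen U) (h : ∀ v ∈ U, HasFDerivAt f (ζ v) v) (hζ : ContDiffOn ℝ ∞ ζ U) :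
    ContDiffOn ℝ ∞ f U := by
  rw [contDiffOn_infty_iff_fderiv_of_isOpen hU]
  exact ⟨fun v hv => (h v hv).differentiableAt.differentiableWithinAt,
    hζ.congr fun v hv => (h v hv).fderiv⟩

lemma IsPrimitiveOn.contDiffOn {W : Set M} {f : CoverFun x₀ V} {η : CoverForm x₀ V}
    (h : IsPrimitiveOn σ W f η) (hη : η.IsSmooth) {U : Set M}
    {s : ∀ y : M, Path.Homotopic.Quotient x₀ y}
    (hU : IsOpen U) (hs : IsLift U s) (hUW : U ⊆ W) (he : e ∈ maximalAtlas 𝓘(ℝ, Plane) ∞ M) :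
    ContDiffOn ℝ ∞ (secIn e s f) (e.target ∩ e.symm ⁻¹' U) :=
  contDiffOn_of_hasFDerivAt (e.isOpen_inter_preimage_symm hU)
    (fun _ hv => h.hasFDerivAt hU hs hUW he hv.1 hv.2)
    fun _ hv => (hη.contDiffAt hU hs he hv.1 hv.2).contDiffWithinAt

lemma contMDiffOn_of_charts {f : M → V} {U : Set M}
    (h : ∀ y ∈ U, ContDiffAt ℝ ∞ (f ∘ (chartAt Plane y).symm) (chartAt Plane y y)) :
    ContMDiffOn 𝓘(ℝ, Plane) 𝓘(ℝ, V) ∞ f U := by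
  intro y hy
  refine ContMDiffAt.contMDiffWithinAt ?_
  have h1 := (h y hy).contMDiffAt.comp y
    (contMDiffAt_of_mem_maximalAtlas (chart_mem_maximalAtlas y) (mem_chart_source Plane y))
  refine h1.congr_of_eventuallyEq ?_
  filter_upwards [(chartAt Plane y).open_source.mem_nhds (mem_chart_source Plane y)] with z hz
  exact congrArg f ((chartAt Plane y).left_inv hz).symm

/-- A form with a global primitive is exact. -/
lemma IsPrimitiveOn.mem_exactForms {f : CoverFun x₀ V} {η : CoverForm x₀ V}
    (h : IsPrimitiveOn σ Set.univ f η) (hη : η.IsSmooth) :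
    IsBundleSection σ f ∧ IsDifferential f η := by
  refine ⟨⟨fun U s hU hs => contMDiffOn_of_charts fun y hy => ?_,
    fun γ y p => h.1 γ y (Set.mem_univ y) p⟩,
    fun U s hU hs y hy => (h.2 U s hU hs (Set.subset_univ U) y hy).mfderiv.symm⟩
  refine (h.contDiffOn hη hU hs (Set.subset_univ U) (chart_mem_maximalAtlas y)).contDiffAt
    (((chartAt Plane y).isOpen_inter_preimage_symm hU).mem_nhds ⟨mem_chart_target Plane y, ?_⟩)
  simpa using hy

lemma IsDifferential.isPrimitiveOn {f : CoverFun x₀ V} {η : CoverForm x₀ V}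
    (h : IsDifferential f η) (hf : IsBundleSection σ f) : IsPrimitiveOn σ Set.univ f η := by
  refine ⟨fun γ y _ p => hf.2 γ y p, fun U s hU hs _ y hy => ?_⟩
  have h1 : η y (s y) = _ := h U s hU hs y hy
  rw [h1]
  exact (hf.1.mdifferentiableAt hU hs hy).hasMFDerivAt

lemma IsPrimitiveOn.sub {W : Set M} {f f' : CoverFun x₀ V} {η η' : CoverForm x₀ V}
    (h : IsPrimitiveOn σ W f η) (h' : IsPrimitiveOn σ W f' η') :
    IsPrimitiveOn σ W (f - f') (η - η') :=
  ⟨fun γ y hy p => by simp only [Pi.sub_apply, h.1 γ y hy p, h'.1 γ y hy p, map_sub],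
    fun U s hU hs hUW y hy => (h.2 U s hU hs hUW y hy).sub (h'.2 U s hU hs hUW y hy)⟩

lemma IsPrimitiveOn.add {W : Set M} {f f' : CoverFun x₀ V} {η η' : CoverForm x₀ V}
    (h : IsPrimitiveOn σ W f η) (h' : IsPrimitiveOn σ W f' η') :
    IsPrimitiveOn σ W (f + f') (η + η') :=
  ⟨fun γ y hy p => by simp only [Pi.add_apply, h.1 γ y hy p, h'.1 γ y hy p, map_add],
    fun U s hU hs hUW y hy => (h.2 U s hU hs hUW y hy).add (h'.2 U s hU hs hUW y hy)⟩

/-- Along a lift over a convex subset of a chart, two primitives differ by a constant. -/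
lemma IsPrimitiveOn.exists_const {W : Set M} {f f' : CoverFun x₀ V} {η : CoverForm x₀ V}
    (h : IsPrimitiveOn σ W f η) (h' : IsPrimitiveOn σ W f' η)
    (he : e ∈ maximalAtlas 𝓘(ℝ, Plane) ∞ M) {Q : Set Plane} (hQo : IsOpen Q) (hQc : Convex ℝ Q)
    (hQ : Q ⊆ e.target) (hQW : e.symm '' Q ⊆ W) {s : ∀ y : M, Path.Homotopic.Quotient x₀ y}
    (hs : IsLift (e.symm '' Q) s) :
    ∃ c : V, ∀ v ∈ Q, secIn e s f v - secIn e s f' v = c := by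
  have hd : ∀ v ∈ Q, HasFDerivAt (fun v => secIn e s f v - secIn e s f' v)
      (0 : Plane →L[ℝ] V) v := by
    intro v hv
    have ho := isOpen_chart_image e hQo hQ
    have := (h.hasFDerivAt ho hs hQW he (hQ hv) ⟨v, hv, rfl⟩).sub
      (h'.hasFDerivAt ho hs hQW he (hQ hv) ⟨v, hv, rfl⟩)
    rwa [sub_self] at this
  rcases Q.eq_empty_or_nonempty with rfl | ⟨v₀, hv₀⟩
  · exact ⟨0, by simp⟩
  refine ⟨secIn e s f v₀ - secIn e s f' v₀, fun v hv => ?_⟩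
  exact hQc.is_const_of_fderivWithin_eq_zero (𝕜 := ℝ)
    (fun w hw => (hd w hw).differentiableAt.differentiableWithinAt)
    (fun w hw => by rw [fderivWithin_of_isOpen hQo hw, (hd w hw).fderiv]) hv hv₀

/-- Two primitives over a convex subset of a chart which agree at a point are equal. -/
lemma IsPrimitiveOn.eq_of_eq [PathConnectedSpace M] {W : Set M} {f f' : CoverFun x₀ V}
    {η : CoverForm x₀ V} (h : IsPrimitiveOn σ W f η) (h' : IsPrimitiveOn σ W f' η)
    (he : e ∈ maximalAtlas 𝓘(ℝ, Plane) ∞ M) {Q : Set Plane} (hQo : IsOpen Q) (hQc : Convex ℝ Q)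
    (hQ : Q ⊆ e.target) (hQW : e.symm '' Q ⊆ W) {y₀ : M} (hy₀ : y₀ ∈ e.symm '' Q)
    {p₀ : Path.Homotopic.Quotient x₀ y₀} (heq : f y₀ p₀ = f' y₀ p₀) {y : M}
    (hy : y ∈ e.symm '' Q) (p : Path.Homotopic.Quotient x₀ y) : f y p = f' y p := by
  obtain ⟨s, hs, hs₀⟩ := exists_isLift e hQc hQ hy₀ p₀
  obtain ⟨c, hc⟩ := h.exists_const h' he hQo hQc hQ hQW hs
  have hc' : ∀ y ∈ e.symm '' Q, f y (s y) - f' y (s y) = c := by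
    rintro _ ⟨v, hv, rfl⟩; exact hc v hv
  -- The lift was chosen through `p₀`, where the primitives agree, so the constant difference is
  -- zero. Other path classes follow by equivariance.
  have hc0 : c = 0 := by rw [← hc' y₀ hy₀, hs₀, heq, sub_self]
  rw [← loopOf_trans p (s y), h.1 _ y (hQW hy), h'.1 _ y (hQW hy),
    sub_eq_zero.1 ((hc' y hy).trans hc0)]

variable (σ) in
/-- The equivariant function which along a given lift is a given function. -/
def spread (s : ∀ y : M, Path.Homotopic.Quotient x₀ y) (g : M → V) : CoverFun x₀ V :=
  fun y p => σ (loopOf p (s y))⁻¹ (g y)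

lemma spread_self (s : ∀ y : M, Path.Homotopic.Quotient x₀ y) (g : M → V) (y : M) :
    spread σ s g y (s y) = g y := by
  rw [spread, loopOf_self, inv_one, map_one]
  rfl

/-- The monodromy is a homomorphism, so this is `loopOf_mul`. Local constructions may thus be
carried out along one lift only. -/
lemma spread_equivariantOn (s : ∀ y : M, Path.Homotopic.Quotient x₀ y) (g : M → V) (W : Set M) :
    EquivariantOn σ W (spread σ s g) := by
  intro γ y _ p
  rw [spread, spread, loopOf_mul, mul_inv_rev, map_mul]
  rfl

/-- Poincaré's lemma for closed 1-forms over a convex subset of a chart. -/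
lemma exists_isPrimitiveOn [CompleteSpace V] [PathConnectedSpace M] {η : CoverForm x₀ V}
    (hη : IsBundleForm σ η) (hc : η.IsClosed)
    (he : e ∈ maximalAtlas 𝓘(ℝ, Plane) ∞ M) {Q : Set Plane} (hQo : IsOpen Q) (hQc : Convex ℝ Q)
    (hQ : Q ⊆ e.target) : ∃ f, IsPrimitiveOn σ (e.symm '' Q) f η := by
  rcases Q.eq_empty_or_nonempty with rfl | ⟨v₀, hv₀⟩
  · exact ⟨0, by simp [EquivariantOn], fun U s _ _ hU y hy => by
      simpa using hU hy⟩
  have ho := isOpen_chart_image e hQo hQ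
  obtain ⟨s, hs, -⟩ := exists_isLift e hQc hQ ⟨v₀, hv₀, rfl⟩
    (Path.Homotopic.Quotient.mk (PathConnectedSpace.somePath x₀ (e.symm v₀)))
  have hd : DifferentiableOn ℝ (formIn e s η) Q := fun v hv => ((hη.1.contDiffAt ho hs he (hQ hv)
    ⟨v, hv, rfl⟩).differentiableAt (by simp)).differentiableWithinAt
  -- Along the lift, `η` is an ordinary 1-form on a convex open set whose derivative is symmetric,
  -- so the usual Poincaré lemma applies; the primitive is then spread equivariantly over all path
  -- classes.
  obtain ⟨g, hg⟩ := hQc.exists_forall_hasFDerivAt_of_fderiv_symmetric hQo hd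
    (fun v hv => (curl_eq_zero_iff _ _).1 (hc.curl_eq_zero hη.1 ho hs he (hQ hv) ⟨v, hv, rfl⟩))
  refine ⟨spread σ s (g ∘ e), (spread_equivariantOn s _ _).isPrimitiveOn ho hη.2
    fun y hy => ⟨_, s, ho, hy, hs, ?_⟩⟩
  have hy' := (mem_chart_image hQ).1 hy
  refine (hasMFDerivAt_iff_chart he hy'.1 (fun y => η y (s y))).2 ?_
  refine (hg (e y) hy'.2).congr_of_eventuallyEq ?_
  filter_upwards [hQo.mem_nhds hy'.2] with v hv
  simp [spread_self, e.right_inv (hQ hv)]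

/-- Compatible primitives can be glued. -/
lemma IsPrimitiveOn.glue {ι : Type*} {W : ι → Set M} (hW : ∀ i, IsOpen (W i))
    {f : ι → CoverFun x₀ V} {η : CoverForm x₀ V} (hη : EquivariantForm σ η)
    (h : ∀ i, IsPrimitiveOn σ (W i) (f i) η)
    (hf : ∀ i j, ∀ y ∈ W i ∩ W j, ∀ p, f i y p = f j y p) {O : Set M} (hO : O ⊆ ⋃ i, W i)
    (hOo : IsOpen O) (hl : ∀ y ∈ O, ∃ (N : Set M) (s : ∀ y : M, Path.Homotopic.Quotient x₀ y),
      IsOpen N ∧ y ∈ N ∧ IsLift N s) :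
    ∃ g, IsPrimitiveOn σ O g η ∧ ∀ i, ∀ y ∈ W i, ∀ p, g y p = f i y p := by
  classical
  let g : CoverFun x₀ V := fun y p =>
    if hy : ∃ i, y ∈ W i then f hy.choose y p else 0
  have hg : ∀ i, ∀ y ∈ W i, ∀ p, g y p = f i y p := by
    intro i y hy p
    have hex : ∃ i, y ∈ W i := ⟨i, hy⟩
    simp only [g, dif_pos hex]
    exact hf _ _ y ⟨hex.choose_spec, hy⟩ p
  refine ⟨g, EquivariantOn.isPrimitiveOn hOo (fun γ y hy p => ?_) hη fun y hy => ?_, hg⟩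
  · obtain ⟨i, hi⟩ := Set.mem_iUnion.1 (hO hy)
    rw [hg i y hi, hg i y hi, (h i).1 γ y hi p]
  · obtain ⟨i, hi⟩ := Set.mem_iUnion.1 (hO hy)
    obtain ⟨N, s, hN, hyN, hs⟩ := hl y hy
    refine ⟨N ∩ W i, s, hN.inter (hW i), ⟨hyN, hi⟩, hs.mono Set.inter_subset_left, ?_⟩
    refine ((h i).2 (N ∩ W i) s (hN.inter (hW i)) (hs.mono Set.inter_subset_left)
      Set.inter_subset_right y ⟨hyN, hi⟩).congr_of_eventuallyEq ?_
    filter_upwards [(hW i).mem_nhds hi] with z hz using hg i z hz (s z)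

/-- Every point has a neighbourhood with a lift. -/
lemma exists_local_lift [PathConnectedSpace M] (y : M) :
    ∃ (N : Set M) (s : ∀ y : M, Path.Homotopic.Quotient x₀ y), IsOpen N ∧ y ∈ N ∧ IsLift N s := by
  obtain ⟨r, hr, h1, h2⟩ := exists_ball_in_chart (mem_chart_source Plane y) isOpen_univ
    (Set.mem_univ y)
  have hy : y ∈ (chartAt Plane y).symm '' Metric.ball (chartAt Plane y y) r :=
    (mem_chart_image h1).2 ⟨mem_chart_source Plane y, Metric.mem_ball_self hr⟩
  obtain ⟨s, hs, -⟩ := exists_isLift _ (convex_ball _ _) h1 hy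
    (Path.Homotopic.Quotient.mk (PathConnectedSpace.somePath x₀ y))
  exact ⟨_, s, isOpen_chart_image _ Metric.isOpen_ball h1, hy, hs⟩

end Primitives

/-! ### Integration of 2-forms -/

section Integration

set_option linter.unusedSectionVars false

open IsManifold Filter Topology MeasureTheory

variable {k : Type*} [RCLike k]
  {M : Type*} [TopologicalSpace M] [ChartedSpace Plane M] [IsManifold 𝓘(ℝ, Plane) ∞ M]
  {e e' : OpenPartialHomeomorph M Plane}

/-- Extension by zero off a compact subset of the open set `Q` is continuous on the whole plane and
has compact support. -/
lemma subset_integrable_of_compact {E : Type*} [NormedAddCommGroup E] {F : Plane → E}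
    {Q K : Set Plane} (hQ : IsOpen Q) (hF : ContinuousOn F Q) (hK : IsCompact K) (hKQ : K ⊆ Q)
    (h0 : ∀ v ∉ K, F v = 0) : Integrable F := by
  have hc : Continuous F := by
    rw [continuous_iff_continuousAt]
    intro v
    by_cases hv : v ∈ K
    · exact hF.continuousAt (hQ.mem_nhds (hKQ hv))
    · refine (continuousAt_const (y := (0 : E))).congr ?_
      filter_upwards [hK.isClosed.isOpen_compl.mem_nhds hv] with w hw using (h0 w hw).symm
  exact hc.integrable_of_hasCompactSupport (HasCompactSupport.intro hK h0)

/-- Change of variables between two charts of an oriented atlas. -/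
lemma setIntegral_transition (hor : IsOrientedAtlas M) (he : e ∈ atlas Plane M)
    (he' : e' ∈ atlas Plane M) (G : Plane → k) :
    ∫ v in e'.target ∩ e'.symm ⁻¹' e.source,
        (fderiv ℝ (e ∘ e'.symm) v).det • G (e (e'.symm v)) =
      ∫ v in e.target ∩ e.symm ⁻¹' e'.source, G v := by
  have him : (e ∘ e'.symm) '' (e'.target ∩ e'.symm ⁻¹' e.source) =
      e.target ∩ e.symm ⁻¹' e'.source := by
    ext w
    constructor
    · rintro ⟨v, ⟨h1, h2⟩, rfl⟩
      exact ⟨e.map_source h2, by simpa [e.left_inv h2] using e'.map_target h1⟩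
    · rintro ⟨h1, h2⟩
      refine ⟨e' (e.symm w), ⟨e'.map_source h2, ?_⟩, ?_⟩
      · simpa [e'.left_inv h2] using e.map_target h1
      · simp [e'.left_inv h2, e.right_inv h1]
  have hinj : Set.InjOn (e ∘ e'.symm) (e'.target ∩ e'.symm ⁻¹' e.source) := by
    rintro v ⟨h1, h2⟩ w ⟨h3, h4⟩ h
    exact e'.symm.injOn h1 h3 (e.injOn h2 h4 h)
  rw [← him, integral_image_eq_integral_abs_det_fderiv_smul volume
    (isOpen_transition e e').measurableSet
    (fun v hv => ((contDiffAt_transition (subset_maximalAtlas he) (subset_maximalAtlas he')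
      hv).differentiableAt (by simp)).hasFDerivAt.hasFDerivWithinAt) hinj]
  refine setIntegral_congr_fun (isOpen_transition e e').measurableSet fun v hv => ?_
  -- Only here does the orientation enter: it removes the absolute value from the Jacobian in the
  -- change of variables formula.
  have : 0 < (fderiv ℝ (e ∘ e'.symm) v).det := hor e' he' e he v (by
    simpa using hv)
  simp [abs_of_pos this]

/-- The coefficient of a 2-form in a chart. -/
def twoIn (e : OpenPartialHomeomorph M Plane)
    (Θ : ∀ y : M, TangentSpace 𝓘(ℝ, Plane) y → TangentSpace 𝓘(ℝ, Plane) y → k) (v : Plane) : k :=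
  Θ (e.symm v)
    (mfderiv 𝓘(ℝ, Plane) 𝓘(ℝ, Plane) e.symm v (EuclideanSpace.single 0 1))
    (mfderiv 𝓘(ℝ, Plane) 𝓘(ℝ, Plane) e.symm v (EuclideanSpace.single 1 1))

/-- A continuous alternating 2-form with support in `K`. -/
structure IsTwoForm (K : Set M)
    (Θ : ∀ y : M, TangentSpace 𝓘(ℝ, Plane) y → TangentSpace 𝓘(ℝ, Plane) y → k) : Prop where
  alt : ∀ y : M, ∃ c : k, ∀ a b : Plane, Θ y a b = area a b • c
  cont : ∀ e ∈ atlas Plane M, ContinuousOn (twoIn e Θ) e.target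
  supp : ∀ y ∉ K, ∀ a b, Θ y a b = 0

variable {Θ Θ' : ∀ y : M, TangentSpace 𝓘(ℝ, Plane) y → TangentSpace 𝓘(ℝ, Plane) y → k}
  {K : Set M}

/-- At one point the form is a multiple of the area form, so the chain rule for the charts and
`area_map` give the Jacobian factor. -/
lemma IsTwoForm.twoIn_transition (h : IsTwoForm K Θ)
    (he : e ∈ maximalAtlas 𝓘(ℝ, Plane) ∞ M) (he' : e' ∈ maximalAtlas 𝓘(ℝ, Plane) ∞ M) {v : Plane}
    (hv : v ∈ e'.target ∩ e'.symm ⁻¹' e.source) :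
    twoIn e' Θ v = (fderiv ℝ (e ∘ e'.symm) v).det • twoIn e Θ (e (e'.symm v)) := by
  have hy : ∀ y, y = e'.symm v → ∀ a b : Plane, Θ (e'.symm v) a b = Θ y a b := by
    rintro _ rfl _ _; rfl
  obtain ⟨c, hc⟩ := h.alt (e'.symm v)
  let A : Plane →L[ℝ] Plane := mfderiv 𝓘(ℝ, Plane) 𝓘(ℝ, Plane) e.symm (e (e'.symm v))
  let A' : Plane →L[ℝ] Plane := mfderiv 𝓘(ℝ, Plane) 𝓘(ℝ, Plane) e'.symm v
  have h1 : twoIn e Θ (e (e'.symm v)) =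
      area (A (EuclideanSpace.single 0 1)) (A (EuclideanSpace.single 1 1)) • c :=
    (hy _ (e.left_inv hv.2) _ _).symm.trans (hc _ _)
  have h2 : twoIn e' Θ v =
      area (A' (EuclideanSpace.single 0 1)) (A' (EuclideanSpace.single 1 1)) • c := hc _ _
  have h3 : A' = A.comp (fderiv ℝ (e ∘ e'.symm) v) := mfderiv_chart_symm_transition he he' hv
  rw [h1, h2, h3]
  simp only [ContinuousLinearMap.comp_apply, area_map, smul_smul]
  congr 1
  ring

lemma chartPartition_subordinate [T2Space M] [SigmaCompactSpace M] (i : M) :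
    tsupport (chartPartition M i) ⊆ (chartAt Plane i).source :=
  (SmoothPartitionOfUnity.exists_isSubordinate_chartAt_source 𝓘(ℝ, Plane) M).choose_spec i

lemma chartPartition_eq_zero [T2Space M] [SigmaCompactSpace M] {i y : M}
    (hy : y ∉ (chartAt Plane i).source) : chartPartition M i y = 0 :=
  image_eq_zero_of_notMem_tsupport fun h => hy (chartPartition_subordinate i h)

variable [T2Space M] [SigmaCompactSpace M]

lemma IsTwoForm.integrable_summand (h : IsTwoForm K Θ) (hK : IsCompact K) {e₁ : OpenPartialHomeomorph M Plane}
    (he₁ : e₁ ∈ atlas Plane M) (hKe : K ⊆ e₁.source) (i : M) :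
    IntegrableOn (fun v => chartPartition M i (e₁.symm v) • twoIn e₁ Θ v) e₁.target := by
  rw [← integrable_indicator_iff e₁.open_target.measurableSet]
  refine subset_integrable_of_compact (K := e₁ '' K) e₁.open_target ?_
    (hK.image_of_continuousOn (e₁.continuousOn.mono hKe)) ?_ ?_
  · refine ContinuousOn.congr (f := fun v => chartPartition M i (e₁.symm v) • twoIn e₁ Θ v) ?_
      fun v hv => Set.indicator_of_mem hv _
    exact ((chartPartition M i).contMDiff.continuous.comp_continuousOn
      e₁.continuousOn_symm).smul (h.cont e₁ he₁)
  · rintro _ ⟨y, hy, rfl⟩; exact e₁.map_source (hKe hy)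
  · intro v hv
    refine Set.indicator_apply_eq_zero.2 fun hvt => ?_
    have : e₁.symm v ∉ K := fun hvK => hv ⟨_, hvK, e₁.right_inv hvt⟩
    rw [twoIn, h.supp _ this, smul_zero]

lemma IsTwoForm.integrable_chart (h : IsTwoForm K Θ) (hK : IsCompact K) (i : M) :
    IntegrableOn (fun v => chartPartition M i ((chartAt Plane i).symm v) •
      twoIn (chartAt Plane i) Θ v) (chartAt Plane i).target := by
  have he := chart_mem_atlas Plane i
  set e₁ := chartAt Plane i with he₁
  rw [← integrable_indicator_iff e₁.open_target.measurableSet]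
  have hKe : K ∩ tsupport (chartPartition M i) ⊆ e₁.source :=
    fun y hy => chartPartition_subordinate i hy.2
  refine subset_integrable_of_compact (K := e₁ '' (K ∩ tsupport (chartPartition M i)))
    e₁.open_target ?_ ((hK.inter_right (isClosed_tsupport _)).image_of_continuousOn
      (e₁.continuousOn.mono hKe)) ?_ ?_
  · refine ContinuousOn.congr (f := fun v => chartPartition M i (e₁.symm v) • twoIn e₁ Θ v) ?_
      fun v hv => Set.indicator_of_mem hv _
    exact ((chartPartition M i).contMDiff.continuous.comp_continuousOn
      e₁.continuousOn_symm).smul (h.cont e₁ he)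
  · rintro _ ⟨y, hy, rfl⟩; exact e₁.map_source (hKe hy)
  · intro v hv
    refine Set.indicator_apply_eq_zero.2 fun hvt => ?_
    by_cases hvs : e₁.symm v ∈ tsupport (chartPartition M i)
    · have : e₁.symm v ∉ K := fun hvK => hv ⟨_, ⟨hvK, hvs⟩, e₁.right_inv hvt⟩
      rw [twoIn, h.supp _ this, smul_zero]
    · rw [image_eq_zero_of_notMem_tsupport hvs, zero_smul]

lemma finite_chartPartition (hK : IsCompact K) :
    {i : M | ∃ y ∈ K, chartPartition M i y ≠ 0}.Finite := by
  refine ((chartPartition M).locallyFinite.finite_nonempty_inter_compact hK).subset ?_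
  rintro i ⟨y, hy, h⟩
  exact ⟨y, h, hy⟩

lemma IsTwoForm.summand_eq_zero (h : IsTwoForm K Θ) {i : M}
    (hi : ¬ ∃ y ∈ K, chartPartition M i y ≠ 0) {e₁ : OpenPartialHomeomorph M Plane} (v : Plane) :
    chartPartition M i (e₁.symm v) • twoIn e₁ Θ v = 0 := by
  by_cases hv : e₁.symm v ∈ K
  · push Not at hi
    rw [hi _ hv, zero_smul]
  · rw [twoIn, h.supp _ hv, smul_zero]

lemma IsTwoForm.integral_eq_sum (h : IsTwoForm K Θ) (hK : IsCompact K) :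
    integral Θ = ∑ i ∈ (finite_chartPartition hK).toFinset,
      ∫ v in (chartAt Plane i).target, chartPartition M i ((chartAt Plane i).symm v) •
        twoIn (chartAt Plane i) Θ v := by
  refine finsum_eq_sum_of_support_subset _ fun i hi => ?_
  by_contra hi'
  refine hi ?_
  simp only [Set.Finite.coe_toFinset, Set.mem_ofPred_eq] at hi'
  refine integral_eq_zero_of_ae (Eventually.of_forall fun v => ?_)
  exact h.summand_eq_zero hi' v

lemma IsTwoForm.integral_add (h : IsTwoForm K Θ) (h' : IsTwoForm K Θ') (hK : IsCompact K)
    {Θ'' : ∀ y : M, TangentSpace 𝓘(ℝ, Plane) y → TangentSpace 𝓘(ℝ, Plane) y → k}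
    (h'' : IsTwoForm K Θ'') (hsum : ∀ y a b, Θ'' y a b = Θ y a b + Θ' y a b) :
    integral Θ'' = integral Θ + integral Θ' := by
  rw [h.integral_eq_sum hK, h'.integral_eq_sum hK, h''.integral_eq_sum hK,
    ← Finset.sum_add_distrib]
  refine Finset.sum_congr rfl fun i _ => ?_
  rw [← MeasureTheory.integral_add (h.integrable_chart hK i) (h'.integrable_chart hK i)]
  refine integral_congr_ae (Eventually.of_forall fun v => ?_)
  simp only [twoIn, hsum, smul_add]

/-- No support or integrability hypothesis is needed, as finite sums and Bochner integrals commute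
with scalars of a field unconditionally. -/
lemma integral_smul (c : k)
    (hsum : ∀ y a b, Θ' y a b = c * Θ y a b) : integral Θ' = c * integral Θ := by
  have : Θ' = fun y a b => c * Θ y a b := by funext y a b; exact hsum y a b
  subst this
  unfold integral
  rw [← smul_eq_mul, smul_finsum]
  refine finsum_congr fun i => ?_
  rw [← MeasureTheory.integral_smul]
  refine integral_congr_ae (Eventually.of_forall fun v => ?_)
  simp only [smul_eq_mul, mul_smul_comm]

/-- The integral of a 2-form with compact support in a chart. -/
lemma IsTwoForm.integral_eq_chart (hor : IsOrientedAtlas M) (h : IsTwoForm K Θ)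
    (hK : IsCompact K) (he : e ∈ atlas Plane M) (hKe : K ⊆ e.source) :
    integral Θ = ∫ v in e.target, twoIn e Θ v := by
  have hmeas : ∀ e : OpenPartialHomeomorph M Plane, MeasurableSet e.target :=
    fun e => e.open_target.measurableSet
  -- Both integrals live on the overlap of the charts: outside of chart `i` the partition function
  -- vanishes, outside of `e` the form does. On the overlap this is the change of variables;
  -- afterwards the partition functions sum to one inside the single chart `e`.
  have h1 : ∀ i : M, ∫ v in (chartAt Plane i).target,
      chartPartition M i ((chartAt Plane i).symm v) • twoIn (chartAt Plane i) Θ v =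
      ∫ v in e.target, chartPartition M i (e.symm v) • twoIn e Θ v := by
    intro i
    have he' := chart_mem_atlas Plane i
    have hz : ∀ y : M, y ∉ (chartAt Plane i).source → chartPartition M i y = 0 :=
      fun y => chartPartition_eq_zero
    generalize chartAt Plane i = e' at *
    rw [setIntegral_eq_of_subset_of_forall_sdiff_eq_zero (hmeas e')
      (Set.inter_subset_left (t := e'.symm ⁻¹' e.source)),
      setIntegral_eq_of_subset_of_forall_sdiff_eq_zero (hmeas e)
      (Set.inter_subset_left (t := e.symm ⁻¹' e'.source)),
      ← setIntegral_transition hor he he']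
    · refine setIntegral_congr_fun (isOpen_transition e e').measurableSet fun v hv => ?_
      rw [h.twoIn_transition (subset_maximalAtlas he) (subset_maximalAtlas he') hv,
        e.left_inv hv.2, smul_comm]
    · rintro v ⟨hv, hv'⟩
      rw [hz _ fun hs => hv' ⟨hv, hs⟩, zero_smul]
    · rintro v ⟨hv, hv'⟩
      rw [twoIn, h.supp _ fun hs => hv' ⟨hv, hKe hs⟩, smul_zero]
  rw [h.integral_eq_sum hK, Finset.sum_congr rfl fun i _ => h1 i,
    ← integral_finsetSum _ fun i _ => h.integrable_summand hK he hKe i]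
  refine setIntegral_congr_fun (hmeas e) fun v hv => ?_
  rw [← Finset.sum_smul]
  by_cases hvK : e.symm v ∈ K
  · rw [← finsum_eq_sum_of_support_subset, (chartPartition M).sum_eq_one (Set.mem_univ _),
      one_smul]
    intro i hi
    simpa using ⟨_, hvK, hi⟩
  · rw [twoIn, h.supp _ hvK, smul_zero]

end Integration

/-! ### Integration by parts on the plane -/

section Plane

set_option linter.unusedSectionVars false

open Filter Topology MeasureTheory

variable {V W Z : Type*} [NormedAddCommGroup V] [NormedSpace ℝ V] [NormedAddCommGroup W]
  [NormedSpace ℝ W] [NormedAddCommGroup Z] [NormedSpace ℝ Z]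

lemma fderiv_eq_zero_of_support {u : Plane → V} {K : Set Plane} (hK : IsClosed K)
    (h0 : ∀ v ∉ K, u v = 0) {v : Plane} (hv : v ∉ K) : fderiv ℝ u v = 0 := by
  have : u =ᶠ[𝓝 v] fun _ => 0 := by
    filter_upwards [hK.isOpen_compl.mem_nhds hv] with w hw using h0 w hw
  rw [this.fderiv_eq]
  simp

lemma integral_by_parts (b : V →L[ℝ] W →L[ℝ] Z) {Q K : Set Plane} (hQ : IsOpen Q)
    (hK : IsCompact K) (hKQ : K ⊆ Q) {u : Plane → V} (hu : ContDiff ℝ ∞ u)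
    (h0 : ∀ v ∉ K, u v = 0) {g : Plane → W} (hg : ContDiffOn ℝ ∞ g Q) (a : Plane) :
    Integrable (fun v => b (u v) (fderiv ℝ g v a)) ∧
    Integrable (fun v => b (fderiv ℝ u v a) (g v)) ∧
    ∫ v, b (u v) (fderiv ℝ g v a) = - ∫ v, b (fderiv ℝ u v a) (g v) := by
  have hdg : ContinuousOn (fun v => fderiv ℝ g v a) Q :=
    (hg.continuousOn_fderiv_of_isOpen hQ (by simp)).clm_apply continuousOn_const
  have hdu : Continuous (fun v => fderiv ℝ u v a) :=
    (hu.continuous_fderiv (by simp)).clm_apply continuous_const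
  have hdu0 : ∀ v ∉ K, fderiv ℝ u v = 0 := fun v => fderiv_eq_zero_of_support hK.isClosed h0
  have hb : Continuous fun p : V × W => b p.1 p.2 := b.continuous₂
  have i1 : Integrable (fun v => b (u v) (fderiv ℝ g v a)) :=
    subset_integrable_of_compact hQ (hb.comp_continuousOn
      (hu.continuous.continuousOn.prodMk hdg)) hK hKQ fun v hv => by simp [h0 v hv]
  have i2 : Integrable (fun v => b (fderiv ℝ u v a) (g v)) :=
    subset_integrable_of_compact hQ (hb.comp_continuousOn
      (hdu.continuousOn.prodMk hg.continuousOn)) hK hKQ fun v hv => by simp [hdu0 v hv]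
  have i3 : Integrable (fun v => b (u v) (g v)) :=
    subset_integrable_of_compact hQ (hb.comp_continuousOn
      (hu.continuous.continuousOn.prodMk hg.continuousOn)) hK hKQ fun v hv => by simp [h0 v hv]
  refine ⟨i1, i2, integral_bilinear_fderiv_right_eq_neg_left_of_integrable i2 i1 i3
    (fun v _ => hu.differentiable (by simp) v) fun v hv => ?_⟩
  have : tsupport u ⊆ K := closure_minimal (fun v hv => by_contra fun h => hv (h0 v h)) hK.isClosed
  exact (hg.differentiableOn (by simp)).differentiableAt (hQ.mem_nhds (hKQ (this hv)))

/-- The coefficient of the wedge product of two 1-forms on the plane. -/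
def wedgeIn (b : V →L[ℝ] W →L[ℝ] Z) (ζ : Plane → Plane →L[ℝ] V) (ξ : Plane → Plane →L[ℝ] W)
    (v : Plane) : Z :=
  b (ζ v (EuclideanSpace.single 0 1)) (ξ v (EuclideanSpace.single 1 1)) -
    b (ζ v (EuclideanSpace.single 1 1)) (ξ v (EuclideanSpace.single 0 1))

lemma fderiv_apply_const {ζ : Plane → Plane →L[ℝ] V} {v : Plane} (h : DifferentiableAt ℝ ζ v)
    (a c : Plane) : fderiv ℝ (fun v => ζ v c) v a = fderiv ℝ ζ v a c := by
  rw [fderiv_clm_apply h (differentiableAt_const c)]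
  simp

/-- Integration by parts moves the derivatives from `u` to `ξ`, where they combine to `curl ξ`. This
is Stokes' theorem for `uξ`, since `d(uξ) = du ∧ ξ` for closed `ξ`. -/
lemma integral_wedgeIn_fderiv_left (b : V →L[ℝ] W →L[ℝ] Z) {Q K : Set Plane} (hQ : IsOpen Q)
    (hK : IsCompact K) (hKQ : K ⊆ Q) {u : Plane → V} (hu : ContDiff ℝ ∞ u)
    (h0 : ∀ v ∉ K, u v = 0) {ξ : Plane → Plane →L[ℝ] W} (hξ : ContDiffOn ℝ ∞ ξ Q)
    (hc : ∀ v ∈ Q, curl ξ v = 0) : ∫ v, wedgeIn b (fderiv ℝ u) ξ v = 0 := by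
  have hap : ∀ a, ContDiffOn ℝ ∞ (fun v => ξ v a) Q := fun a => hξ.clm_apply contDiffOn_const
  obtain ⟨h1, h2, h3⟩ := integral_by_parts b hQ hK hKQ hu h0 (hap (EuclideanSpace.single 1 1))
    (EuclideanSpace.single 0 1)
  obtain ⟨h1', h2', h3'⟩ := integral_by_parts b hQ hK hKQ hu h0 (hap (EuclideanSpace.single 0 1))
    (EuclideanSpace.single 1 1)
  unfold wedgeIn
  rw [MeasureTheory.integral_sub h2 h2', ← neg_eq_iff_eq_neg.2 h3, ← neg_eq_iff_eq_neg.2 h3',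
    ← neg_sub', neg_eq_zero, ← MeasureTheory.integral_sub h1 h1']
  refine integral_eq_zero_of_ae (Eventually.of_forall fun v => ?_)
  by_cases hv : v ∈ K
  · have hd : DifferentiableAt ℝ ξ v :=
      (hξ.differentiableOn (by simp)).differentiableAt (hQ.mem_nhds (hKQ hv))
    simp only [fderiv_apply_const hd, ← map_sub]
    have := hc v (hKQ hv)
    rw [curl] at this
    simp [this]
  · simp [h0 v hv]

/-- Since `d(ζg) = dζ g - ζ ∧ dg`, this is Stokes' theorem for `ζg`. Here `ζ` has compact support
and need not be closed; the formula turns integration against `β = dg` into a functional of `dζ`. -/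
lemma integral_wedgeIn_fderiv_right (b : V →L[ℝ] W →L[ℝ] Z) {Q K : Set Plane} (hQ : IsOpen Q)
    (hK : IsCompact K) (hKQ : K ⊆ Q) {ζ : Plane → Plane →L[ℝ] V} (hζ : ContDiff ℝ ∞ ζ)
    (h0 : ∀ v ∉ K, ζ v = 0) {g : Plane → W} (hg : ContDiffOn ℝ ∞ g Q) :
    ∫ v, wedgeIn b ζ (fderiv ℝ g) v = ∫ v, b (curl ζ v) (g v) := by
  have hap : ∀ a, ContDiff ℝ ∞ (fun v => ζ v a) := fun a => hζ.clm_apply contDiff_const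
  obtain ⟨h1, h2, h3⟩ := integral_by_parts b hQ hK hKQ (hap (EuclideanSpace.single 0 1))
    (fun v hv => by simp [h0 v hv]) hg (EuclideanSpace.single 1 1)
  obtain ⟨h1', h2', h3'⟩ := integral_by_parts b hQ hK hKQ (hap (EuclideanSpace.single 1 1))
    (fun v hv => by simp [h0 v hv]) hg (EuclideanSpace.single 0 1)
  unfold wedgeIn
  rw [MeasureTheory.integral_sub h1 h1', h3, h3', sub_neg_eq_add, neg_add_eq_sub,
    ← MeasureTheory.integral_sub h2' h2]
  refine integral_congr_ae (Eventually.of_forall fun v => ?_)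
  have hd : DifferentiableAt ℝ ζ v := hζ.differentiable (by simp) v
  simp only [fderiv_apply_const hd, curl, map_sub, sub_apply]

end Plane

/-! ### The wedge product of bundle forms -/

section Wedge

set_option linter.unusedSectionVars false

open IsManifold Filter Topology MeasureTheory

variable {k : Type*} [RCLike k] {V : Type*} [NormedAddCommGroup V] [NormedSpace ℝ V]
  [NormedSpace k V] [IsScalarTower ℝ k V] [FiniteDimensional k V]
  {M : Type*} [TopologicalSpace M] [ChartedSpace Plane M] [IsManifold 𝓘(ℝ, Plane) ∞ M] {x₀ : M}
  {σ : FundamentalGroup M x₀ →* (V →L[k] V)}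
  {e e' : OpenPartialHomeomorph M Plane} (B : LinearMap.BilinForm k V)

/-- A bilinear form on a finite dimensional space, as a continuous real bilinear map. -/
def realForm : V →L[ℝ] V →L[ℝ] k :=
  (ContinuousLinearMap.restrictScalarsL k V k ℝ ℝ).comp
    ((LinearMap.toContinuousBilinearMap B).restrictScalars ℝ)

/-- Invariance of a bilinear form under a representation. -/
def IsInvariant (σ : FundamentalGroup M x₀ →* (V →L[k] V)) : Prop :=
  ∀ γ u v, B (σ γ u) (σ γ v) = B u v

variable {B} {α β : CoverForm x₀ V}

/-- The form `wedge` is defined with an arbitrary path class. A change of this class acts on both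
arguments of `B` by the same monodromy, under which `B` is invariant. -/
lemma wedge_eq (hB : IsInvariant B σ) (hα : EquivariantForm σ α) (hβ : EquivariantForm σ β)
    (y : M) (p : Path.Homotopic.Quotient x₀ y) (a b : TangentSpace 𝓘(ℝ, Plane) y) :
    wedge B α β y a b = B (α y p a) (β y p b) - B (α y p b) (β y p a) := by
  have h : Nonempty (Path.Homotopic.Quotient x₀ y) := ⟨p⟩
  rw [wedge, dif_pos h]
  rw [← loopOf_trans h.some p, hα, hα, hβ, hβ, hB, hB]

lemma twoIn_wedge (hB : IsInvariant B σ) (hα : EquivariantForm σ α) (hβ : EquivariantForm σ β)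
    (s : ∀ y : M, Path.Homotopic.Quotient x₀ y) (v : Plane) :
    twoIn e (wedge B α β) v = wedgeIn (realForm B) (formIn e s α) (formIn e s β) v :=
  wedge_eq hB hα hβ _ (s (e.symm v)) _ _

lemma isTwoForm_wedge [PathConnectedSpace M] (hB : IsInvariant B σ) (hα : IsBundleForm σ α)
    (hβ : IsBundleForm σ β) {K : Set M} (hK : ∀ y ∉ K, (∀ p, α y p = 0) ∨ ∀ p, β y p = 0) :
    IsTwoForm K (wedge B α β) where
  alt y := by
    let p : Path.Homotopic.Quotient x₀ y :=
      Path.Homotopic.Quotient.mk (PathConnectedSpace.somePath x₀ y)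
    let α' : Plane →L[ℝ] V := α y p
    let β' : Plane →L[ℝ] V := β y p
    let L : Plane →L[ℝ] Plane →L[ℝ] k := ((realForm B).bilinearComp α' β')
    refine ⟨L (EuclideanSpace.single 0 1) (EuclideanSpace.single 1 1) -
      L (EuclideanSpace.single 1 1) (EuclideanSpace.single 0 1), fun a b => ?_⟩
    rw [← bilin_antisymm_plane]
    exact wedge_eq hB hα.2 hβ.2 y p a b
  cont e he v hv := by
    refine ContinuousAt.continuousWithinAt ?_
    obtain ⟨N, s, hN, hyN, hs⟩ := exists_local_lift (x₀ := x₀) (e.symm v)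
    have hα' := (hα.1.contDiffAt hN hs (subset_maximalAtlas he) hv hyN).continuousAt
    have hβ' := (hβ.1.contDiffAt hN hs (subset_maximalAtlas he) hv hyN).continuousAt
    have : twoIn e (wedge B α β) = wedgeIn (realForm B) (formIn e s α) (formIn e s β) :=
      funext fun v => twoIn_wedge hB hα.2 hβ.2 s v
    rw [this]
    have hb : Continuous fun p : V × V => realForm B p.1 p.2 := (realForm B).continuous₂
    have hap : ∀ a b, ContinuousAt (fun v => realForm B (formIn e s α v a) (formIn e s β v b)) v :=
      fun a b => hb.continuousAt.comp (f := fun v => (formIn e s α v a, formIn e s β v b))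
        ((hα'.clm_apply continuousAt_const).prodMk
        (hβ'.clm_apply continuousAt_const))
    exact (hap _ _).sub (hap _ _)
  supp y hy a b := by
    rw [wedge_eq hB hα.2 hβ.2 y
      (Path.Homotopic.Quotient.mk (PathConnectedSpace.somePath x₀ y))]
    rcases hK y hy with h | h
    all_goals
      rw [h]
      simp only [zero_apply, LinearMap.zero_apply, map_zero, sub_self]

variable [T2Space M] [SigmaCompactSpace M] [PathConnectedSpace M]

/-- The integral of the wedge product of forms, one of which has compact support in a disc. -/
lemma integral_wedge_eq_chart (hor : IsOrientedAtlas M) (hB : IsInvariant B σ)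
    (hα : IsBundleForm σ α) (hβ : IsBundleForm σ β) {K : Set M} (hKc : IsCompact K)
    (hK : ∀ y ∉ K, (∀ p, α y p = 0) ∨ ∀ p, β y p = 0) (he : e ∈ atlas Plane M)
    (hKe : K ⊆ e.source) (s : ∀ y : M, Path.Homotopic.Quotient x₀ y) :
    integral (wedge B α β) =
      ∫ v in e.target, wedgeIn (realForm B) (formIn e s α) (formIn e s β) v := by
  rw [(isTwoForm_wedge hB hα hβ hK).integral_eq_chart hor hKc he hKe]
  exact integral_congr_ae (Eventually.of_forall fun v => twoIn_wedge hB hα.2 hβ.2 s v)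

lemma integral_wedge_add_left (hB : IsInvariant B σ) {α' : CoverForm x₀ V}
    (hα : IsBundleForm σ α) (hα' : IsBundleForm σ α') (hαα' : IsBundleForm σ (α + α'))
    (hβ : IsBundleForm σ β) {K : Set M} (hKc : IsCompact K)
    (hK : ∀ y ∉ K, (∀ p, α y p = 0) ∨ ∀ p, β y p = 0)
    (hK' : ∀ y ∉ K, (∀ p, α' y p = 0) ∨ ∀ p, β y p = 0)  :
    integral (wedge B (α + α') β) = integral (wedge B α β) + integral (wedge B α' β) := by
  refine (isTwoForm_wedge hB hα hβ hK).integral_add (isTwoForm_wedge hB hα' hβ hK') hKc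
    (isTwoForm_wedge hB hαα' hβ fun y hy => ?_) fun y a b => ?_
  · rcases hK y hy with h | h
    · rcases hK' y hy with h' | h'
      · exact Or.inl fun p => by simp [h, h']
      · exact Or.inr h'
    · exact Or.inr h
  · let p : Path.Homotopic.Quotient x₀ y :=
      Path.Homotopic.Quotient.mk (PathConnectedSpace.somePath x₀ y)
    rw [wedge_eq hB hα.2 hβ.2 y p, wedge_eq hB hα'.2 hβ.2 y p, wedge_eq hB hαα'.2 hβ.2 y p]
    have h : ∀ a, (α + α') y p a = α y p a + α' y p a := fun _ => rfl
    rw [h, h, map_add, map_add, LinearMap.add_apply, LinearMap.add_apply]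
    ring

/-- The identity holds pointwise, so no condition on supports is needed. It also transfers
statements about the left argument of the pairing to the right one. -/
lemma integral_wedge_antisymm (hBs : B.IsSymm) (hB : IsInvariant B σ) (hα : EquivariantForm σ α)
    (hβ : EquivariantForm σ β) :
    integral (wedge B β α) = - integral (wedge B α β) := by
  rw [neg_eq_neg_one_mul]
  refine integral_smul _ fun y a b => ?_
  let p : Path.Homotopic.Quotient x₀ y :=
    Path.Homotopic.Quotient.mk (PathConnectedSpace.somePath x₀ y)
  rw [wedge_eq hB hα hβ y p, wedge_eq hB hβ hα y p, ← hBs.eq (β y p a), ← hBs.eq (β y p b)]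
  ring

lemma integral_wedge_smul_left (hB : IsInvariant B σ) (c : k) (hα : EquivariantForm σ α)
    (hcα : EquivariantForm σ (c • α)) (hβ : EquivariantForm σ β) :
    integral (wedge B (c • α) β) = c * integral (wedge B α β) := by
  refine integral_smul _ fun y a b => ?_
  let p : Path.Homotopic.Quotient x₀ y :=
    Path.Homotopic.Quotient.mk (PathConnectedSpace.somePath x₀ y)
  rw [wedge_eq hB hα hβ y p, wedge_eq hB hcα hβ y p]
  have h : ∀ a, (c • α) y p a = c • α y p a := fun _ => rfl
  rw [h, h, map_smul, map_smul, LinearMap.smul_apply, LinearMap.smul_apply, smul_eq_mul,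
    smul_eq_mul]
  ring

end Wedge

/-! ### The differential of a section, and Stokes' theorem -/

section Stokes

set_option linter.unusedSectionVars false

open IsManifold Filter Topology MeasureTheory

variable {k : Type*} [RCLike k] {V : Type*} [NormedAddCommGroup V] [NormedSpace ℝ V]
  [NormedSpace k V] [IsScalarTower ℝ k V]
  {M : Type*} [TopologicalSpace M] [ChartedSpace Plane M] [IsManifold 𝓘(ℝ, Plane) ∞ M] {x₀ : M}
  {σ : FundamentalGroup M x₀ →* (V →L[k] V)}
  {e e' : OpenPartialHomeomorph M Plane} {B : LinearMap.BilinForm k V}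

lemma exists_local_lift_through [PathConnectedSpace M] (y : M)
    (p : Path.Homotopic.Quotient x₀ y) :
    ∃ (N : Set M) (s : ∀ y : M, Path.Homotopic.Quotient x₀ y), IsOpen N ∧ y ∈ N ∧ IsLift N s ∧
      s y = p := by
  obtain ⟨N, s, hN, hy, hs⟩ := exists_local_lift (x₀ := x₀) y
  exact ⟨N, _, hN, hy, hs.translate (loopOf p (s y)), loopOf_trans _ _⟩

/-- Lifts which agree at a point agree near this point. -/
lemma IsLift.eventuallyEq {U U' : Set M} {s s' : ∀ y : M, Path.Homotopic.Quotient x₀ y}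
    (h : IsLift U s) (h' : IsLift U' s') (hU : IsOpen U) (hU' : IsOpen U') {y : M} (hy : y ∈ U)
    (hy' : y ∈ U') (heq : s' y = s y) : ∀ᶠ z in 𝓝 y, s' z = s z := by
  obtain ⟨γ, hγ⟩ := h.eventually_translate h' hU hU' hy hy'
  have h1 := hγ.self_of_nhds
  have h2 : γ = 1 := (loopOf_eq h1.symm).symm.trans (by rw [heq, loopOf_self])
  subst h2
  filter_upwards [hγ] with z hz
  rw [hz, toPath_one_trans]

variable [PathConnectedSpace M]

/-- The differential of a function on the universal cover. -/
def dSec (f : CoverFun x₀ V) : CoverForm x₀ V := fun y p =>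
  mfderiv 𝓘(ℝ, Plane) 𝓘(ℝ, V)
    (fun z => f z ((exists_local_lift_through y p).choose_spec.choose z)) y

/-- The choice of the lift in `dSec` is harmless, as lifts through the same point of the universal
cover agree nearby. -/
lemma isDifferential_dSec (f : CoverFun x₀ V) : IsDifferential f (dSec f) := by
  intro U s hU hs y hy
  obtain ⟨hN, hyN, hs', heq⟩ := (exists_local_lift_through y (s y)).choose_spec.choose_spec
  refine Filter.EventuallyEq.mfderiv_eq (I := 𝓘(ℝ, Plane)) (I' := 𝓘(ℝ, V)) (x := y) ?_
  filter_upwards [hs.eventuallyEq hs' hU hN hy hyN heq] with z hz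
  rw [hz]

lemma IsDifferential.unique {f : CoverFun x₀ V} {η η' : CoverForm x₀ V}
    (h : IsDifferential f η) (h' : IsDifferential f η') : η = η' := by
  funext y p
  obtain ⟨N, s, hN, hyN, hs, rfl⟩ := exists_local_lift_through y p
  exact (h N s hN hs y hyN).trans (h' N s hN hs y hyN).symm

lemma dSec_eq_of_eventuallyEq {f f' : CoverFun x₀ V} {y : M}
    (h : ∀ᶠ z in 𝓝 y, ∀ p, f z p = f' z p) (p : Path.Homotopic.Quotient x₀ y) :
    dSec f y p = dSec f' y p := by
  obtain ⟨N, s, hN, hyN, hs, rfl⟩ := exists_local_lift_through y p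
  refine (isDifferential_dSec f N s hN hs y hyN).trans (Eq.trans ?_
    (isDifferential_dSec f' N s hN hs y hyN).symm)
  refine Filter.EventuallyEq.mfderiv_eq (I := 𝓘(ℝ, Plane)) (I' := 𝓘(ℝ, V)) (x := y) ?_
  filter_upwards [h] with z hz using hz _

lemma dSec_zero : dSec (0 : CoverFun x₀ V) = 0 :=
  (isDifferential_dSec _).unique isDifferential_zero

lemma dSec_eq_zero {f : CoverFun x₀ V} {K : Set M} (hK : IsClosed K)
    (h : ∀ y ∉ K, ∀ p, f y p = 0) {y : M} (hy : y ∉ K) (p : Path.Homotopic.Quotient x₀ y) :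
    dSec f y p = 0 := by
  have h1 : ∀ᶠ z in 𝓝 y, ∀ p, f z p = (0 : CoverFun x₀ V) z p := by
    filter_upwards [hK.isOpen_compl.mem_nhds hy] with z hz using h z hz
  rw [dSec_eq_of_eventuallyEq h1, dSec_zero]
  rfl

lemma dSec_add {f f' : CoverFun x₀ V} (h : IsBundleSection σ f) (h' : IsBundleSection σ f') :
    dSec (f + f') = dSec f + dSec f' :=
  (isDifferential_dSec _).unique
    ((isDifferential_dSec f).add h.1 h'.1 (isDifferential_dSec f'))

lemma IsBundleSection.hasFDerivAt {f : CoverFun x₀ V} (h : IsBundleSection σ f)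
    {U : Set M} {s : ∀ y : M, Path.Homotopic.Quotient x₀ y}
    (hU : IsOpen U) (hs : IsLift U s) (he : e ∈ maximalAtlas 𝓘(ℝ, Plane) ∞ M)
    {v : Plane} (hv : v ∈ e.target) (hvU : e.symm v ∈ U) :
    HasFDerivAt (secIn e s f) (formIn e s (dSec f) v) v :=
  ((isDifferential_dSec f).isPrimitiveOn h).hasFDerivAt hU hs (Set.subset_univ U) he hv hvU

lemma IsBundleSection.contDiffOn {f : CoverFun x₀ V} (h : IsBundleSection σ f)
    {U : Set M} {s : ∀ y : M, Path.Homotopic.Quotient x₀ y}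
    (hU : IsOpen U) (hs : IsLift U s) (he : e ∈ maximalAtlas 𝓘(ℝ, Plane) ∞ M) :
    ContDiffOn ℝ ∞ (secIn e s f) (e.target ∩ e.symm ⁻¹' U) := by
  rw [← contMDiffOn_iff_contDiffOn]
  exact (h.1 U s hU hs).comp ((contMDiffOn_symm_of_mem_maximalAtlas he).mono
    Set.inter_subset_left) Set.inter_subset_right

/-- Differentiating the equivariance relation along a translated lift gives equivariance of the
differential, because the monodromy is a constant linear map. Smoothness then needs to be checked
along one lift only. -/
lemma IsBundleSection.isBundleForm {f : CoverFun x₀ V} (h : IsBundleSection σ f) :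
    IsBundleForm σ (dSec f) := by
  have heq : EquivariantForm σ (dSec f) := by
    intro γ y p a
    obtain ⟨N, s, hN, hyN, hs, rfl⟩ := exists_local_lift_through y p
    have h1 := isDifferential_dSec f N _ hN (hs.translate γ) y hyN
    have h2 : (fun z => f z (γ.toPath.trans (s z))) = fun z => mon σ γ (f z (s z)) :=
      funext fun z => h.2 γ z (s z)
    have h3 := ((mon σ γ).hasFDerivAt (x := f y (s y))).hasMFDerivAt.comp y
      (h.1.mdifferentiableAt hN hs hyN).hasMFDerivAt
    rw [h2] at h1
    have h4 : dSec f y (γ.toPath.trans (s y)) = _ := h1.trans h3.mfderiv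
    have h5 : dSec f y (s y) = _ := isDifferential_dSec f N s hN hs y hyN
    rw [h4, h5]
    rfl
  refine ⟨heq.isSmooth fun y => ?_, heq⟩
  obtain ⟨N, s, hN, hyN, hs⟩ := exists_local_lift (x₀ := x₀) y
  refine ⟨N, s, hN, hyN, hs, chartAt Plane y, chart_mem_maximalAtlas y, mem_chart_source Plane y, ?_⟩
  have ho := (chartAt Plane y).isOpen_inter_preimage_symm hN
  have h1 := (contDiffOn_infty_iff_fderiv_of_isOpen ho).1
    (h.contDiffOn hN hs (chart_mem_maximalAtlas y))
  refine (h1.2.congr fun v hv => ?_).contDiffAt (ho.mem_nhds ⟨mem_chart_target Plane y, ?_⟩)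
  · exact (h.hasFDerivAt hN hs (chart_mem_maximalAtlas y) hv.1 hv.2).fderiv.symm
  · simpa using hyN

/-- The product of a function on the surface with a function on the universal cover. -/
def mulSec (ψ : M → ℝ) (f : CoverFun x₀ V) : CoverFun x₀ V := fun y p => ψ y • f y p

lemma IsBundleSection.mulSec {ψ : M → ℝ} (hψ : ContMDiff 𝓘(ℝ, Plane) 𝓘(ℝ, ℝ) ∞ ψ)
    {f : CoverFun x₀ V} (h : IsBundleSection σ f) : IsBundleSection σ (mulSec ψ f) := by
  refine ⟨fun U s hU hs => hψ.contMDiffOn.smul (h.1 U s hU hs), fun γ y p => ?_⟩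
  simp only [FlatSurface.mulSec]
  rw [h.2]
  exact (map_smul ((σ γ⁻¹).restrictScalars ℝ) _ _).symm

lemma contDiff_indicator {E : Type*} [NormedAddCommGroup E] [NormedSpace ℝ E] {F : Plane → E}
    {Q K : Set Plane} (hQ : IsOpen Q) (hF : ContDiffOn ℝ ∞ F Q) (hK : IsClosed K)
    (hKQ : K ⊆ Q) (h0 : ∀ v ∈ Q, v ∉ K → F v = 0) :
    ContDiff ℝ ∞ (Q.indicator F) ∧ ∀ v ∉ K, Q.indicator F v = 0 := by
  have h1 : ∀ v ∉ K, Q.indicator F v = 0 :=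
    fun v hv => Set.indicator_apply_eq_zero.2 fun hvQ => h0 v hvQ hv
  refine ⟨contDiff_iff_contDiffAt.2 fun v => ?_, h1⟩
  by_cases hv : v ∈ K
  · refine (hF.contDiffAt (hQ.mem_nhds (hKQ hv))).congr_of_eventuallyEq ?_
    filter_upwards [hQ.mem_nhds (hKQ hv)] with w hw using Set.indicator_of_mem hw _
  · refine (contDiffAt_const (c := (0 : E))).congr_of_eventuallyEq ?_
    filter_upwards [hK.isOpen_compl.mem_nhds hv] with w hw using h1 w hw

lemma IsCompact.chart_image {C : Set M} (hC : IsCompact C) {Q : Set Plane} (hQ : Q ⊆ e.target)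
    (hCQ : C ⊆ e.symm '' Q) : IsCompact (e '' C) ∧ e '' C ⊆ Q ∧
      ∀ v ∈ e.target, v ∉ e '' C → e.symm v ∉ C := by
  refine ⟨hC.image_of_continuousOn (e.continuousOn.mono fun y hy =>
    ((mem_chart_image hQ).1 (hCQ hy)).1), ?_, fun v hv hvC h => hvC ⟨_, h, e.right_inv hv⟩⟩
  rintro _ ⟨y, hy, rfl⟩
  exact ((mem_chart_image hQ).1 (hCQ hy)).2

variable [FiniteDimensional k V] [T2Space M] [SigmaCompactSpace M]

/-- The support lies in a disc with a lift, so `integral_wedge_eq_chart` reduces the claim to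
Stokes' theorem in the plane, applied to the extension by zero of the local expression of `f`. -/
lemma integral_wedge_dSec_of_disc (hor : IsOrientedAtlas M) (hB : IsInvariant B σ)
    {f : CoverFun x₀ V} (hf : IsBundleSection σ f) {α : CoverForm x₀ V} (hα : IsBundleForm σ α)
    (hαc : α.IsClosed) (he : e ∈ atlas Plane M) {Q : Set Plane} (hQo : IsOpen Q)
    (hQc : Convex ℝ Q) (hQ : Q ⊆ e.target) {C : Set M} (hC : IsCompact C)
    (hCQ : C ⊆ e.symm '' Q) (h0 : ∀ y ∉ C, ∀ p, f y p = 0) :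
    integral (wedge B (dSec f) α) = 0 := by
  have hem := subset_maximalAtlas (I := 𝓘(ℝ, Plane)) (n := ∞) he
  have ho := isOpen_chart_image e hQo hQ
  obtain ⟨hK, hKQ, hKC⟩ := IsCompact.chart_image hC hQ hCQ
  have hd0 : ∀ y ∉ C, ∀ p, dSec f y p = 0 := fun y hy p => dSec_eq_zero hC.isClosed h0 hy p
  rcases Q.eq_empty_or_nonempty with rfl | ⟨v₀, hv₀⟩
  · have : f = 0 := by
      funext y p
      exact h0 y (fun hy => by simpa using hCQ hy) p
    rw [this, dSec_zero]
    have := integral_wedge_smul_left (c := (0 : k)) hB hα.2 (by rw [zero_smul]; intro γ y p a; exact (map_zero (σ γ⁻¹)).symm) hα.2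
    rwa [zero_smul, zero_mul] at this
  obtain ⟨s, hs, -⟩ := exists_isLift e hQc hQ ⟨v₀, hv₀, rfl⟩
    (Path.Homotopic.Quotient.mk (PathConnectedSpace.somePath x₀ (e.symm v₀)))
  rw [integral_wedge_eq_chart hor hB hf.isBundleForm hα hC (fun y hy => Or.inl (hd0 y hy)) he
    (fun y hy => ((mem_chart_image hQ).1 (hCQ hy)).1) s]
  have hsub : Q ⊆ e.target ∩ e.symm ⁻¹' (e.symm '' Q) := fun v hv => ⟨hQ hv, v, hv, rfl⟩
  obtain ⟨hu, hu0⟩ := contDiff_indicator hQo ((hf.contDiffOn ho hs hem).mono hsub) hK.isClosed hKQ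
    fun v hv hvK => h0 _ (hKC v (hQ hv) hvK) _
  have hfd : ∀ v ∈ e.target, formIn e s (dSec f) v = fderiv ℝ (Q.indicator (secIn e s f)) v := by
    intro v hv
    by_cases hvQ : v ∈ Q
    · have h1 : Q.indicator (secIn e s f) =ᶠ[𝓝 v] secIn e s f := by
        filter_upwards [hQo.mem_nhds hvQ] with w hw using Set.indicator_of_mem hw _
      rw [h1.fderiv_eq, (hf.hasFDerivAt ho hs hem hv ⟨v, hvQ, rfl⟩).fderiv]
    · have h1 : v ∉ e '' C := fun h => hvQ (hKQ h)
      rw [fderiv_eq_zero_of_support hK.isClosed hu0 h1]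
      ext a
      change dSec f _ _ _ = 0
      rw [hd0 _ (hKC v hv h1)]
      rfl
  calc ∫ v in e.target, wedgeIn (realForm B) (formIn e s (dSec f)) (formIn e s α) v
      = ∫ v in e.target, wedgeIn (realForm B) (fderiv ℝ (Q.indicator (secIn e s f)))
          (formIn e s α) v :=
        setIntegral_congr_fun e.open_target.measurableSet fun v hv => by
          simp only [wedgeIn, hfd v hv]
    _ = ∫ v, wedgeIn (realForm B) (fderiv ℝ (Q.indicator (secIn e s f))) (formIn e s α) v := by
        refine setIntegral_eq_integral_of_forall_compl_eq_zero fun v hv => ?_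
        have h1 : v ∉ e '' C := fun h => hv (hQ (hKQ h))
        simp [wedgeIn, fderiv_eq_zero_of_support hK.isClosed hu0 h1]
    _ = 0 := integral_wedgeIn_fderiv_left (realForm B) hQo hK hKQ hu hu0
        (fun v hv => (hα.1.contDiffAt ho hs hem (hQ hv) ⟨v, hv, rfl⟩).contDiffWithinAt)
        fun v hv => hαc.curl_eq_zero hα.1 ho hs hem (hQ hv) ⟨v, hv, rfl⟩

/-- Partitions of unity near a compact set, consisting of functions with compact supports in
discs. -/
lemma exists_disc_partition {K : Set M} (hK : IsCompact K) :
    ∃ (S : Finset M) (ψ : M → M → ℝ), (∀ i, ContMDiff 𝓘(ℝ, Plane) 𝓘(ℝ, ℝ) ∞ (ψ i)) ∧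
      (∀ i, IsCompact (tsupport (ψ i)) ∧ ∃ Q : Set Plane, IsOpen Q ∧ Convex ℝ Q ∧
        Q ⊆ (chartAt Plane i).target ∧ tsupport (ψ i) ⊆ (chartAt Plane i).symm '' Q) ∧
      ∀ y ∈ K, ∑ i ∈ S, ψ i y = 1 := by
  -- Closed balls inside the chart are used so that the supports, being closed subsets of their
  -- images, are compact.
  have h1 : ∀ i : M, ∃ r > 0, Metric.closedBall (chartAt Plane i i) r ⊆ (chartAt Plane i).target := by
    intro i
    exact Metric.nhds_basis_closedBall.mem_iff.1
      ((chartAt Plane i).open_target.mem_nhds (mem_chart_target Plane i))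
  choose r hr h2 using h1
  have h3 : ∀ i : M, Metric.ball (chartAt Plane i i) (r i) ⊆ (chartAt Plane i).target :=
    fun i => Metric.ball_subset_closedBall.trans (h2 i)
  obtain ⟨P, hP⟩ := SmoothPartitionOfUnity.exists_isSubordinate 𝓘(ℝ, Plane) hK.isClosed
    (fun i : M => (chartAt Plane i).symm '' Metric.ball (chartAt Plane i i) (r i))
    (fun i => isOpen_chart_image _ Metric.isOpen_ball (h3 i))
    (fun y _ => Set.mem_iUnion.2 ⟨y, (mem_chart_image (h3 y)).2
      ⟨mem_chart_source Plane y, Metric.mem_ball_self (hr y)⟩⟩)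
  have hfin : {i : M | ∃ y ∈ K, P i y ≠ 0}.Finite := by
    refine (P.locallyFinite.finite_nonempty_inter_compact hK).subset ?_
    rintro i ⟨y, hy, h⟩
    exact ⟨y, h, hy⟩
  refine ⟨hfin.toFinset, fun i => P i, fun i => (P i).contMDiff, fun i => ⟨?_, _,
    Metric.isOpen_ball, convex_ball _ _, h3 i, hP i⟩, fun y hy => ?_⟩
  · refine IsCompact.of_isClosed_subset ((isCompact_closedBall _ _).image_of_continuousOn
      ((chartAt Plane i).continuousOn_symm.mono (h2 i))) (isClosed_tsupport _)
      ((hP i).trans (Set.image_mono Metric.ball_subset_closedBall))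
  · rw [← P.sum_eq_one hy, finsum_eq_sum_of_support_subset]
    intro i hi
    simpa using ⟨y, hy, hi⟩

/-- The bridge from discs to the whole surface: the differential of a cut-off of `f` is a finite sum
of differentials supported in discs. The first two conclusions are carried along because additivity
of the integral needs bundle forms with a common compact support. -/
lemma integral_wedge_dSec_sum (hor : IsOrientedAtlas M) (hB : IsInvariant B σ)
    {f : CoverFun x₀ V} (hf : IsBundleSection σ f) {α : CoverForm x₀ V} (hα : IsBundleForm σ α)
    (hαc : α.IsClosed) {ψ : M → M → ℝ} (hψ : ∀ i, ContMDiff 𝓘(ℝ, Plane) 𝓘(ℝ, ℝ) ∞ (ψ i))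
    (hd : ∀ i, IsCompact (tsupport (ψ i)) ∧ ∃ Q : Set Plane, IsOpen Q ∧ Convex ℝ Q ∧
        Q ⊆ (chartAt Plane i).target ∧ tsupport (ψ i) ⊆ (chartAt Plane i).symm '' Q)
    (S : Finset M) :
    IsBundleSection σ (mulSec (fun y => ∑ i ∈ S, ψ i y) f) ∧
    (∃ K : Set M, IsCompact K ∧ ∀ y ∉ K, ∑ i ∈ S, ψ i y = 0) ∧
    integral (wedge B (dSec (mulSec (fun y => ∑ i ∈ S, ψ i y) f)) α) = 0 := by
  classical
  induction S using Finset.induction_on with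
  | empty =>
    have h0 : mulSec (fun y : M => ∑ i ∈ (∅ : Finset M), ψ i y) f = 0 := by
      funext y p; simp [mulSec]
    rw [h0]
    refine ⟨isBundleSection_zero σ, ⟨∅, isCompact_empty, by simp⟩, ?_⟩
    exact integral_wedge_dSec_of_disc hor hB (isBundleSection_zero σ) hα hαc
      (chart_mem_atlas Plane x₀) isOpen_empty convex_empty (Set.empty_subset _) isCompact_empty
      (Set.empty_subset _) fun _ _ _ => rfl
  | insert i S hi ih =>
    obtain ⟨h1, ⟨K, hK, hK0⟩, h2⟩ := ih
    obtain ⟨hc, Q, hQo, hQc, hQ, hQs⟩ := hd i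
    have hsum : mulSec (fun y => ∑ j ∈ insert i S, ψ j y) f =
        mulSec (ψ i) f + mulSec (fun y => ∑ j ∈ S, ψ j y) f := by
      funext y p
      simp [mulSec, Finset.sum_insert hi, add_smul]
    have h3 := hf.mulSec (hψ i)
    have h0 : ∀ y ∉ tsupport (ψ i), ψ i y = 0 := fun y hy => image_eq_zero_of_notMem_tsupport hy
    have h4 : ∀ y ∉ tsupport (ψ i), ∀ p, mulSec (ψ i) f y p = 0 := fun y hy p => by
      simp [mulSec, h0 y hy]
    have h5 : ∀ y ∉ K, ∀ p, mulSec (fun y => ∑ j ∈ S, ψ j y) f y p = 0 := fun y hy p => by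
      simp [mulSec, hK0 y hy]
    refine ⟨hsum ▸ h3.add h1, ⟨_, hc.union hK, fun y hy => ?_⟩, ?_⟩
    · rw [Set.mem_union, not_or] at hy
      rw [Finset.sum_insert hi, h0 y hy.1, hK0 y hy.2, add_zero]
    · have h6 := (h3.add h1).isBundleForm
      rw [dSec_add h3 h1] at h6
      rw [hsum, dSec_add h3 h1, integral_wedge_add_left hB h3.isBundleForm h1.isBundleForm h6 hα
        (hc.union hK), h2, integral_wedge_dSec_of_disc hor hB h3 hα hαc (chart_mem_atlas Plane i)
          hQo hQc hQ hc hQs h4, add_zero]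
      · intro y hy
        rw [Set.mem_union, not_or] at hy
        exact Or.inl fun p => dSec_eq_zero hc.isClosed h4 hy.1 p
      · intro y hy
        rw [Set.mem_union, not_or] at hy
        exact Or.inl fun p => dSec_eq_zero hK.isClosed h5 hy.2 p

/-- Stokes' theorem for `B(df ∧ α)`, where `α` is closed and `f` has compact support. -/
lemma integral_wedge_dSec_left (hor : IsOrientedAtlas M) (hB : IsInvariant B σ)
    {f : CoverFun x₀ V} (hf : IsBundleSection σ f) (hfc : HasCompactSupp f)
    {α : CoverForm x₀ V} (hα : IsBundleForm σ α) (hαc : α.IsClosed) :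
    integral (wedge B (dSec f) α) = 0 := by
  obtain ⟨K, hK, h0⟩ := hfc
  obtain ⟨S, ψ, hψ, hd, hS⟩ := exists_disc_partition hK
  have : mulSec (fun y => ∑ i ∈ S, ψ i y) f = f := by
    funext y p
    by_cases hy : y ∈ K
    · simp [mulSec, hS y hy]
    · simp [mulSec, h0 y hy]
  rw [← this]
  exact (integral_wedge_dSec_sum hor hB hf hα hαc hψ hd S).2.2

/-- Stokes' theorem for `B(df ∧ α)`, where `α` is closed and has compact support. -/
lemma integral_wedge_dSec_right (hor : IsOrientedAtlas M) (hB : IsInvariant B σ)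
    {f : CoverFun x₀ V} (hf : IsBundleSection σ f)
    {α : CoverForm x₀ V} (hα : IsBundleForm σ α) (hαc : α.IsClosed) (hαs : HasCompactSupp α) :
    integral (wedge B (dSec f) α) = 0 := by
  obtain ⟨K, hK, h0⟩ := hαs
  have : LocallyCompactSpace M := ChartedSpace.locallyCompactSpace Plane M
  -- The cut-off has to be one on a neighbourhood of the support of `α`, and not only on the
  -- support, so that the differentials of `f` and of its cut-off agree there.
  obtain ⟨K', hK', hKK'⟩ := exists_compact_superset hK
  obtain ⟨S, ψ, hψ, hd, hS⟩ := exists_disc_partition hK'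
  obtain ⟨h1, -, h2⟩ := integral_wedge_dSec_sum hor hB hf hα hαc hψ hd S
  rw [← h2]
  congr 1
  funext y a b
  let p : Path.Homotopic.Quotient x₀ y :=
    Path.Homotopic.Quotient.mk (PathConnectedSpace.somePath x₀ y)
  rw [wedge_eq hB hf.isBundleForm.2 hα.2 y p, wedge_eq hB h1.isBundleForm.2 hα.2 y p]
  by_cases hy : y ∈ K
  · have h3 : ∀ᶠ z in 𝓝 y, ∀ p, f z p = mulSec (fun y => ∑ i ∈ S, ψ i y) f z p := by
      filter_upwards [isOpen_interior.mem_nhds (hKK' hy)] with z hz p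
      simp [mulSec, hS z (interior_subset hz)]
    rw [dSec_eq_of_eventuallyEq h3]
  · rw [h0 y hy]
    simp only [zero_apply, map_zero, sub_self]

end Stokes

/-! ### Poincaré's lemma with compact supports on the plane -/

section CompactPoincare

open MeasureTheory Filter Topology

/-- Primitives of a smooth function with parameters, which vanish at `-∞`. -/
lemma exists_smooth_primitive {P : Type*} [NormedAddCommGroup P] [NormedSpace ℝ P]
    {G : P × ℝ → ℝ} (hG : ContDiff ℝ ∞ G) {a b : ℝ}
    (h0 : ∀ p t, t ∉ Set.Icc a b → G (p, t) = 0) :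
    ∃ I : P × ℝ → ℝ, ContDiff ℝ ∞ I ∧ (∀ p t, HasDerivAt (fun t => I (p, t)) (G (p, t)) t) ∧
      (∀ p t, t < a → I (p, t) = 0) ∧ (∀ p t, b ≤ t → I (p, t) = ∫ u, G (p, u)) ∧
      ∀ p, (∀ t, G (p, t) = 0) → ∀ t, I (p, t) = 0 := by
  have hint : ∀ p, Integrable fun u => G (p, u) := fun p =>
    (hG.continuous.comp (Continuous.prodMk_right p)).integrable_of_hasCompactSupport
      (HasCompactSupport.intro isCompact_Icc fun t ht => h0 p t ht)
  have hsm : ContDiff ℝ ∞ fun q : P × ℝ => ∫ u in Set.Iic q.2, G (q.1, u) := by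
    -- The primitive is the convolution in `t` with the indicator function of `[0, ∞)`; smoothness
    -- of convolutions with parameters gives joint smoothness in `p` and `t`.
    have h1 := contDiffOn_convolution_right_with_param (n := ⊤) (μ := volume)
      (f := Set.indicator (Set.Ici (0 : ℝ)) fun _ => (1 : ℝ)) (ContinuousLinearMap.mul ℝ ℝ)
      (g := fun p t => G (p, t)) (s := Set.univ) isOpen_univ (isCompact_Icc (a := a) (b := b))
      (fun p t _ ht => h0 p t ht)
      ((locallyIntegrable_const (1 : ℝ)).indicator measurableSet_Ici)
      (by simpa [Function.HasUncurry.uncurry] using hG.contDiffOn)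
    rw [Set.univ_prod_univ, contDiffOn_univ] at h1
    convert h1 using 1
    funext q
    rw [convolution_def, ← integral_indicator measurableSet_Iic]
    refine Eq.trans ?_ (integral_sub_left_eq_self (μ := volume) _ q.2)
    refine integral_congr_ae (Eventually.of_forall fun u => ?_)
    by_cases hu : u ≤ q.2
    · simp [Set.indicator, hu]
    · simp [Set.indicator, hu]
  refine ⟨_, hsm, fun p t => ?_, fun p t ht => ?_, fun p t ht => ?_, fun p hp t => ?_⟩
  · have h1 : (fun t => ∫ u in Set.Iic t, G (p, u)) =
        fun t => (∫ u in (a - 1)..t, G (p, u)) + ∫ u in Set.Iic (a - 1), G (p, u) := by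
      funext t
      rw [← intervalIntegral.integral_Iic_sub_Iic (hint p).integrableOn (hint p).integrableOn,
        sub_add_cancel]
    have hc : Continuous fun u => G (p, u) := hG.continuous.comp (Continuous.prodMk_right p)
    change HasDerivAt (fun t => ∫ u in Set.Iic t, G (p, u)) _ _
    rw [h1]
    exact (intervalIntegral.integral_hasDerivAt_right (hc.intervalIntegrable _ _)
      hc.aestronglyMeasurable.stronglyMeasurableAtFilter hc.continuousAt).add_const _
  · exact setIntegral_eq_zero_of_forall_eq_zero fun u hu =>
      h0 p u fun h => (h.1.trans (Set.mem_Iic.1 hu)).not_gt ht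
  · exact setIntegral_eq_integral_of_forall_compl_eq_zero fun u hu =>
      h0 p u fun h => hu (h.2.trans ht)
  · exact setIntegral_eq_zero_of_forall_eq_zero fun u _ => hp u

lemma exists_smooth_bump_interval {a b : ℝ} (hab : a < b) :
    ∃ χ : ℝ → ℝ, ContDiff ℝ ∞ χ ∧ (∀ t ∉ Set.Icc a b, χ t = 0) ∧ ∫ t, χ t = 1 := by
  let f : ContDiffBump ((a + b) / 2) := ⟨(b - a) / 4, (b - a) / 2, by linarith, by linarith⟩
  refine ⟨f.normed volume, f.contDiff_normed, fun t ht => ?_, f.integral_normed⟩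
  refine image_eq_zero_of_notMem_tsupport ?_
  rw [f.tsupport_normed_eq, Real.closedBall_eq_Icc]
  convert ht using 3 <;> simp only [f] <;> ring

/-- A smooth function on `ℝ²` with support in a box and integral zero is `∂ₓu - ∂_yw` for smooth
functions `u`, `w` with support in this box. -/
lemma exists_curl_eq_prod {h : ℝ × ℝ → ℝ} (hh : ContDiff ℝ ∞ h) {a₁ b₁ a₂ b₂ : ℝ} (hab : a₁ < b₁)
    (h0 : ∀ x y, (x ∉ Set.Icc a₁ b₁ ∨ y ∉ Set.Icc a₂ b₂) → h (x, y) = 0)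
    (hint : ∫ z, h z = 0) :
    ∃ u w : ℝ × ℝ → ℝ, ContDiff ℝ ∞ u ∧ ContDiff ℝ ∞ w ∧
      (∀ x y, (x ∉ Set.Icc a₁ b₁ ∨ y ∉ Set.Icc a₂ b₂) → u (x, y) = 0 ∧ w (x, y) = 0) ∧
      ∀ x y, ∃ c, HasDerivAt (fun t => u (t, y)) (h (x, y) + c) x ∧
        HasDerivAt (fun t => w (x, t)) c y := by
  obtain ⟨χ, hχ, hχ0, hχ1⟩ := exists_smooth_bump_interval hab
  have hhc : HasCompactSupport h := by
    refine HasCompactSupport.intro (isCompact_Icc.prod (isCompact_Icc (a := a₂) (b := b₂))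
      (s := Set.Icc a₁ b₁)) fun z hz => ?_
    rw [Set.mem_prod, not_and_or] at hz
    exact h0 z.1 z.2 hz
  have hhi := hh.continuous.integrable_of_hasCompactSupport hhc (μ := volume)
  obtain ⟨A, hA, -, -, hA2, hA3⟩ := exists_smooth_primitive (P := ℝ) (G := fun q => h (q.2, q.1))
    (hh.comp (contDiff_snd.prodMk contDiff_fst)) (a := a₁) (b := b₁)
    fun p t ht => h0 t p (Or.inl ht)
  -- The integrals of `h` over horizontal lines. Expressing them as values at `b₁` of the smooth
  -- primitive `A` makes smoothness in `y` evident.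
  let ψ : ℝ → ℝ := fun y => A (y, b₁)
  have hψ : ContDiff ℝ ∞ ψ := hA.comp (contDiff_id.prodMk contDiff_const)
  have hψe : ∀ y, ψ y = ∫ x, h (x, y) := fun y => hA2 y b₁ le_rfl
  have hψ0 : ∀ y ∉ Set.Icc a₂ b₂, ψ y = 0 := fun y hy => hA3 y (fun t => h0 t y (Or.inr hy)) _
  have hψi : ∫ y, ψ y = 0 := by
    simp_rw [hψe]
    rw [← hint, Measure.volume_eq_prod, integral_prod_symm _ hhi]
  -- By Fubini `ψ` has integral zero, so its primitive `Ψ` vanishes on both sides of the interval.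
  -- The parameter space is a dummy, always evaluated at `0`.
  obtain ⟨Ψ, hΨ, hΨ1, hΨ2, hΨ3, -⟩ := exists_smooth_primitive (P := ℝ) (G := fun q => ψ q.2)
    (hψ.comp contDiff_snd) (a := a₂) (b := b₂) fun p t ht => hψ0 t ht
  have hΨ0 : ∀ t ∉ Set.Icc a₂ b₂, Ψ (0, t) = 0 := by
    intro t ht
    rw [Set.mem_Icc, not_and_or, not_le, not_le] at ht
    rcases ht with ht | ht
    · exact hΨ2 0 t ht
    · rw [hΨ3 0 t ht.le, hψi]
  -- Subtracting `χ ψ` makes all horizontal integrals zero, so the primitive in the direction of `x`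
  -- has support in the box. The correction is `-∂_y w` for `w = -χ Ψ`, whose support is in the box
  -- too.
  obtain ⟨U, hU, hU1, hU2, hU3, hU4⟩ := exists_smooth_primitive (P := ℝ)
    (G := fun q => h (q.2, q.1) - χ q.2 * ψ q.1)
    ((hh.comp (contDiff_snd.prodMk contDiff_fst)).sub
      ((hχ.comp contDiff_snd).mul (hψ.comp contDiff_fst))) (a := a₁) (b := b₁)
    fun p t ht => by simp [h0 t p (Or.inl ht), hχ0 t ht]
  refine ⟨fun q => U (q.2, q.1), fun q => -(χ q.1 * Ψ (0, q.2)),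
    hU.comp (contDiff_snd.prodMk contDiff_fst), ((hχ.comp contDiff_fst).mul
      (hΨ.comp (contDiff_const.prodMk contDiff_snd))).neg, fun x y hxy => ⟨?_, ?_⟩, fun x y =>
      ⟨-(χ x * ψ y), ?_, ?_⟩⟩
  · by_cases hy : y ∈ Set.Icc a₂ b₂
    · have hx := hxy.resolve_right (not_not.2 hy)
      rw [Set.mem_Icc, not_and_or, not_le, not_le] at hx
      rcases hx with hx | hx
      · exact hU2 y x hx
      · refine (hU3 y x hx.le).trans ?_
        simp only
        rw [integral_sub, integral_mul_const, hχ1, one_mul, hψe, sub_self]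
        · exact (hh.continuous.comp (Continuous.prodMk_left y)).integrable_of_hasCompactSupport
            (HasCompactSupport.intro isCompact_Icc fun t ht => h0 t y (Or.inl ht))
        · exact (hχ.continuous.mul continuous_const).integrable_of_hasCompactSupport
            (HasCompactSupport.intro (isCompact_Icc (a := a₁) (b := b₁))
              fun t ht => by simp [hχ0 t ht])
    · exact hU4 y (fun t => by simp [h0 t y (Or.inr hy), hψ0 y hy]) x
  · rcases hxy with hx | hy
    · simp [hχ0 x hx]
    · simp [hΨ0 y hy]
  · exact hU1 y x
  · exact ((hΨ1 0 y).const_mul (χ x)).neg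

/-- An open box in the plane. -/
def box (a b : Fin 2 → ℝ) : Set Plane := {v | ∀ i, v i ∈ Set.Ioo (a i) (b i)}

lemma isOpen_box (a b : Fin 2 → ℝ) : IsOpen (box a b) := by
  have : box a b = ⋂ i, (fun v : Plane => v i) ⁻¹' Set.Ioo (a i) (b i) := by
    ext v; simp [box]
  rw [this]
  exact isOpen_iInter_of_finite fun i => isOpen_Ioo.preimage (by fun_prop)

lemma convex_box (a b : Fin 2 → ℝ) : Convex ℝ (box a b) := by
  intro v hv w hw s t hs ht hst i
  exact (convex_Ioo (a i) (b i)) (hv i) (hw i) hs ht hst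

lemma exists_box {Q : Set Plane} (hQ : IsOpen Q) {v : Plane} (hv : v ∈ Q) :
    ∃ a b, v ∈ box a b ∧ box a b ⊆ Q := by
  have h1 : (WithLp.toLp 2 : (Fin 2 → ℝ) → Plane) ⁻¹' Q ∈ 𝓝 (WithLp.ofLp v) :=
    (hQ.preimage (by fun_prop)).mem_nhds hv
  obtain ⟨r, hr, h2⟩ := Metric.mem_nhds_iff.1 h1
  refine ⟨fun i => v i - r, fun i => v i + r, fun i => ⟨by linarith, by linarith⟩, fun w hw => ?_⟩
  have h3 : WithLp.ofLp w ∈ Metric.ball (WithLp.ofLp v) r := by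
    rw [Metric.mem_ball, dist_pi_lt_iff hr]
    intro i
    rw [Real.dist_eq, abs_lt]
    have := hw i
    constructor <;> linarith [this.1, this.2]
  exact h2 h3

/-- Taking midpoints ensures `a' < b'` even if `S` is a single point; the bump function in
`exists_curl_eq_prod` needs an interval of positive length. -/
lemma exists_Icc_of_isCompact {S : Set ℝ} (hS : IsCompact S) (hne : S.Nonempty) {a b : ℝ}
    (h : S ⊆ Set.Ioo a b) : ∃ a' b', a < a' ∧ a' < b' ∧ b' < b ∧ S ⊆ Set.Icc a' b' := by
  obtain ⟨x, hx, hxm⟩ := hS.exists_isLeast hne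
  obtain ⟨y, hy, hym⟩ := hS.exists_isGreatest hne
  have h1 := (h hx).1
  have h2 := (h hy).2
  have h3 := hxm hy
  exact ⟨(a + x) / 2, (y + b) / 2, by linarith, by linarith, by linarith,
    fun z hz => ⟨by linarith [hxm hz], by linarith [hym hz]⟩⟩

lemma integral_plane (h : Plane → ℝ) : ∫ z : ℝ × ℝ, h !₂[z.1, z.2] = ∫ v, h v := by
  have h1 := (PiLp.volume_preserving_toLp (Fin 2)).comp (volume_preserving_finTwoArrow ℝ).symm
  have h2 := h1.integral_comp ((MeasurableEquiv.toLp 2 (Fin 2 → ℝ)).measurableEmbedding.comp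
    (MeasurableEquiv.finTwoArrow (α := ℝ)).symm.measurableEmbedding) h
  rw [← h2]
  refine integral_congr_ae (Eventually.of_forall fun z => ?_)
  simp only [Function.comp_apply]
  rfl

lemma fderiv_eq_of_hasDerivAt {F : Plane → ℝ} {v a : Plane} (hF : DifferentiableAt ℝ F v) {c : ℝ}
    (h : HasDerivAt (fun t : ℝ => F (v + t • a)) c 0) : fderiv ℝ F v a = c :=
  (hF.hasFDerivAt.hasLineDerivAt a).lineDeriv.symm.trans h.deriv

/-- Poincaré's lemma with compact supports, in degree two, for a box in the plane. -/
lemma exists_curl_eq {a b : Fin 2 → ℝ} {h : Plane → ℝ} (hh : ContDiff ℝ ∞ h) {K : Set Plane}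
    (hK : IsCompact K) (hKQ : K ⊆ box a b) (h0 : ∀ v ∉ K, h v = 0) (hint : ∫ v, h v = 0) :
    ∃ (ζ : Plane → Plane →L[ℝ] ℝ) (K' : Set Plane), ContDiff ℝ ∞ ζ ∧ IsCompact K' ∧ K' ⊆ box a b ∧
      (∀ v ∉ K', ζ v = 0) ∧ ∀ v, curl ζ v = h v := by
  rcases K.eq_empty_or_nonempty with rfl | hne
  · refine ⟨fun _ => 0, ∅, contDiff_const, isCompact_empty, Set.empty_subset _, fun _ _ => rfl,
      fun v => ?_⟩
    rw [h0 v (Set.notMem_empty v)]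
    simp [curl]
  have hc : ∀ i, ∃ a' b', a i < a' ∧ a' < b' ∧ b' < b i ∧ (fun v : Plane => v i) '' K ⊆ Set.Icc a' b' := by
    intro i
    refine exists_Icc_of_isCompact (hK.image (by fun_prop)) (hne.image _) ?_
    rintro _ ⟨v, hv, rfl⟩
    exact hKQ hv i
  choose a' b' h1 h2 h3 h4 using hc
  obtain ⟨u, w, hu, hw, huw, hd⟩ := exists_curl_eq_prod (h := fun z => h !₂[z.1, z.2])
    (hh.comp (PiLp.contDiff_toLp.comp (contDiff_pi.2 fun i => by
      fin_cases i
      · exact contDiff_fst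
      · exact contDiff_snd))) (h2 0) (a₂ := a' 1) (b₂ := b' 1)
    (fun x y hxy => h0 _ fun hK' => by
      rcases hxy with hx | hy
      · exact hx (h4 0 ⟨_, hK', rfl⟩)
      · exact hy (h4 1 ⟨_, hK', rfl⟩))
    (by rw [integral_plane h, hint])
  let pr : Fin 2 → Plane →L[ℝ] ℝ := fun i => EuclideanSpace.proj i
  have hpr : ContDiff ℝ ∞ fun v : Plane => (v 0, v 1) :=
    (pr 0).contDiff.prodMk (pr 1).contDiff
  -- This is `w dx + u dy`, whose differential has the coefficient `∂ₓu - ∂_yw`.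
  let ζ : Plane → Plane →L[ℝ] ℝ := fun v => w (v 0, v 1) • pr 0 + u (v 0, v 1) • pr 1
  have hζ : ContDiff ℝ ∞ ζ := ((hw.comp hpr).smul contDiff_const).add
    ((hu.comp hpr).smul contDiff_const)
  let K' : Set Plane := WithLp.toLp 2 '' Set.Icc a' b'
  refine ⟨ζ, K', hζ, isCompact_Icc.image (by fun_prop), ?_, fun v hv => ?_, fun v => ?_⟩
  · rintro _ ⟨v, hv, rfl⟩ i
    exact ⟨(h1 i).trans_le (hv.1 i), (hv.2 i).trans_lt (h3 i)⟩
  · have h5 : v 0 ∉ Set.Icc (a' 0) (b' 0) ∨ v 1 ∉ Set.Icc (a' 1) (b' 1) := by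
      by_contra! hcon
      refine hv ⟨WithLp.ofLp v, ⟨fun i => ?_, fun i => ?_⟩, rfl⟩ <;> fin_cases i
      exacts [hcon.1.1, hcon.2.1, hcon.1.2, hcon.2.2]
    simp [ζ, huw _ _ h5]
  · have hζd := hζ.differentiable (by simp) v
    obtain ⟨c, hd1, hd2⟩ := hd (v 0) (v 1)
    have hv : !₂[v 0, v 1] = v := by ext i; fin_cases i <;> rfl
    have h5 : fderiv ℝ (fun v => ζ v (EuclideanSpace.single 1 1)) v
        (EuclideanSpace.single 0 1) = h v + c := by
      refine fderiv_eq_of_hasDerivAt (hζd.clm_apply (differentiableAt_const _)) ?_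
      have h6 : HasDerivAt (fun t => u (t, v 1)) (h v + c) (v 0 + 0) := by
        rw [add_zero]; simpa only [hv] using hd1
      refine (h6.comp_const_add (v 0) 0).congr_of_eventuallyEq (Eventually.of_forall fun t => ?_)
      simp [ζ, pr]
    have h7 : fderiv ℝ (fun v => ζ v (EuclideanSpace.single 0 1)) v
        (EuclideanSpace.single 1 1) = c := by
      refine fderiv_eq_of_hasDerivAt (hζd.clm_apply (differentiableAt_const _)) ?_
      have h6 : HasDerivAt (fun t => w (v 0, t)) c (v 1 + 0) := by rwa [add_zero]
      refine (h6.comp_const_add (v 1) 0).congr_of_eventuallyEq (Eventually.of_forall fun t => ?_)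
      simp [ζ, pr]
    rw [fderiv_apply_const hζd] at h5 h7
    rw [curl, h5, h7, add_sub_cancel_right]

end CompactPoincare

/-! ### Forms with compact support in a disc -/

section LocalForms

set_option linter.unusedSectionVars false

open IsManifold Filter Topology MeasureTheory

variable {k : Type*} [RCLike k] {V : Type*} [NormedAddCommGroup V] [NormedSpace ℝ V]
  [NormedSpace k V] [IsScalarTower ℝ k V]
  {M : Type*} [TopologicalSpace M] [ChartedSpace Plane M] [IsManifold 𝓘(ℝ, Plane) ∞ M] {x₀ : M}
  {σ : FundamentalGroup M x₀ →* (V →L[k] V)}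
  {e e' : OpenPartialHomeomorph M Plane} {B : LinearMap.BilinForm k V}

/-- The Jacobian determinant at `y` of the chart `e` with respect to the preferred chart at `y`. -/
def jac (e : OpenPartialHomeomorph M Plane) (y : M) : ℝ :=
  (fderiv ℝ (e ∘ (chartAt Plane y).symm) (chartAt Plane y y)).det

/-- The chain rule through the preferred chart at `y`. It makes coefficients computed in different
charts describe the same 2-form. -/
lemma jac_mul (he : e ∈ maximalAtlas 𝓘(ℝ, Plane) ∞ M) (he' : e' ∈ maximalAtlas 𝓘(ℝ, Plane) ∞ M)
    {y : M} (hy : y ∈ e.source) (hy' : y ∈ e'.source) :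
    jac e y = (fderiv ℝ (e ∘ e'.symm) (e' y)).det * jac e' y := by
  set c := chartAt Plane y with hc
  have hcm : c ∈ maximalAtlas 𝓘(ℝ, Plane) ∞ M := chart_mem_maximalAtlas y
  have hyc : y ∈ c.source := mem_chart_source Plane y
  have hv : c y ∈ c.target ∩ c.symm ⁻¹' e'.source :=
    ⟨c.map_source hyc, by simpa [c.left_inv hyc] using hy'⟩
  have hw : e' y ∈ e'.target ∩ e'.symm ⁻¹' e.source :=
    ⟨e'.map_source hy', by simpa [e'.left_inv hy'] using hy⟩
  have h1 : e ∘ c.symm =ᶠ[𝓝 (c y)] (e ∘ e'.symm) ∘ (e' ∘ c.symm) := by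
    filter_upwards [(isOpen_transition e' c).mem_nhds hv] with w hw
    simp [e'.left_inv hw.2]
  have h2 := ((contDiffAt_transition he he' hw).differentiableAt (by simp))
  have h3 := ((contDiffAt_transition he' hcm hv).differentiableAt (by simp))
  have h4 : (e' ∘ c.symm) (c y) = e' y := by simp [c.left_inv hyc]
  unfold jac
  rw [← hc, h1.fderiv_eq, fderiv_comp (c y) (by rwa [h4]) h3, h4]
  exact LinearMap.det_comp _ _

lemma curl_smulRight {ζ : Plane → Plane →L[ℝ] ℝ} {v : Plane} (h : DifferentiableAt ℝ ζ v)
    (w : V) : curl (fun v => (ζ v).smulRight w) v = curl ζ v • w := by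
  have h1 : HasFDerivAt (fun v => (ζ v).smulRight w)
      (((ContinuousLinearMap.smulRightL ℝ Plane V).flip w).comp (fderiv ℝ ζ v)) v :=
    ((ContinuousLinearMap.smulRightL ℝ Plane V).flip w).hasFDerivAt.comp v h.hasFDerivAt
  rw [curl, h1.fderiv, curl, sub_smul]
  rfl

lemma curl_add {ζ ξ : Plane → Plane →L[ℝ] V} {v : Plane} (h : DifferentiableAt ℝ ζ v)
    (h' : DifferentiableAt ℝ ξ v) : curl (ζ + ξ) v = curl ζ v + curl ξ v := by
  rw [curl, fderiv_add h h', curl, curl]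
  simp only [add_apply]
  abel

lemma curl_const_smul {ζ : Plane → Plane →L[ℝ] V} {v : Plane} (h : DifferentiableAt ℝ ζ v)
    (c : k) : curl (c • ζ) v = c • curl ζ v := by
  rw [curl, fderiv_const_smul h, curl, smul_sub]
  rfl

section

variable (σ)

/-- The 2-form `ψ w`, for a function `ψ` in a chart and a vector `w` along a lift. We represent
2-forms by their coefficients in the preferred charts. -/
def twoSec (e : OpenPartialHomeomorph M Plane) (s : ∀ y : M, Path.Homotopic.Quotient x₀ y)
    (ψ : Plane → ℝ) (w : V) : CoverFun x₀ V :=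
  open scoped Classical in
  fun y p => if y ∈ e.source then (jac e y * ψ (e y)) • σ (loopOf p (s y))⁻¹ w else 0

/-- The 1-form `ζ w`, for a 1-form `ζ` in a chart and a vector `w` along a lift. -/
def locForm (e : OpenPartialHomeomorph M Plane) (s : ∀ y : M, Path.Homotopic.Quotient x₀ y)
    (ζ : Plane → Plane →L[ℝ] ℝ) (w : V) : CoverForm x₀ V :=
  open scoped Classical in
  fun y p => if y ∈ e.source then ((ζ (e y)).comp
    (mfderiv 𝓘(ℝ, Plane) 𝓘(ℝ, Plane) e y : TangentSpace 𝓘(ℝ, Plane) y →L[ℝ] Plane)).smulRight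
      (σ (loopOf p (s y))⁻¹ w) else 0

end

variable {s : ∀ y : M, Path.Homotopic.Quotient x₀ y} {ζ : Plane → Plane →L[ℝ] ℝ} {w : V}

lemma locForm_equivariant : EquivariantForm σ (locForm σ e s ζ w) := by
  intro γ y p a
  by_cases hy : y ∈ e.source
  · simp only [locForm, if_pos hy, loopOf_mul, mul_inv_rev, map_mul]
    exact ((σ γ⁻¹).restrictScalars ℝ).map_smul _ _ |>.symm
  · simp only [locForm, if_neg hy]
    exact (map_zero (σ γ⁻¹)).symm

lemma formIn_locForm (he : e ∈ maximalAtlas 𝓘(ℝ, Plane) ∞ M) {v : Plane} (hv : v ∈ e.target) :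
    formIn e s (locForm σ e s ζ w) v = (ζ v).smulRight w := by
  ext a
  have h1 : locForm σ e s ζ w (e.symm v) (s (e.symm v)) = _ := if_pos (e.map_target hv)
  change locForm σ e s ζ w (e.symm v) (s (e.symm v)) _ = _
  rw [h1, loopOf_self, inv_one, map_one, e.right_inv hv]
  change ζ v _ • w = ζ v a • w
  congr 2
  exact DFunLike.congr_fun (mfderiv_chart_comp_symm he hv) a

lemma locForm_eq_zero {K : Set Plane} (hK : ∀ v ∉ K, ζ v = 0) {y : M} (hy : y ∉ e.symm '' K)
    (p : Path.Homotopic.Quotient x₀ y) : locForm σ e s ζ w y p = 0 := by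
  by_cases hys : y ∈ e.source
  · have : e y ∉ K := fun h => hy ⟨_, h, e.left_inv hys⟩
    simp only [locForm, if_pos hys, hK _ this]
    ext a
    exact zero_smul ℝ _
  · simp only [locForm, if_neg hys]

variable [PathConnectedSpace M]

/-- A 1-form on a disc with compact support extends by zero. -/
lemma locForm_isBundleForm [T2Space M] (he : e ∈ maximalAtlas 𝓘(ℝ, Plane) ∞ M) {Q K : Set Plane}
    (hQo : IsOpen Q) (hQ : Q ⊆ e.target) (hs : IsLift (e.symm '' Q) s) (hK : IsCompact K)
    (hKQ : K ⊆ Q) (h0 : ∀ v ∉ K, ζ v = 0) (hζ : ContDiff ℝ ∞ ζ) :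
    IsBundleForm σ (locForm σ e s ζ w) := by
  refine ⟨locForm_equivariant.isSmooth fun y => ?_, locForm_equivariant⟩
  by_cases hy : y ∈ e.symm '' Q
  · have hy' := (mem_chart_image hQ).1 hy
    refine ⟨_, s, isOpen_chart_image e hQo hQ, hy, hs, e, he, hy'.1, ?_⟩
    refine ContDiffAt.congr_of_eventuallyEq (f := fun v => (ζ v).smulRight w)
      ?_ ?_
    · exact (((ContinuousLinearMap.smulRightL ℝ Plane V).flip w).contDiff.comp hζ).contDiffAt
    · filter_upwards [hQo.mem_nhds hy'.2] with v hv using formIn_locForm he (hQ hv)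
  · obtain ⟨N, s', hN, hyN, hs'⟩ := exists_local_lift (x₀ := x₀) y
    have hc : IsClosed (e.symm '' K) :=
      (hK.image_of_continuousOn (e.continuousOn_symm.mono (hKQ.trans hQ))).isClosed
    refine ⟨N, s', hN, hyN, hs', chartAt Plane y, chart_mem_maximalAtlas y,
      mem_chart_source Plane y, ?_⟩
    refine (contDiffAt_const (c := (0 : Plane →L[ℝ] V))).congr_of_eventuallyEq ?_
    have hyK : y ∉ e.symm '' K := fun h => hy (Set.image_mono hKQ h)
    filter_upwards [(tendsto_chart_symm (mem_chart_source Plane y)).eventually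
      (hc.isOpen_compl.mem_nhds hyK)] with v hv
    ext a
    change locForm σ e s ζ w _ _ _ = 0
    rw [locForm_eq_zero h0 hv]
    rfl

/-- The differential of a 1-form, given by its coefficients in the preferred charts. -/
def dForm (η : CoverForm x₀ V) : CoverFun x₀ V := fun y p =>
  curl (formIn (chartAt Plane y) (exists_local_lift_through y p).choose_spec.choose η)
    (chartAt Plane y y)

lemma dForm_eq {η : CoverForm x₀ V} {N : Set M} (hN : IsOpen N) {y : M} (hy : y ∈ N)
    (hs : IsLift N s) : dForm η y (s y) = curl (formIn (chartAt Plane y) s η) (chartAt Plane y y) := by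
  obtain ⟨hN', hyN, hs', heq⟩ := (exists_local_lift_through y (s y)).choose_spec.choose_spec
  refine curl_congr ?_
  filter_upwards [(tendsto_chart_symm (mem_chart_source Plane y)).eventually
    (hs.eventuallyEq hs' hN hN' hy hyN heq)] with v hv
  exact congrArg (fun p => (η ((chartAt Plane y).symm v) p).comp
    (mfderiv 𝓘(ℝ, Plane) 𝓘(ℝ, Plane) (chartAt Plane y).symm v)) hv

/-- The preferred chart changes with the point, so it is unsuited to local computation. Here the
differential is expressed in one fixed chart along one fixed lift, at the cost of a Jacobian and a
monodromy factor. -/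
lemma dForm_eq_jac {η : CoverForm x₀ V} (hη : IsBundleForm σ η) {N : Set M} (hN : IsOpen N) {y : M}
    (hy : y ∈ N) (hs : IsLift N s) (he : e ∈ maximalAtlas 𝓘(ℝ, Plane) ∞ M) (hye : y ∈ e.source)
    (p : Path.Homotopic.Quotient x₀ y) :
    dForm η y p = jac e y • σ (loopOf p (s y))⁻¹ (curl (formIn e s η) (e y)) := by
  set γ := loopOf p (s y) with hγ
  have h1 := dForm_eq (η := η) (s := fun y => γ.toPath.trans (s y)) hN hy (hs.translate γ)
  simp only [hγ, loopOf_trans] at h1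
  rw [← hγ] at h1
  have hyc := mem_chart_source Plane y
  have h2 : formIn (chartAt Plane y) (fun y => γ.toPath.trans (s y)) η =
      fun v => (mon σ γ).comp (formIn (chartAt Plane y) s η v) :=
    funext fun v => EquivariantForm.formIn_translate hη.2 rfl
  have hyc' : (chartAt Plane y).symm (chartAt Plane y y) = y := (chartAt Plane y).left_inv hyc
  have h3 := curl_inChart_transition (θ := fun y => η y (s y)) he (chart_mem_maximalAtlas y)
    (v := chartAt Plane y y) ⟨mem_chart_target Plane y, by simpa using hye⟩
    ((hη.1.contDiffAt hN hs he (by rw [hyc']; exact e.map_source hye)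
      (by rw [hyc', e.left_inv hye]; exact hy)).differentiableAt (by simp))
  rw [hyc'] at h3
  rw [h1, h2, curl_comp _ ((hη.1.contDiffAt hN hs (chart_mem_maximalAtlas y)
    (mem_chart_target Plane y) (by rwa [hyc'])).differentiableAt (by simp)), h3]
  exact (mon σ γ).map_smul _ _

/-- Along the lift the vector `w` is constant, that is, flat, so only `ζ` is differentiated. Away
from the disc both sides vanish. -/
lemma dForm_locForm [T2Space M] (he : e ∈ maximalAtlas 𝓘(ℝ, Plane) ∞ M) {Q K : Set Plane}
    (hQo : IsOpen Q) (hQ : Q ⊆ e.target) (hs : IsLift (e.symm '' Q) s) (hK : IsCompact K)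
    (hKQ : K ⊆ Q) (h0 : ∀ v ∉ K, ζ v = 0) (hζ : ContDiff ℝ ∞ ζ) :
    dForm (locForm σ e s ζ w) = twoSec σ e s (curl ζ) w := by
  have hb := locForm_isBundleForm (σ := σ) (w := w) he hQo hQ hs hK hKQ h0 hζ
  funext y p
  by_cases hy : y ∈ e.symm '' Q
  · have hy' := (mem_chart_image hQ).1 hy
    rw [dForm_eq_jac hb (isOpen_chart_image e hQo hQ) hy hs he hy'.1]
    have h1 : formIn e s (locForm σ e s ζ w) =ᶠ[𝓝 (e y)] fun v => (ζ v).smulRight w := by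
      filter_upwards [hQo.mem_nhds hy'.2] with v hv using formIn_locForm he (hQ hv)
    rw [curl_congr h1, curl_smulRight (hζ.differentiable (by simp) _)]
    simp only [twoSec, if_pos hy'.1, mul_smul]
    congr 1
    exact ((σ (loopOf p (s y))⁻¹).restrictScalars ℝ).map_smul _ _
  · obtain ⟨N, s', hN, hyN, hs', rfl⟩ := exists_local_lift_through y p
    have hc : IsClosed (e.symm '' K) :=
      (hK.image_of_continuousOn (e.continuousOn_symm.mono (hKQ.trans hQ))).isClosed
    have hyK : y ∉ e.symm '' K := fun h => hy (Set.image_mono hKQ h)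
    have h1 : formIn (chartAt Plane y) s' (locForm σ e s ζ w) =ᶠ[𝓝 (chartAt Plane y y)]
        fun _ => 0 := by
      filter_upwards [(tendsto_chart_symm (mem_chart_source Plane y)).eventually
        (hc.isOpen_compl.mem_nhds hyK)] with v hv
      ext a
      change locForm σ e s ζ w _ _ _ = 0
      rw [locForm_eq_zero h0 hv]
      rfl
    rw [dForm_eq hN hyN hs', curl_congr h1]
    have h2 : curl (fun _ : Plane => (0 : Plane →L[ℝ] V)) (chartAt Plane y y) = 0 := by simp [curl]
    rw [h2]
    by_cases hys : y ∈ e.source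
    · have : e y ∉ K := fun h => hyK ⟨_, h, e.left_inv hys⟩
      have h3 : curl ζ (e y) = 0 := by
        rw [curl, fderiv_eq_zero_of_support hK.isClosed h0 this]; simp
      simp [twoSec, h3]
    · simp [twoSec, hys]

variable (σ) in
/-- The smooth bundle forms with compact support. -/
def bundleFormsCpt : Submodule k (CoverForm x₀ V) where
  carrier := {η | IsBundleForm σ η ∧ HasCompactSupp η}
  zero_mem' := ⟨(zero_mem (closedForms σ) : _).1, hasCompactSupp_zero⟩
  add_mem' := by
    rintro η η' ⟨⟨h1, h2⟩, h3⟩ ⟨⟨h1', h2'⟩, h3'⟩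
    refine ⟨⟨fun U s hU hs e he => ?_, fun γ y p a => ?_⟩, h3.add h3'⟩
    · simp only [Pi.add_apply]; rw [inChart_add]
      exact (h1 U s hU hs e he).add (h1' U s hU hs e he)
    · change η y _ a + η' y _ a = σ γ⁻¹ (η y p a + η' y p a)
      rw [h2, h2', map_add]
  smul_mem' := by
    rintro c η ⟨⟨h1, h2⟩, h3⟩
    refine ⟨⟨fun U s hU hs e he => ?_, fun γ y p a => ?_⟩, h3.smul c⟩
    · simp only [Pi.smul_apply]; rw [inChart_smul]
      exact (h1 U s hU hs e he).const_smul c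
    · change c • η y _ a = σ γ⁻¹ (c • η y p a)
      rw [h2, map_smul]

variable (σ) in
/-- The differential on the bundle forms with compact support. -/
def dFormCpt : bundleFormsCpt σ →ₗ[k] CoverFun x₀ V where
  toFun η := dForm η.1
  map_add' η η' := by
    funext y p
    obtain ⟨N, s, hN, hyN, hs, rfl⟩ := exists_local_lift_through y p
    have hyN' : (chartAt Plane y).symm (chartAt Plane y y) ∈ N := by simpa using hyN
    rw [Pi.add_apply, Pi.add_apply, dForm_eq hN hyN hs, dForm_eq hN hyN hs, dForm_eq hN hyN hs,
      ← curl_add ((η.2.1.1.contDiffAt hN hs (chart_mem_maximalAtlas y)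
      (mem_chart_target Plane y) hyN').differentiableAt (by simp))
      ((η'.2.1.1.contDiffAt hN hs (chart_mem_maximalAtlas y)
      (mem_chart_target Plane y) hyN').differentiableAt (by simp))]
    rfl
  map_smul' c η := by
    funext y p
    obtain ⟨N, s, hN, hyN, hs, rfl⟩ := exists_local_lift_through y p
    have hyN' : (chartAt Plane y).symm (chartAt Plane y y) ∈ N := by simpa using hyN
    rw [RingHom.id_apply, Pi.smul_apply, Pi.smul_apply, dForm_eq hN hyN hs, dForm_eq hN hyN hs,
      ← curl_const_smul ((η.2.1.1.contDiffAt hN hs (chart_mem_maximalAtlas y)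
      (mem_chart_target Plane y) hyN').differentiableAt (by simp))]
    rfl

lemma isClosed_of_dForm_eq_zero {η : CoverForm x₀ V} (hη : IsBundleForm σ η) (h : dForm η = 0) :
    η.IsClosed := by
  refine EquivariantForm.isClosed hη.2 hη.1 fun y => ?_
  obtain ⟨N, s, hN, hyN, hs⟩ := exists_local_lift (x₀ := x₀) y
  refine ⟨N, s, hN, hyN, hs, chartAt Plane y, chart_mem_maximalAtlas y, mem_chart_source Plane y, ?_⟩
  rw [← dForm_eq hN hyN hs, h]
  rfl

end LocalForms

/-! ### Flat sections as primitives of zero -/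

section Primitives

open IsManifold

variable {k : Type*} [RCLike k] {V : Type*} [NormedAddCommGroup V] [NormedSpace ℝ V]
  [NormedSpace k V] [IsScalarTower ℝ k V]
  {M : Type*} [TopologicalSpace M] [ChartedSpace Plane M] [IsManifold 𝓘(ℝ, Plane) ∞ M] {x₀ : M}
  {σ : FundamentalGroup M x₀ →* (V →L[k] V)} {e : OpenPartialHomeomorph M Plane}

/-- The primitives of the zero form which are constant along a given lift. -/
lemma isPrimitiveOn_spread_const {Q : Set Plane} (hQo : IsOpen Q) (hQ : Q ⊆ e.target)
    {s : ∀ y : M, Path.Homotopic.Quotient x₀ y} (hs : IsLift (e.symm '' Q) s) (c : V) :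
    IsPrimitiveOn σ (e.symm '' Q) (spread σ s fun _ => c) (0 : CoverForm x₀ V) := by
  refine (spread_equivariantOn s _ _).isPrimitiveOn (isOpen_chart_image e hQo hQ)
    (fun γ y p a => (map_zero (σ γ⁻¹)).symm) fun y hy =>
    ⟨_, s, isOpen_chart_image e hQo hQ, hy, hs, ?_⟩
  have h2 : (fun z => spread σ s (fun _ => c) z (s z)) = fun _ => c :=
    funext fun z => spread_self s _ z
  rw [h2]
  exact hasMFDerivAt_const c y

end Primitives

/-! ### Poincaré duality: forms orthogonal to all closed forms with compact support are exact -/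

section Duality

set_option linter.unusedSectionVars false

open IsManifold Filter Topology MeasureTheory

variable {k : Type*} [RCLike k] {V : Type*} [NormedAddCommGroup V] [NormedSpace ℝ V]
  [NormedSpace k V] [IsScalarTower ℝ k V] [FiniteDimensional k V]
  {M : Type*} [TopologicalSpace M] [ChartedSpace Plane M] [IsManifold 𝓘(ℝ, Plane) ∞ M] {x₀ : M}
  {σ : FundamentalGroup M x₀ →* (V →L[k] V)}
  {e e' : OpenPartialHomeomorph M Plane} {B : LinearMap.BilinForm k V}
  [T2Space M] [SigmaCompactSpace M] [PathConnectedSpace M] {β : CoverForm x₀ V}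

/-- A form orthogonal to all closed forms with compact support defines a functional on 2-forms. -/
lemma exists_functional (hB : IsInvariant B σ) (hβ : IsBundleForm σ β)
    (h : ∀ α ∈ closedFormsCpt σ, integral (wedge B α β) = 0) :
    ∃ T : CoverFun x₀ V →ₗ[k] k, ∀ η ∈ bundleFormsCpt σ,
      T (dForm η) = integral (wedge B η β) := by
  let I : bundleFormsCpt σ →ₗ[k] k :=
    { toFun := fun η => integral (wedge B η.1 β)
      map_add' := fun η η' => by
        obtain ⟨K, hK, h0⟩ := η.2.2
        obtain ⟨K', hK', h0'⟩ := η'.2.2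
        exact integral_wedge_add_left hB η.2.1 η'.2.1 (η + η').2.1 hβ (hK.union hK')
          (fun y hy => Or.inl (h0 y fun h => hy (Or.inl h)))
          (fun y hy => Or.inl (h0' y fun h => hy (Or.inr h)))
      map_smul' := fun c η => integral_wedge_smul_left hB c η.2.1.2 (c • η).2.1.2 hβ.2 }
  have hker : I ∈ (LinearMap.ker (dFormCpt σ)).dualAnnihilator := by
    rw [Submodule.mem_dualAnnihilator]
    intro η hη
    exact h η.1 ⟨⟨η.2.1, isClosed_of_dForm_eq_zero η.2.1 hη⟩, η.2.2⟩
  -- A functional which vanishes on the kernel of the differential factors through its image, and it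
  -- extends from there to the whole space. This extension is purely algebraic; no continuity of `T`
  -- is used later.
  rw [← LinearMap.range_dualMap_eq_dualAnnihilator_ker] at hker
  obtain ⟨T, hT⟩ := hker
  exact ⟨T, fun η hη => DFunLike.congr_fun hT (⟨η, hη⟩ : bundleFormsCpt σ)⟩

lemma twoSec_sub (s : ∀ y : M, Path.Homotopic.Quotient x₀ y) (ψ φ : Plane → ℝ) (c : ℝ) (w : V) :
    twoSec σ e s (fun v => ψ v - c * φ v) w = twoSec σ e s ψ w - c • twoSec σ e s φ w := by
  funext y p
  by_cases hy : y ∈ e.source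
  · simp only [twoSec, if_pos hy, Pi.sub_apply, Pi.smul_apply, smul_smul]
    rw [← sub_smul]
    congr 1
    ring
  · simp [twoSec, if_neg hy]

variable (σ) in
-- Nondegeneracy represents the functional `w ↦ T(φ w)` by a vector. For `φ` of integral one this is
-- the `φ`-average that the primitive representing `T` must have.
lemma exists_vector (hBn : B.Nondegenerate) (T : CoverFun x₀ V →ₗ[k] k)
    (e : OpenPartialHomeomorph M Plane) (s : ∀ y : M, Path.Homotopic.Quotient x₀ y)
    (φ : Plane → ℝ) (hBs : B.IsSymm) : ∃ t : V, ∀ w, B w t = T (twoSec σ e s φ w) := by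
  let L : V →ₗ[k] CoverFun x₀ V :=
    { toFun := twoSec σ e s φ
      map_add' := fun w w' => by
        funext y p
        by_cases hy : y ∈ e.source
        · simp [twoSec, if_pos hy]
        · simp [twoSec, if_neg hy]
      map_smul' := fun c w => by
        funext y p
        by_cases hy : y ∈ e.source
        · simp only [twoSec, if_pos hy, map_smul, Pi.smul_apply, RingHom.id_apply]
          exact (smul_comm c _ _).symm
        · simp [twoSec, if_neg hy] }
  refine ⟨(B.toDual hBn).symm (T ∘ₗ L), fun w => ?_⟩
  rw [← hBs.eq]
  exact LinearMap.BilinForm.apply_toDual_symm_apply _ w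

lemma integrable_smul_secIn {F : CoverFun x₀ V} {s : ∀ y : M, Path.Homotopic.Quotient x₀ y}
    (hβ : IsBundleForm σ β)
    (he : e ∈ atlas Plane M) {Q K : Set Plane} (hQo : IsOpen Q)
    (hQ : Q ⊆ e.target) (hs : IsLift (e.symm '' Q) s)
    (hF : IsPrimitiveOn σ (e.symm '' Q) F β) {ψ : Plane → ℝ} (hψ : ContDiff ℝ ∞ ψ)
    (hK : IsCompact K) (hKQ : K ⊆ Q) (h0 : ∀ v ∉ K, ψ v = 0) :
    Integrable fun v => ψ v • secIn e s F v := by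
  refine subset_integrable_of_compact hQo ?_ hK hKQ fun v hv => by simp [h0 v hv]
  have hsub : Q ⊆ e.target ∩ e.symm ⁻¹' (e.symm '' Q) := fun v hv => ⟨hQ hv, v, hv, rfl⟩
  exact hψ.continuous.continuousOn.smul ((hF.contDiffOn hβ.1 (isOpen_chart_image e hQo hQ) hs
    subset_rfl (subset_maximalAtlas he)).mono hsub).continuousOn

/-- On a box, the integral against `β` is the integral of the differential against a primitive. -/
lemma integral_wedge_locForm (hor : IsOrientedAtlas M) (hB : IsInvariant B σ)
    (hβ : IsBundleForm σ β) (he : e ∈ atlas Plane M) {Q K : Set Plane} (hQo : IsOpen Q)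
    (hQ : Q ⊆ e.target) {s : ∀ y : M, Path.Homotopic.Quotient x₀ y} (hs : IsLift (e.symm '' Q) s)
    {F : CoverFun x₀ V} (hF : IsPrimitiveOn σ (e.symm '' Q) F β)
    {ζ : Plane → Plane →L[ℝ] ℝ} (hζ : ContDiff ℝ ∞ ζ) (hK : IsCompact K) (hKQ : K ⊆ Q)
    (h0 : ∀ v ∉ K, ζ v = 0) (w : V) :
    integral (wedge B (locForm σ e s ζ w) β) = ∫ v, curl ζ v • B w (secIn e s F v) := by
  have hem := subset_maximalAtlas (I := 𝓘(ℝ, Plane)) (n := ∞) he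
  have ho := isOpen_chart_image e hQo hQ
  have hb := locForm_isBundleForm (σ := σ) (w := w) hem hQo hQ hs hK hKQ h0 hζ
  have hsub : Q ⊆ e.target ∩ e.symm ⁻¹' (e.symm '' Q) := fun v hv => ⟨hQ hv, v, hv, rfl⟩
  have hFs : ContDiffOn ℝ ∞ (secIn e s F) Q := (hF.contDiffOn hβ.1 ho hs subset_rfl hem).mono hsub
  have hζw : ContDiff ℝ ∞ fun v => (ζ v).smulRight w :=
    ((ContinuousLinearMap.smulRightL ℝ Plane V).flip w).contDiff.comp hζ
  have hζ0 : ∀ v ∉ K, (ζ v).smulRight w = 0 := fun v hv => by rw [h0 v hv]; ext; simp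
  have hKc : IsCompact (e.symm '' K) :=
    hK.image_of_continuousOn (e.continuousOn_symm.mono (hKQ.trans hQ))
  rw [integral_wedge_eq_chart hor hB hb hβ hKc (fun y hy => Or.inl (locForm_eq_zero h0 hy)) he
    (by rintro _ ⟨v, hv, rfl⟩; exact e.map_target (hQ (hKQ hv))) s]
  calc ∫ v in e.target, wedgeIn (realForm B) (formIn e s (locForm σ e s ζ w)) (formIn e s β) v
      = ∫ v in e.target, wedgeIn (realForm B) (fun v => (ζ v).smulRight w)
          (fderiv ℝ (secIn e s F)) v := by
        refine setIntegral_congr_fun e.open_target.measurableSet fun v hv => ?_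
        simp only [wedgeIn, formIn_locForm hem hv]
        by_cases hvK : v ∈ K
        · rw [(hF.hasFDerivAt ho hs subset_rfl hem hv ⟨v, hKQ hvK, rfl⟩).fderiv]
        · rw [hζ0 v hvK]; simp
    _ = ∫ v, wedgeIn (realForm B) (fun v => (ζ v).smulRight w) (fderiv ℝ (secIn e s F)) v := by
        refine setIntegral_eq_integral_of_forall_compl_eq_zero fun v hv => ?_
        have hvK : v ∉ K := fun h => hv (hQ (hKQ h))
        simp only [wedgeIn, hζ0 v hvK]; simp
    _ = ∫ v, curl ζ v • B w (secIn e s F v) := by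
        rw [integral_wedgeIn_fderiv_right (realForm B) hQo hK hKQ hζw hζ0 hFs]
        refine integral_congr_ae (Eventually.of_forall fun v => ?_)
        simp only
        rw [curl_smulRight (hζ.differentiable (by simp) v), map_smul]
        rfl

/-- On a box, the functional is given by integration against a primitive of `β`. -/
lemma exists_representing_primitive (hor : IsOrientedAtlas M) (hBs : B.IsSymm)
    (hBn : B.Nondegenerate) (hB : IsInvariant B σ) (hβ : IsBundleForm σ β) (hβc : β.IsClosed)
    {T : CoverFun x₀ V →ₗ[k] k}
    (hT : ∀ η ∈ bundleFormsCpt σ, T (dForm η) = integral (wedge B η β))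
    (he : e ∈ atlas Plane M) {a b : Fin 2 → ℝ} (hQ : box a b ⊆ e.target)
    (hne : (box a b).Nonempty) {s : ∀ y : M, Path.Homotopic.Quotient x₀ y}
    (hs : IsLift (e.symm '' box a b) s) :
    ∃ F, IsPrimitiveOn σ (e.symm '' box a b) F β ∧ ∀ (ψ : Plane → ℝ) (K : Set Plane),
      ContDiff ℝ ∞ ψ → IsCompact K → K ⊆ box a b → (∀ v ∉ K, ψ v = 0) → ∀ w,
        T (twoSec σ e s ψ w) = ∫ v, ψ v • B w (secIn e s F v) := by
  have : CompleteSpace V := FiniteDimensional.complete k V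
  have hem := subset_maximalAtlas (I := 𝓘(ℝ, Plane)) (n := ∞) he
  have hQo := isOpen_box a b
  obtain ⟨f, hf⟩ := exists_isPrimitiveOn hβ hβc hem hQo (convex_box a b) hQ
  obtain ⟨v₀, hv₀⟩ := hne
  obtain ⟨r, hr, hrQ⟩ := Metric.nhds_basis_closedBall.mem_iff.1 (hQo.mem_nhds hv₀)
  let φb : ContDiffBump v₀ := ⟨r / 2, r, by linarith, by linarith⟩
  let φ : Plane → ℝ := φb.normed volume
  have hφ : ContDiff ℝ ∞ φ := φb.contDiff_normed
  have hφ0 : ∀ v ∉ Metric.closedBall v₀ r, φ v = 0 := fun v hv =>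
    image_eq_zero_of_notMem_tsupport (by rwa [φb.tsupport_normed_eq])
  have hφ1 : ∫ v, φ v = 1 := φb.integral_normed
  have hφi : Integrable φ := φb.integrable_normed
  obtain ⟨t, ht⟩ := exists_vector σ hBn T e s φ hBs
  -- With this constant the average of `f + c` against `φ` is `t`, so integration against the new
  -- primitive agrees with `T` on the 2-forms `φ w`.
  let c : V := t - ∫ v, φ v • secIn e s f v
  let F : CoverFun x₀ V := f + spread σ s (fun _ => c)
  have hFs : ∀ v, secIn e s F v = secIn e s f v + c := fun v => by
    change secIn e s f v + spread σ s (fun _ => c) (e.symm v) (s (e.symm v)) = _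
    rw [spread_self]
  have hF : IsPrimitiveOn σ (e.symm '' box a b) F β := by
    simpa using hf.add (isPrimitiveOn_spread_const hQo hQ hs c)
  have hfi := integrable_smul_secIn hβ he hQo hQ hs hf hφ (isCompact_closedBall v₀ r) hrQ hφ0
  have hpull : ∀ (w : V) (ψ : Plane → ℝ), (Integrable fun v => ψ v • secIn e s F v) →
      ∫ v, ψ v • B w (secIn e s F v) = B w (∫ v, ψ v • secIn e s F v) := by
    intro w ψ hi
    have h1 := ((realForm B) w).integral_comp_comm hi
    refine Eq.trans (integral_congr_ae (Eventually.of_forall fun v => ?_)) h1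
    exact (((realForm B) w).map_smul _ _).symm
  have hφF := integrable_smul_secIn hβ he hQo hQ hs hF hφ (isCompact_closedBall v₀ r) hrQ hφ0
  have hTφ : ∀ w, T (twoSec σ e s φ w) = ∫ v, φ v • B w (secIn e s F v) := by
    intro w
    rw [hpull w φ hφF, ← ht]
    congr 1
    simp only [hFs, smul_add]
    rw [MeasureTheory.integral_add hfi (hφi.smul_const c), integral_smul_const, hφ1, one_smul]
    simp [c]
  refine ⟨F, hF, fun ψ K hψ hK hKQ h0 w => ?_⟩
  let m : ℝ := ∫ v, ψ v
  -- `ψ'` has integral zero, hence is the curl of a form with compact support in the box. On such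
  -- 2-forms `T` is known from its defining property, and on multiples of `φ` from the choice of
  -- `c`.
  let ψ' : Plane → ℝ := fun v => ψ v - m * φ v
  have hψi : Integrable ψ := hψ.continuous.integrable_of_hasCompactSupport
    (HasCompactSupport.intro hK h0)
  have hψ' : ContDiff ℝ ∞ ψ' := hψ.sub (contDiff_const.mul hφ)
  have hKu : K ∪ Metric.closedBall v₀ r ⊆ box a b := Set.union_subset hKQ hrQ
  have h0' : ∀ v ∉ K ∪ Metric.closedBall v₀ r, ψ' v = 0 := by
    intro v hv
    rw [Set.mem_union, not_or] at hv
    simp [ψ', h0 v hv.1, hφ0 v hv.2]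
  obtain ⟨ζ, K', hζ, hK', hK'Q, hζ0, hcurl⟩ := exists_curl_eq hψ'
    (hK.union (isCompact_closedBall v₀ r)) hKu h0' (by
      simp only [ψ']
      rw [MeasureTheory.integral_sub hψi (hφi.const_mul m), integral_const_mul, hφ1, mul_one,
        sub_self])
  have hcurl' : curl ζ = ψ' := funext hcurl
  have hKc : IsCompact (e.symm '' K') :=
    hK'.image_of_continuousOn (e.continuousOn_symm.mono (hK'Q.trans hQ))
  have h1 := hT _ ⟨locForm_isBundleForm (σ := σ) (w := w) hem hQo hQ hs hK' hK'Q hζ0 hζ,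
    _, hKc, fun y hy => locForm_eq_zero hζ0 hy⟩
  rw [integral_wedge_locForm hor hB hβ he hQo hQ hs hF hζ hK' hK'Q hζ0,
    dForm_locForm hem hQo hQ hs hK' hK'Q hζ0 hζ, hcurl', twoSec_sub, map_sub,
    LinearMap.map_smul_of_tower, hTφ, sub_eq_iff_eq_add] at h1
  rw [h1]
  have hψF := integrable_smul_secIn hβ he hQo hQ hs hF hψ hK hKQ h0
  have hBi : ∀ ψ : Plane → ℝ, (Integrable fun v => ψ v • secIn e s F v) →
      Integrable fun v => ψ v • B w (secIn e s F v) := fun ψ hi =>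
    (((realForm B) w).integrable_comp hi).congr (Eventually.of_forall fun v =>
      ((realForm B) w).map_smul _ _)
  rw [← MeasureTheory.integral_smul, ← MeasureTheory.integral_add]
  · refine integral_congr_ae (Eventually.of_forall fun v => ?_)
    simp only [ψ', sub_smul, mul_smul]
    abel
  · have h2 := (hBi ψ hψF).sub ((hBi φ hφF).smul m)
    refine h2.congr (Eventually.of_forall fun v => ?_)
    simp only [ψ', sub_smul, mul_smul, Pi.sub_apply, Pi.smul_apply]
  · exact (hBi φ hφF).smul m

/-- The same 2-form in two charts and along two lifts: the function changes by the Jacobian, the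
vector by the monodromy between the lifts. -/
lemma twoSec_eq_twoSec {e₁ e₂ : OpenPartialHomeomorph M Plane}
    (he₁ : e₁ ∈ atlas Plane M) (he₂ : e₂ ∈ atlas Plane M)
    {s₁ s₂ : ∀ y : M, Path.Homotopic.Quotient x₀ y} {N : Set M} (hN₁ : N ⊆ e₁.source)
    (hN₂ : N ⊆ e₂.source) {γ : FundamentalGroup M x₀}
    (hγ : ∀ z ∈ N, s₂ z = γ.toPath.trans (s₁ z)) {φ ψ : Plane → ℝ}
    (hφ : ∀ y ∈ e₁.source, y ∉ N → φ (e₁ y) = 0) (hψ : ∀ y ∈ e₂.source, y ∉ N → ψ (e₂ y) = 0)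
    (hφψ : ∀ y ∈ N, ψ (e₂ y) = (fderiv ℝ (e₁ ∘ e₂.symm) (e₂ y)).det * φ (e₁ y)) (w : V) :
    twoSec σ e₁ s₁ φ w = twoSec σ e₂ s₂ ψ (σ γ⁻¹ w) := by
  funext y p
  by_cases hy : y ∈ N
  · have h1 : loopOf p (s₁ y) = γ * loopOf p (s₂ y) := by
      refine loopOf_eq ?_
      rw [toPath_mul_trans, ← hγ y hy, loopOf_trans]
    simp only [twoSec, if_pos (hN₁ hy), if_pos (hN₂ hy)]
    rw [h1, mul_inv_rev, map_mul, hφψ y hy,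
      jac_mul (subset_maximalAtlas he₁) (subset_maximalAtlas he₂) (hN₁ hy) (hN₂ hy)]
    rw [mul_assoc, mul_left_comm]
    rw [mul_left_comm]
    rfl
  · have h1 : twoSec σ e₁ s₁ φ w y p = 0 := by
      by_cases hs : y ∈ e₁.source
      · simp [twoSec, hφ y hs hy]
      · simp [twoSec, hs]
    have h2 : twoSec σ e₂ s₂ ψ (σ γ⁻¹ w) y p = 0 := by
      by_cases hs : y ∈ e₂.source
      · simp [twoSec, hψ y hs hy]
      · simp [twoSec, hs]
    rw [h1, h2]

/-- The primitives which represent the functional agree on overlaps. -/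
lemma representing_primitives_agree (hor : IsOrientedAtlas M) (hBn : B.Nondegenerate)
    (hB : IsInvariant B σ)
    {T : CoverFun x₀ V →ₗ[k] k} {e₁ e₂ : OpenPartialHomeomorph M Plane}
    (he₁ : e₁ ∈ atlas Plane M) (he₂ : e₂ ∈ atlas Plane M) {Q₁ Q₂ : Set Plane} (hQo₁ : IsOpen Q₁)
    (hQo₂ : IsOpen Q₂)
    (hQ₁ : Q₁ ⊆ e₁.target) (hQ₂ : Q₂ ⊆ e₂.target)
    {s₁ s₂ : ∀ y : M, Path.Homotopic.Quotient x₀ y} (hs₁ : IsLift (e₁.symm '' Q₁) s₁)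
    (hs₂ : IsLift (e₂.symm '' Q₂) s₂) {F₁ F₂ : CoverFun x₀ V}
    (hF₁ : IsPrimitiveOn σ (e₁.symm '' Q₁) F₁ β) (hF₂ : IsPrimitiveOn σ (e₂.symm '' Q₂) F₂ β)
    (hT₁ : ∀ (ψ : Plane → ℝ) (K : Set Plane),
      ContDiff ℝ ∞ ψ → IsCompact K → K ⊆ Q₁ → (∀ v ∉ K, ψ v = 0) → ∀ w,
        T (twoSec σ e₁ s₁ ψ w) = ∫ v, ψ v • B w (secIn e₁ s₁ F₁ v))
    (hT₂ : ∀ (ψ : Plane → ℝ) (K : Set Plane),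
      ContDiff ℝ ∞ ψ → IsCompact K → K ⊆ Q₂ → (∀ v ∉ K, ψ v = 0) → ∀ w,
        T (twoSec σ e₂ s₂ ψ w) = ∫ v, ψ v • B w (secIn e₂ s₂ F₂ v))
    {y : M} (hy₁ : y ∈ e₁.symm '' Q₁) (hy₂ : y ∈ e₂.symm '' Q₂)
    (p : Path.Homotopic.Quotient x₀ y) : F₁ y p = F₂ y p := by
  have hem₁ := subset_maximalAtlas (I := 𝓘(ℝ, Plane)) (n := ∞) he₁
  have hem₂ := subset_maximalAtlas (I := 𝓘(ℝ, Plane)) (n := ∞) he₂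
  have hy₁' := (mem_chart_image hQ₁).1 hy₁
  have hy₂' := (mem_chart_image hQ₂).1 hy₂
  have ho₂ := isOpen_chart_image e₂ hQo₂ hQ₂
  -- a ball around `y` in the first chart, inside both discs
  obtain ⟨r, hr, hrt, hrW⟩ := exists_ball_in_chart hy₁'.1
    ((isOpen_chart_image e₁ hQo₁ hQ₁).inter ho₂) ⟨hy₁, hy₂⟩
  set Q' := Metric.ball (e₁ y) r with hQ'
  set N := e₁.symm '' Q' with hN
  have hNo : IsOpen N := isOpen_chart_image e₁ Metric.isOpen_ball hrt
  have hyN : y ∈ N := (mem_chart_image hrt).2 ⟨hy₁'.1, Metric.mem_ball_self hr⟩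
  have hNc : IsPathConnected N :=
    isPathConnected_chart_image e₁ (convex_ball _ _) (Metric.nonempty_ball.2 hr) hrt
  have hN₁ : N ⊆ e₁.symm '' Q₁ := hrW.trans Set.inter_subset_left
  have hN₂ : N ⊆ e₂.symm '' Q₂ := hrW.trans Set.inter_subset_right
  have hNs₁ : N ⊆ e₁.source := fun z hz => ((mem_chart_image hrt).1 hz).1
  have hNs₂ : N ⊆ e₂.source := fun z hz => ((mem_chart_image hQ₂).1 (hN₂ hz)).1
  have hQ'Q₁ : Q' ⊆ Q₁ := by
    intro v hv
    have := ((mem_chart_image hQ₁).1 (hN₁ ⟨v, hv, rfl⟩)).2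
    rwa [e₁.right_inv (hrt hv)] at this
  obtain ⟨γ, hγ⟩ := hs₁.eq_translate hs₂ hN₁ hN₂ hNc
  obtain ⟨d, hd⟩ := (hF₁.mono hN₁).exists_const (hF₂.mono hN₂) hem₁ Metric.isOpen_ball
    (convex_ball _ _) hrt subset_rfl (hs₁.mono hN₁)
  -- a bump function in this ball
  let φb : ContDiffBump (e₁ y) := ⟨r / 4, r / 2, by linarith, by linarith⟩
  let φ : Plane → ℝ := φb.normed volume
  let C : Set Plane := Metric.closedBall (e₁ y) (r / 2)
  have hC : IsCompact C := isCompact_closedBall _ _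
  have hCQ' : C ⊆ Q' := Metric.closedBall_subset_ball (by linarith)
  have hφ : ContDiff ℝ ∞ φ := φb.contDiff_normed
  have hφ0 : ∀ v ∉ C, φ v = 0 := fun v hv =>
    image_eq_zero_of_notMem_tsupport (by rwa [φb.tsupport_normed_eq])
  have hφ1 : ∫ v, φ v = 1 := φb.integral_normed
  have hφi : Integrable φ := φb.integrable_normed
  -- the same 2-form in the second chart
  let τ : Plane → Plane := e₁ ∘ e₂.symm
  let ψ₀ : Plane → ℝ := fun v => (fderiv ℝ τ v).det * φ (τ v)
  let Q'' : Set Plane := e₂.target ∩ e₂.symm ⁻¹' N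
  have hQ''o : IsOpen Q'' := e₂.isOpen_inter_preimage_symm hNo
  have hQ''τ : Q'' ⊆ e₂.target ∩ e₂.symm ⁻¹' e₁.source := fun v hv => ⟨hv.1, hNs₁ hv.2⟩
  have hτ : ContDiffOn ℝ ∞ τ Q'' := (contDiffOn_transition hem₁ hem₂).mono hQ''τ
  have hψ₀ : ContDiffOn ℝ ∞ ψ₀ Q'' := by
    refine ContDiffOn.mul ?_ (hφ.comp_contDiffOn hτ)
    have h1 : ContDiffOn ℝ ∞ (fderiv ℝ τ) Q'' := hτ.fderiv_of_isOpen hQ''o (by simp)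
    -- Written as a polynomial in the matrix entries, the Jacobian is visibly smooth.
    have h2 : ∀ T : Plane →L[ℝ] Plane, T.det =
        T (EuclideanSpace.single 0 1) 0 * T (EuclideanSpace.single 1 1) 1 -
        T (EuclideanSpace.single 0 1) 1 * T (EuclideanSpace.single 1 1) 0 := by
      intro T
      have := area_map T (EuclideanSpace.single 0 1) (EuclideanSpace.single 1 1)
      simp only [area] at this
      simpa using this.symm
    simp only [h2]
    have h3 : ∀ (a : Plane) (i : Fin 2), ContDiffOn ℝ ∞ (fun v => fderiv ℝ τ v a i) Q'' :=
      fun a i => (EuclideanSpace.proj i : Plane →L[ℝ] ℝ).contDiff.comp_contDiffOn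
        (h1.clm_apply contDiffOn_const)
    exact ((h3 _ _).mul (h3 _ _)).sub ((h3 _ _).mul (h3 _ _))
  let C₂ : Set Plane := e₂ '' (e₁.symm '' C)
  have hCN : e₁.symm '' C ⊆ N := Set.image_mono hCQ'
  have hC₂ : IsCompact C₂ := (hC.image_of_continuousOn (e₁.continuousOn_symm.mono
    (hCQ'.trans hrt))).image_of_continuousOn (e₂.continuousOn.mono (hCN.trans hNs₂))
  have hC₂Q : C₂ ⊆ Q'' := by
    rintro _ ⟨z, hz, rfl⟩
    exact ⟨e₂.map_source (hNs₂ (hCN hz)), by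
      simpa [e₂.left_inv (hNs₂ (hCN hz))] using hCN hz⟩
  obtain ⟨hψ, hψ0⟩ := contDiff_indicator hQ''o hψ₀ hC₂.isClosed hC₂Q fun v hv hvC => by
    have : τ v ∉ C := fun h => hvC ⟨e₂.symm v, ⟨_, h, e₁.left_inv (hNs₁ hv.2)⟩, e₂.right_inv hv.1⟩
    simp [ψ₀, hφ0 _ this]
  set ψ : Plane → ℝ := Q''.indicator ψ₀ with hψd
  have hQ''Q₂ : Q'' ⊆ Q₂ := by
    intro v hv
    have := ((mem_chart_image hQ₂).1 (hN₂ hv.2)).2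
    rwa [e₂.right_inv hv.1] at this
  have hφN : ∀ z ∈ e₁.source, z ∉ N → φ (e₁ z) = 0 := fun z hz hzN =>
    hφ0 _ fun h => hzN ⟨_, hCQ' h, e₁.left_inv hz⟩
  have hψN : ∀ z ∈ e₂.source, z ∉ N → ψ (e₂ z) = 0 := fun z hz hzN =>
    Set.indicator_of_notMem (fun h => hzN (by simpa [e₂.left_inv hz] using h.2)) _
  have htwo : ∀ w, twoSec σ e₁ s₁ φ w = twoSec σ e₂ s₂ ψ (σ γ⁻¹ w) := fun w => by
    refine twoSec_eq_twoSec he₁ he₂ hNs₁ hNs₂ hγ hφN hψN (fun z hz => ?_) w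
    have h1 : e₂ z ∈ Q'' := ⟨e₂.map_source (hNs₂ hz), by simpa [e₂.left_inv (hNs₂ hz)] using hz⟩
    rw [hψd, Set.indicator_of_mem h1]
    simp only [ψ₀, τ, Function.comp_apply, e₂.left_inv (hNs₂ hz)]
  -- change of variables
  have hcv : ∀ w, ∫ v, ψ v • B (σ γ⁻¹ w) (secIn e₂ s₂ F₂ v) =
      ∫ v, φ v • B w (secIn e₁ s₁ F₂ v) := by
    intro w
    have h1 := setIntegral_transition hor he₁ he₂ fun v => φ v • B w (secIn e₁ s₁ F₂ v)
    have h2 : ∀ (S : Set Plane) (g : Plane → k), (∀ v ∉ S, g v = 0) →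
        ∫ v, g v = ∫ v in S, g v := fun S g hg =>
      (setIntegral_eq_integral_of_forall_compl_eq_zero hg).symm
    rw [h2 (e₂.target ∩ e₂.symm ⁻¹' e₁.source) _ fun v hv => ?_,
      h2 (e₁.target ∩ e₁.symm ⁻¹' e₂.source) _ fun v hv => ?_, ← h1]
    · refine setIntegral_congr_fun (isOpen_transition e₁ e₂).measurableSet fun v hv => ?_
      by_cases hvN : e₂.symm v ∈ N
      · have h2 : v ∈ Q'' := ⟨hv.1, hvN⟩
        rw [hψd, Set.indicator_of_mem h2]
        have h3 : secIn e₂ s₂ F₂ v = σ γ⁻¹ (secIn e₁ s₁ F₂ (e₁ (e₂.symm v))) := by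
          simp only [secIn]
          rw [hγ _ hvN, hF₂.1 _ _ (hN₂ hvN), e₁.left_inv hv.2]
        rw [h3, hB]
        simp only [ψ₀, τ, Function.comp_apply, mul_smul]
      · have h2 : φ (e₁ (e₂.symm v)) = 0 := hφN _ hv.2 hvN
        have h3 : ψ v = 0 := Set.indicator_of_notMem (fun h => hvN h.2) _
        rw [h2, h3]
        simp
    · have : v ∉ C := fun h => hv ⟨hrt (hCQ' h), hNs₂ ⟨v, hCQ' h, rfl⟩⟩
      rw [hφ0 v this, zero_smul]
    · have : v ∉ Q'' := fun h => hv (hQ''τ h)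
      rw [hψd, Set.indicator_of_notMem this, zero_smul]
  -- The global functional `T` takes one value on this 2-form, computed once with `F₁` and once with
  -- `F₂`. As `φ` has integral one, comparing them gives `B w d = 0` for all `w`, so `d = 0` by
  -- nondegeneracy.
  have hconst : ∀ w, B w d = 0 := by
    intro w
    have h1 := hT₁ φ C hφ hC (hCQ'.trans hQ'Q₁) hφ0 w
    have h2 := hT₂ ψ C₂ hψ hC₂ (hC₂Q.trans hQ''Q₂) hψ0 (σ γ⁻¹ w)
    rw [← htwo, h1, hcv] at h2
    have hi : ∀ F : CoverFun x₀ V, ContinuousOn (secIn e₁ s₁ F) Q' →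
        Integrable fun v => φ v • B w (secIn e₁ s₁ F v) := by
      intro F hF
      refine subset_integrable_of_compact Metric.isOpen_ball ?_ hC hCQ' fun v hv => by
        simp [hφ0 v hv]
      exact hφ.continuous.continuousOn.smul (((realForm B) w).continuous.comp_continuousOn hF)
    have hc₁ : ContinuousOn (secIn e₁ s₁ F₁) Q' := fun v hv =>
      ((hF₁.mono hN₁).hasFDerivAt hNo (hs₁.mono hN₁) subset_rfl hem₁ (hrt hv)
        ⟨v, hv, rfl⟩).continuousAt.continuousWithinAt
    have hc₂ : ContinuousOn (secIn e₁ s₁ F₂) Q' := fun v hv =>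
      ((hF₂.mono hN₂).hasFDerivAt hNo (hs₁.mono hN₁) subset_rfl hem₁ (hrt hv)
        ⟨v, hv, rfl⟩).continuousAt.continuousWithinAt
    have h3 := sub_eq_zero.2 h2
    rw [← MeasureTheory.integral_sub (hi F₁ hc₁) (hi F₂ hc₂)] at h3
    have h4 : ∀ v, φ v • B w (secIn e₁ s₁ F₁ v) - φ v • B w (secIn e₁ s₁ F₂ v) =
        φ v • B w d := by
      intro v
      by_cases hv : v ∈ C
      · rw [← smul_sub, ← map_sub, hd v (hCQ' hv)]
      · simp [hφ0 v hv]
    simp only [h4] at h3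
    rwa [integral_smul_const, hφ1, one_smul] at h3
  have hd0 : d = 0 := hBn.2 d hconst
  have h5 := hd (e₁ y) (Metric.mem_ball_self hr)
  rw [hd0, sub_eq_zero] at h5
  simp only [secIn] at h5
  rw [e₁.left_inv hy₁'.1] at h5
  rw [← loopOf_trans p (s₁ y), hF₁.1 _ _ hy₁, hF₂.1 _ _ hy₂, h5]

/-- A closed form which is orthogonal to all closed forms with compact support is exact. -/
theorem mem_exactForms_of_orthogonal (hor : IsOrientedAtlas M) (hBs : B.IsSymm)
    (hBn : B.Nondegenerate) (hB : IsInvariant B σ) (hβ : β ∈ closedForms σ)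
    (h : ∀ α ∈ closedFormsCpt σ, integral (wedge B α β) = 0) : β ∈ exactForms σ := by
  obtain ⟨T, hT⟩ := exists_functional hB hβ.1 h
  have hloc : ∀ i : M, ∃ (Q : Set Plane) (s : ∀ y : M, Path.Homotopic.Quotient x₀ y)
      (F : CoverFun x₀ V), IsOpen Q ∧ Q ⊆ (chartAt Plane i).target ∧
      i ∈ (chartAt Plane i).symm '' Q ∧ IsLift ((chartAt Plane i).symm '' Q) s ∧
      IsPrimitiveOn σ ((chartAt Plane i).symm '' Q) F β ∧ ∀ (ψ : Plane → ℝ) (K : Set Plane),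
        ContDiff ℝ ∞ ψ → IsCompact K → K ⊆ Q → (∀ v ∉ K, ψ v = 0) → ∀ w,
          T (twoSec σ (chartAt Plane i) s ψ w) =
            ∫ v, ψ v • B w (secIn (chartAt Plane i) s F v) := by
    intro i
    obtain ⟨a, b, hmem, hsub⟩ := exists_box (chartAt Plane i).open_target (mem_chart_target Plane i)
    have hi : i ∈ (chartAt Plane i).symm '' box a b :=
      (mem_chart_image hsub).2 ⟨mem_chart_source Plane i, hmem⟩
    obtain ⟨s, hs, -⟩ := exists_isLift (chartAt Plane i) (convex_box a b) hsub hi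
      (Path.Homotopic.Quotient.mk (PathConnectedSpace.somePath x₀ i))
    obtain ⟨F, hF, hFT⟩ := exists_representing_primitive hor hBs hBn hB hβ.1 hβ.2 hT
      (chart_mem_atlas Plane i) hsub ⟨_, hmem⟩ hs
    exact ⟨box a b, s, F, isOpen_box a b, hsub, hi, hs, hF, hFT⟩
  choose Q s F hQo hQ hi hs hF hFT using hloc
  obtain ⟨g, hg, -⟩ := IsPrimitiveOn.glue (fun i => isOpen_chart_image _ (hQo i) (hQ i)) hβ.1.2 hF
    (fun i j y hy p => representing_primitives_agree hor hBn hB (chart_mem_atlas Plane i)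
      (chart_mem_atlas Plane j) (hQo i) (hQo j) (hQ i) (hQ j) (hs i) (hs j) (hF i) (hF j)
      (hFT i) (hFT j) hy.1 hy.2 p)
    (O := Set.univ) (fun y _ => Set.mem_iUnion.2 ⟨y, hi y⟩) isOpen_univ
    fun y _ => exists_local_lift y
  exact ⟨g, hg.mem_exactForms hβ.1.1⟩

end Duality

/-! ### Finiteness of the image of the cohomology with compact supports -/

section Finiteness

set_option linter.unusedSectionVars false

open IsManifold Filter Topology

/-- A linear map which vanishes on the kernel of a map to a finite-dimensional space has finite
rank. -/
lemma finiteDimensional_range_of_ker_le {k S H W : Type*} [Field k] [AddCommGroup S] [Module k S]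
    [AddCommGroup H] [Module k H] [AddCommGroup W] [Module k W] [FiniteDimensional k W]
    (φ : S →ₗ[k] H) (ψ : S →ₗ[k] W) (h : LinearMap.ker ψ ≤ LinearMap.ker φ) :
    FiniteDimensional k (LinearMap.range φ) := by
  have h1 : FiniteDimensional k (S ⧸ LinearMap.ker ψ) :=
    ψ.quotKerEquivRange.symm.finiteDimensional
  have h2 := Submodule.finiteDimensional_of_le
    (Submodule.range_liftQ (LinearMap.ker ψ) φ h).symm.le
  exact h2

variable {k : Type*} [RCLike k] {V : Type*} [NormedAddCommGroup V] [NormedSpace ℝ V]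
  [NormedSpace k V] [IsScalarTower ℝ k V]
  {M : Type*} [TopologicalSpace M] [ChartedSpace Plane M] [IsManifold 𝓘(ℝ, Plane) ∞ M] {x₀ : M}
  {σ : FundamentalGroup M x₀ →* (V →L[k] V)}
  {e : OpenPartialHomeomorph M Plane} {η : CoverForm x₀ V}

lemma IsPrimitiveOn.smul {W : Set M} {f : CoverFun x₀ V} (h : IsPrimitiveOn σ W f η) (c : k) :
    IsPrimitiveOn σ W (c • f) (c • η) := by
  refine ⟨fun γ y hy p => ?_, fun U s hU hs hUW y hy => ?_⟩
  · simp only [Pi.smul_apply, h.1 γ y hy p, map_smul]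
  · have hc : HasFDerivAt (fun v : V => c • v) (c • ContinuousLinearMap.id ℝ V) (f y (s y)) :=
      (hasFDerivAt_id _).const_smul c
    exact hc.hasMFDerivAt.comp y (h.2 U s hU hs hUW y hy)

/-- The zero function is a primitive where the form vanishes. -/
lemma isPrimitiveOn_zero {W : Set M} (h : ∀ y ∈ W, ∀ p, η y p = 0) :
    IsPrimitiveOn σ W (0 : CoverFun x₀ V) η := by
  refine ⟨fun γ y hy p => (map_zero (σ γ⁻¹)).symm, fun U s hU hs hUW y hy => ?_⟩
  rw [h y (hUW hy)]
  exact hasMFDerivAt_const (0 : V) y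

/-- Poincaré's lemma, with a primitive that vanishes at a given point. -/
lemma exists_isPrimitiveOn_vanishing [FiniteDimensional k V] [PathConnectedSpace M]
    (hη : IsBundleForm σ η) (hc : η.IsClosed)
    (he : e ∈ maximalAtlas 𝓘(ℝ, Plane) ∞ M) {Q : Set Plane} (hQo : IsOpen Q) (hQc : Convex ℝ Q)
    (hQ : Q ⊆ e.target) {y₀ : M} (hy₀ : y₀ ∈ e.symm '' Q) (p₀ : Path.Homotopic.Quotient x₀ y₀) :
    ∃ f, IsPrimitiveOn σ (e.symm '' Q) f η ∧ f y₀ p₀ = 0 := by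
  have : CompleteSpace V := FiniteDimensional.complete k V
  obtain ⟨f, hf⟩ := exists_isPrimitiveOn hη hc he hQo hQc hQ
  obtain ⟨s, hs, hs₀⟩ := exists_isLift e hQc hQ hy₀ p₀
  have h1 := hf.sub (isPrimitiveOn_spread_const hQo hQ hs (f y₀ p₀))
  rw [sub_zero] at h1
  refine ⟨_, h1, ?_⟩
  change f y₀ p₀ - spread σ s (fun _ => f y₀ p₀) y₀ p₀ = 0
  rw [← hs₀, spread_self, sub_self]

/-- A half disc. -/
def halfDisc (c : Plane) (r : ℝ) (u : Plane) : Set Plane :=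
  Metric.ball c r ∩ {v | 0 < inner ℝ u (v - c)}

lemma isOpen_halfDisc (c : Plane) (r : ℝ) (u : Plane) : IsOpen (halfDisc c r u) :=
  Metric.isOpen_ball.inter (isOpen_lt continuous_const (by fun_prop))

lemma convex_halfDisc (c : Plane) (r : ℝ) (u : Plane) : Convex ℝ (halfDisc c r u) := by
  refine (convex_ball c r).inter fun v hv w hw a b ha hb hab => ?_
  simp only [Set.mem_ofPred_eq] at hv hw ⊢
  have h1 : a • v + b • w - c = a • (v - c) + b • (w - c) := by
    rw [smul_sub, smul_sub, sub_add_sub_comm, ← add_smul, hab, one_smul]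
  rw [h1, inner_add_right, inner_smul_right, inner_smul_right]
  rcases ha.lt_or_eq with h | h
  · exact add_pos_of_pos_of_nonneg (mul_pos h hv) (mul_nonneg hb hw.le)
  · have hb1 : b = 1 := by linarith
    simpa [← h, hb1] using hw

lemma halfDisc_subset (c : Plane) (r : ℝ) (u : Plane) :
    halfDisc c r u ⊆ Metric.ball c r \ {c} := by
  rintro v ⟨h1, h2⟩
  refine ⟨h1, ?_⟩
  rintro rfl
  simp at h2

/-- Half discs are stable under contraction to the centre. -/
lemma contract_mem_halfDisc {c u v : Plane} {r t : ℝ} (hv : v ∈ halfDisc c r u) (ht : 0 < t)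
    (ht1 : t ≤ 1) : c + t • (v - c) ∈ halfDisc c r u := by
  refine ⟨?_, ?_⟩
  · have h1 := hv.1
    rw [Metric.mem_ball, dist_eq_norm] at h1 ⊢
    rw [add_sub_cancel_left, norm_smul, Real.norm_of_nonneg ht.le]
    nlinarith [norm_nonneg (v - c)]
  · have h2 := hv.2
    simp only [Set.mem_ofPred_eq] at h2 ⊢
    rw [add_sub_cancel_left, inner_smul_right]
    exact mul_pos ht h2

/-- Together with `contract_mem_halfDisc` this moves any point of a half disc, or of an intersection
of half discs, into the small ball where the form vanishes. -/
lemma exists_contract_mem_ball (c v : Plane) {ε : ℝ} (hε : 0 < ε) :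
    ∃ t : ℝ, 0 < t ∧ t ≤ 1 ∧ c + t • (v - c) ∈ Metric.ball c ε := by
  have hd : 0 < ‖v - c‖ + 1 := by positivity
  refine ⟨min 1 (ε / (‖v - c‖ + 1)), by positivity, min_le_left _ _, ?_⟩
  have h0 : 0 ≤ min 1 (ε / (‖v - c‖ + 1)) := by positivity
  rw [Metric.mem_ball, dist_eq_norm, add_sub_cancel_left, norm_smul, Real.norm_of_nonneg h0]
  calc min 1 (ε / (‖v - c‖ + 1)) * ‖v - c‖ ≤ ε / (‖v - c‖ + 1) * ‖v - c‖ := by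
        gcongr; exact min_le_right _ _
    _ < ε / (‖v - c‖ + 1) * (‖v - c‖ + 1) := by gcongr; linarith
    _ = ε := by field_simp

/-- Over a punctured disc, a closed form which vanishes near the puncture has a primitive. -/
lemma exists_isPrimitiveOn_puncturedDisc [FiniteDimensional k V] [PathConnectedSpace M]
    (hη : IsBundleForm σ η) (hc : η.IsClosed) (he : e ∈ maximalAtlas 𝓘(ℝ, Plane) ∞ M)
    {c : Plane} {r ε : ℝ} (hε : 0 < ε) (hr : Metric.ball c r \ {c} ⊆ e.target)
    (h0 : ∀ v ∈ Metric.ball c r \ {c}, v ∈ Metric.ball c ε → ∀ p, η (e.symm v) p = 0) :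
    ∃ f, IsPrimitiveOn σ (e.symm '' (Metric.ball c r \ {c})) f η := by
  have hsub : ∀ u, halfDisc c r u ⊆ e.target := fun u => (halfDisc_subset c r u).trans hr
  have : CompleteSpace V := FiniteDimensional.complete k V
  -- A punctured disc is not simply connected, but half discs are convex. On each of them the
  -- primitive is normalized to vanish near the puncture, where the form is zero.
  have key : ∀ u, ∃ f, IsPrimitiveOn σ (e.symm '' halfDisc c r u) f η ∧
      ∀ v ∈ halfDisc c r u ∩ Metric.ball c ε, ∀ p, f (e.symm v) p = 0 := by
    intro u
    rcases (halfDisc c r u).eq_empty_or_nonempty with h | ⟨v₁, hv₁⟩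
    · obtain ⟨f, hf⟩ := exists_isPrimitiveOn hη hc he (isOpen_halfDisc c r u)
        (convex_halfDisc c r u) (hsub u)
      exact ⟨f, hf, by simp [h]⟩
    obtain ⟨t, ht, ht1, htε⟩ := exists_contract_mem_ball c v₁ hε
    set v₀ := c + t • (v₁ - c)
    have hv₀ : v₀ ∈ halfDisc c r u := contract_mem_halfDisc hv₁ ht ht1
    obtain ⟨f, hf, hf0⟩ := exists_isPrimitiveOn_vanishing hη hc he (isOpen_halfDisc c r u)
      (convex_halfDisc c r u) (hsub u) ⟨v₀, hv₀, rfl⟩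
      (Path.Homotopic.Quotient.mk (PathConnectedSpace.somePath x₀ (e.symm v₀)))
    refine ⟨f, hf, fun v hv p => ?_⟩
    have hz : IsPrimitiveOn σ (e.symm '' (halfDisc c r u ∩ Metric.ball c ε)) 0 η := by
      refine isPrimitiveOn_zero ?_
      rintro _ ⟨w, hw, rfl⟩
      exact h0 w (halfDisc_subset c r u hw.1) hw.2
    exact (hf.mono (Set.image_mono Set.inter_subset_left)).eq_of_eq hz he
      ((isOpen_halfDisc c r u).inter Metric.isOpen_ball)
      ((convex_halfDisc c r u).inter (convex_ball c ε)) (Set.inter_subset_left.trans (hsub u))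
      subset_rfl ⟨v₀, ⟨hv₀, htε⟩, rfl⟩ hf0 ⟨v, hv, rfl⟩ p
  choose f hf hf0 using key
  -- The intersection of two half discs is convex and, if nonempty, reaches the puncture. Both
  -- normalized primitives vanish there, hence agree on the whole intersection.
  have hagree : ∀ u w, ∀ y ∈ e.symm '' halfDisc c r u ∩ e.symm '' halfDisc c r w, ∀ p,
      f u y p = f w y p := by
    intro u w y hy p
    have hu := (mem_chart_image (hsub u)).1 hy.1
    have hw := (mem_chart_image (hsub w)).1 hy.2
    obtain ⟨t, ht, ht1, htε⟩ := exists_contract_mem_ball c (e y) hε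
    have hu' := contract_mem_halfDisc hu.2 ht ht1
    have hw' := contract_mem_halfDisc hw.2 ht ht1
    refine ((hf u).mono (Set.image_mono Set.inter_subset_left)).eq_of_eq
      ((hf w).mono (Set.image_mono Set.inter_subset_right)) he
      ((isOpen_halfDisc c r u).inter (isOpen_halfDisc c r w))
      ((convex_halfDisc c r u).inter (convex_halfDisc c r w))
      (Set.inter_subset_left.trans (hsub u)) subset_rfl ⟨_, ⟨hu', hw'⟩, rfl⟩
      (p₀ := Path.Homotopic.Quotient.mk (PathConnectedSpace.somePath x₀ _)) ?_
      ((mem_chart_image (Set.inter_subset_left.trans (hsub u))).2 ⟨hu.1, hu.2, hw.2⟩) p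
    rw [hf0 u _ ⟨hu', htε⟩, hf0 w _ ⟨hw', htε⟩]
  have hcov : e.symm '' (Metric.ball c r \ {c}) ⊆ ⋃ u, e.symm '' halfDisc c r u := by
    rintro _ ⟨v, hv, rfl⟩
    refine Set.mem_iUnion.2 ⟨v - c, v, ⟨hv.1, ?_⟩, rfl⟩
    have : v - c ≠ 0 := sub_ne_zero.2 hv.2
    change 0 < inner ℝ (v - c) (v - c)
    rw [real_inner_self_eq_norm_sq]
    positivity
  obtain ⟨g, hg, -⟩ := IsPrimitiveOn.glue
    (fun u => isOpen_chart_image e (isOpen_halfDisc c r u) (hsub u)) hη.2 hf hagree hcov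
    (isOpen_chart_image e (Metric.isOpen_ball.sdiff isClosed_singleton) hr)
    fun y _ => exists_local_lift y
  exact ⟨g, hg⟩

/-- If all closed forms with compact support have primitives over the members of a finite cover
which overlap nicely, then the image of the cohomology with compact supports is finite
dimensional. -/
theorem finiteDimensional_range_forgetSupport [FiniteDimensional k V] [PathConnectedSpace M]
    {ι : Type*} [Finite ι] {U U' : ι → Set M} (hU : ∀ i, IsOpen (U i)) (hU' : ∀ i, IsOpen (U' i))
    (hUU : ∀ i, U' i ⊆ U i) (hcov : ⋃ i, U' i = Set.univ)
    (hprim : ∀ α ∈ closedFormsCpt σ, ∀ i, ∃ f, IsPrimitiveOn σ (U i) f α)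
    (hK : ∀ i j, i ≠ j → ∃ K, IsCompact K ∧ U' i ∩ U' j ⊆ K ∧ K ⊆ U i ∩ U j) :
    FiniteDimensional k (LinearMap.range (forgetSupport σ)) := by
  classical
  have := Fintype.ofFinite ι
  -- Compactness gives finitely many sample points, such that each point of the smaller overlap lies
  -- in a convex disc inside the larger overlap around one of them. The diagonal is left out: no
  -- comparison is needed there, and a punctured disc need not be relatively compact.
  have hT : ∀ i j, ∃ T : Finset M, i ≠ j → ∀ y ∈ U' i ∩ U' j, ∃ z ∈ T, ∃ Q : Set Plane,
      IsOpen Q ∧ Convex ℝ Q ∧ Q ⊆ (chartAt Plane z).target ∧ z ∈ (chartAt Plane z).symm '' Q ∧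
      y ∈ (chartAt Plane z).symm '' Q ∧ (chartAt Plane z).symm '' Q ⊆ U i ∩ U j := by
    intro i j
    by_cases hij : i = j
    · exact ⟨∅, fun h => (h hij).elim⟩
    obtain ⟨K, hKc, hK1, hK2⟩ := hK i j hij
    have h1 : ∀ z ∈ K, ∃ r > 0, Metric.ball (chartAt Plane z z) r ⊆ (chartAt Plane z).target ∧
        (chartAt Plane z).symm '' Metric.ball (chartAt Plane z z) r ⊆ U i ∩ U j := fun z hz =>
      exists_ball_in_chart (mem_chart_source Plane z) ((hU i).inter (hU j)) (hK2 hz)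
    choose! r hr hrt hrU using h1
    have h2 : ∀ z ∈ K, z ∈ (chartAt Plane z).symm '' Metric.ball (chartAt Plane z z) (r z) :=
      fun z hz => (mem_chart_image (hrt z hz)).2
        ⟨mem_chart_source Plane z, Metric.mem_ball_self (hr z hz)⟩
    obtain ⟨T, hTK, hT⟩ := hKc.elim_nhds_subcover _ fun z hz =>
      (isOpen_chart_image _ Metric.isOpen_ball (hrt z hz)).mem_nhds (h2 z hz)
    refine ⟨T, fun _ y hy => ?_⟩
    obtain ⟨z, hz, hyz⟩ := Set.mem_iUnion₂.1 (hT (hK1 hy))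
    exact ⟨z, hz, _, Metric.isOpen_ball, convex_ball _ _, hrt z (hTK z hz), h2 z (hTK z hz), hyz,
      hrU z (hTK z hz)⟩
  choose T hT using hT
  let p : ∀ y : M, Path.Homotopic.Quotient x₀ y := fun y =>
    Path.Homotopic.Quotient.mk (PathConnectedSpace.somePath x₀ y)
  let S : Submodule k (CoverForm x₀ V × (ι → CoverFun x₀ V)) :=
    { carrier := {a | a.1 ∈ closedFormsCpt σ ∧ ∀ i, IsPrimitiveOn σ (U i) (a.2 i) a.1}
      zero_mem' := ⟨zero_mem _, fun i => isPrimitiveOn_zero fun _ _ _ => rfl⟩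
      add_mem' := fun h h' => ⟨add_mem h.1 h'.1, fun i => (h.2 i).add (h'.2 i)⟩
      smul_mem' := fun c _ h => ⟨Submodule.smul_mem _ c h.1, fun i => (h.2 i).smul c⟩ }
  let φ : S →ₗ[k] H1 σ := H1.mk σ ∘ₗ
    { toFun := fun a => ⟨a.1.1, closedFormsCpt_le σ a.2.1⟩
      map_add' := fun _ _ => rfl
      map_smul' := fun _ _ => rfl }
  -- The invariants are the differences of the primitives at the sample points, for one path class
  -- at each. By equivariance this class determines the differences for all others.
  let ψ : S →ₗ[k] (∀ i j : ι, T i j → V) :=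
    { toFun := fun a i j z => a.1.2 i z (p z) - a.1.2 j z (p z)
      map_add' := fun a b => by
        funext i j z
        exact add_sub_add_comm _ _ _ _
      map_smul' := fun c a => by
        funext i j z
        exact (smul_sub c _ _).symm }
  have hker : LinearMap.ker ψ ≤ LinearMap.ker φ := by
    intro a ha
    rw [LinearMap.mem_ker] at ha ⊢
    refine (Submodule.Quotient.mk_eq_zero _).2 ?_
    have hagree : ∀ i j, ∀ y ∈ U' i ∩ U' j, ∀ q, a.1.2 i y q = a.1.2 j y q := by
      intro i j y hy q
      by_cases hij : i = j
      · rw [hij]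
      obtain ⟨z, hz, Q, hQo, hQc, hQ, hzQ, hyQ, hQU⟩ := hT i j hij y hy
      have h1 : a.1.2 i z (p z) - a.1.2 j z (p z) = 0 :=
        congrFun (congrFun (congrFun ha i) j) ⟨z, hz⟩
      exact ((a.2.2 i).mono (hQU.trans Set.inter_subset_left)).eq_of_eq
        ((a.2.2 j).mono (hQU.trans Set.inter_subset_right)) (chart_mem_maximalAtlas z) hQo hQc hQ
        subset_rfl hzQ (sub_eq_zero.1 h1) hyQ q
    obtain ⟨g, hg, -⟩ := IsPrimitiveOn.glue hU' a.2.1.1.1.2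
      (fun i => (a.2.2 i).mono (hUU i)) hagree hcov.ge isOpen_univ fun y _ => exists_local_lift y
    exact ⟨g, hg.mem_exactForms a.2.1.1.1.1⟩
  have hfin := finiteDimensional_range_of_ker_le φ ψ hker
  refine Submodule.finiteDimensional_of_le (S₂ := LinearMap.range φ) ?_
  rintro _ ⟨a, rfl⟩
  obtain ⟨α, rfl⟩ := Submodule.mkQ_surjective _ a
  choose f hf using hprim α.1 α.2
  exact ⟨⟨(α.1, f), α.2, hf⟩, rfl⟩

end Finiteness

/-! ### Punctured surfaces -/

section Punctured

set_option linter.unusedSectionVars false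

open IsManifold Filter Topology

/-- The ball is diffeomorphic to the plane with its centre going to the origin, and the plane minus
a point is connected since its dimension exceeds one. -/
lemma isConnected_puncturedBall (c : Plane) {r : ℝ} (hr : 0 < r) :
    IsConnected (Metric.ball c r \ {c}) := by
  have hrank : 1 < Module.rank ℝ Plane := by
    rw [← Module.finrank_eq_rank]
    simp
  have h1 := isConnected_compl_singleton_of_one_lt_rank hrank (0 : Plane)
  have h2 : Metric.ball c r \ {c} = OpenPartialHomeomorph.univBall c r '' {0}ᶜ := by
    have hi : Function.Injective (OpenPartialHomeomorph.univBall c r) := by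
      have := (OpenPartialHomeomorph.univBall c r).injOn
      rwa [OpenPartialHomeomorph.univBall_source, Set.injOn_univ] at this
    rw [Set.compl_eq_univ_sdiff, Set.image_sdiff hi, Set.image_singleton,
      OpenPartialHomeomorph.univBall_apply_zero, ← OpenPartialHomeomorph.univBall_source c r,
      OpenPartialHomeomorph.image_source_eq_target, OpenPartialHomeomorph.univBall_target c hr]
  rw [h2]
  exact h1.image _ (OpenPartialHomeomorph.continuous_univBall c r).continuousOn

variable {X : Type*} [TopologicalSpace X] [T2Space X] [ChartedSpace Plane X]
  [IsManifold 𝓘(ℝ, Plane) ∞ X]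

lemma exists_ball_around (D : Finset X) (x : X) :
    ∃ r > 0, Metric.ball (chartAt Plane x x) r ⊆ (chartAt Plane x).target ∧
      ∀ v ∈ Metric.ball (chartAt Plane x x) r, (chartAt Plane x).symm v ∈ D →
        (chartAt Plane x).symm v = x := by
  classical
  obtain ⟨r, hr, h1, h2⟩ := exists_ball_in_chart (mem_chart_source Plane x)
    ((D.erase x).finite_toSet.isClosed.isOpen_compl) (y := x) (by simp)
  refine ⟨r, hr, h1, fun v hv hD => ?_⟩
  by_contra hne
  exact h2 ⟨v, hv, rfl⟩ (by simp [hne, hD])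

/-- A nonempty open subset of a surface is infinite. -/
lemma infinite_of_isOpen {W : Set X} (hW : IsOpen W) (hne : W.Nonempty) : W.Infinite := by
  obtain ⟨x, hx⟩ := hne
  obtain ⟨r, hr, h1, h2⟩ := exists_ball_in_chart (mem_chart_source Plane x) hW hx
  exact ((infinite_of_mem_nhds _ (Metric.ball_mem_nhds _ hr)).image
    ((chartAt Plane x).symm.injOn.mono h1)).mono h2

lemma exists_connected_nhds (D : Finset X) (x : X) :
    ∃ N, IsOpen N ∧ x ∈ N ∧ IsPreconnected (N \ (D : Set X)) := by
  obtain ⟨r, hr, h1, h2⟩ := exists_ball_around D x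
  set e := chartAt Plane x
  refine ⟨e.symm '' Metric.ball (e x) r, isOpen_chart_image e Metric.isOpen_ball h1,
    (mem_chart_image h1).2 ⟨mem_chart_source Plane x, Metric.mem_ball_self hr⟩, ?_⟩
  have hex : e.symm (e x) = x := e.left_inv (mem_chart_source Plane x)
  by_cases hx : x ∈ D
  · have h3 : e.symm '' Metric.ball (e x) r \ (D : Set X) =
        e.symm '' (Metric.ball (e x) r \ {e x}) := by
      ext y
      constructor
      · rintro ⟨⟨v, hv, rfl⟩, hD⟩
        refine ⟨v, ⟨hv, ?_⟩, rfl⟩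
        rintro rfl
        exact hD (by rwa [hex])
      · rintro ⟨v, ⟨hv, hne⟩, rfl⟩
        refine ⟨⟨v, hv, rfl⟩, fun hD => hne ?_⟩
        rw [Set.mem_singleton_iff, ← e.right_inv (h1 hv), h2 v hv hD]
    rw [h3]
    exact (isConnected_puncturedBall _ hr).isPreconnected.image _
      (e.continuousOn_symm.mono (Set.sdiff_subset.trans h1))
  · have h3 : e.symm '' Metric.ball (e x) r \ (D : Set X) = e.symm '' Metric.ball (e x) r := by
      refine sdiff_eq_left.2 (Set.disjoint_left.2 ?_)
      rintro _ ⟨v, hv, rfl⟩ hD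
      exact hx (by rwa [← h2 v hv hD])
    rw [h3]
    exact (convex_ball _ _).isPreconnected.image _ (e.continuousOn_symm.mono h1)

/-- A connected surface remains connected when finitely many points are removed. -/
lemma isPreconnected_punctured [ConnectedSpace X] (D : Finset X) :
    IsPreconnected ((D : Set X)ᶜ) := by
  have hDo : IsOpen ((D : Set X)ᶜ) := D.finite_toSet.isClosed.isOpen_compl
  rw [isPreconnected_iff_subset_of_disjoint]
  intro u v hu hv huv hd
  set A := closure (u ∩ (D : Set X)ᶜ)
  set B := closure (v ∩ (D : Set X)ᶜ)
  have hAB : A ∪ B = Set.univ := by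
    rw [← closure_union, ← Set.union_inter_distrib_right, Set.inter_eq_right.2 huv]
    refine dense_iff_closure_eq.1 (dense_iff_inter_open.2 fun W hW hne => ?_)
    by_contra hem
    refine infinite_of_isOpen hW hne (D.finite_toSet.subset fun y hy => ?_)
    by_contra hyD
    exact hem ⟨y, hy, hyD⟩
  -- A common point of the closures would have a neighbourhood that stays connected without `D` and
  -- meets both pieces, which is impossible as they are open and disjoint off `D`.
  have hABd : A ∩ B = ∅ := by
    refine Set.eq_empty_of_forall_notMem fun x hx => ?_
    obtain ⟨N, hN, hxN, hc⟩ := exists_connected_nhds D x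
    obtain ⟨y, hyN, hyu, hyD⟩ := mem_closure_iff.1 hx.1 N hN hxN
    obtain ⟨z, hzN, hzv, hzD⟩ := mem_closure_iff.1 hx.2 N hN hxN
    obtain ⟨w, hw, hw'⟩ := hc u v hu hv (fun w hw => huv hw.2) ⟨y, ⟨hyN, hyD⟩, hyu⟩
      ⟨z, ⟨hzN, hzD⟩, hzv⟩
    exact (hd.le ⟨hw.2, hw'⟩ : w ∈ (∅ : Set X))
  have hX := isPreconnected_iff_subset_of_disjoint_closed.1 (isPreconnected_univ (α := X)) A B
    isClosed_closure isClosed_closure hAB.ge (by rw [hABd, Set.inter_empty])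
  have key : ∀ {a b : Set X}, Set.univ ⊆ closure (a ∩ (D : Set X)ᶜ) → (D : Set X)ᶜ ⊆ a ∪ b →
      IsOpen b → (D : Set X)ᶜ ∩ (a ∩ b) = ∅ → (D : Set X)ᶜ ⊆ a := by
    intro a b ha hab hb hd y hy
    by_contra hya
    have hyb : y ∈ b := (hab hy).resolve_left hya
    obtain ⟨z, hzb, hza, hzD⟩ := mem_closure_iff.1 (ha (Set.mem_univ y)) b hb hyb
    exact (hd.le ⟨hzD, hza, hzb⟩ : z ∈ (∅ : Set X))
  rcases hX with h | h
  · exact Or.inl (key h huv hv hd)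
  · exact Or.inr (key h (by rwa [Set.union_comm]) hu (by rwa [Set.inter_comm v u]))

lemma pathConnectedSpace_punctured [ConnectedSpace X] (D : Finset X) (x₀ : punctured X D) :
    PathConnectedSpace (punctured X D) := by
  have : LocallyPathConnectedSpace (punctured X D) :=
    ChartedSpace.locallyPathConnectedSpace Plane _
  rw [pathConnectedSpace_iff_connectedSpace]
  have h : IsConnected ((D : Set X)ᶜ) := ⟨⟨x₀.1, x₀.2⟩, isPreconnected_punctured D⟩
  exact isConnected_iff_connectedSpace.1 h

/-- The charts of an open subset are restrictions of charts of `X`, so near each point the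
coordinate changes, and hence their derivatives, are the old ones. -/
lemma isOrientedAtlas_punctured (hX : IsOrientedAtlas X) (D : Finset X) :
    IsOrientedAtlas (punctured X D) := by
  intro e he e' he' v hv
  have hne : Nonempty (punctured X D) := ⟨e.symm v⟩
  obtain ⟨x, rfl⟩ := TopologicalSpace.Opens.chart_eq hne he
  obtain ⟨x', rfl⟩ := TopologicalSpace.Opens.chart_eq hne he'
  have h1 := OpenPartialHomeomorph.subtypeRestr_symm_trans_subtypeRestr hne
    (chartAt Plane x.1) (chartAt Plane x'.1)
  have hv' : v ∈ ((chartAt Plane x.1).symm.trans (chartAt Plane x'.1)).source := by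
    rw [h1.1] at hv
    exact hv.1
  have h2 := hX _ (chart_mem_atlas Plane x.1) _ (chart_mem_atlas Plane x'.1) v hv'
  have h3 : (((chartAt Plane x.1).subtypeRestr hne).symm.trans
      ((chartAt Plane x'.1).subtypeRestr hne)) =ᶠ[𝓝 v]
      ((chartAt Plane x.1).symm.trans (chartAt Plane x'.1)) := by
    filter_upwards [OpenPartialHomeomorph.open_source _ |>.mem_nhds hv] with w hw using h1.2 hw
  rwa [h3.fderiv_eq]

variable {k : Type*} [RCLike k] {V : Type*} [NormedAddCommGroup V] [NormedSpace ℝ V]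
  [NormedSpace k V] [IsScalarTower ℝ k V] [FiniteDimensional k V]

/-- On a punctured compact surface, the image of `H¹_c` in `H¹` is finite dimensional. -/
theorem finiteDimensional_range_forgetSupport_punctured [CompactSpace X] [ConnectedSpace X]
    (D : Finset X) {x₀ : punctured X D}
    (σ : FundamentalGroup (punctured X D) x₀ →* (V →L[k] V)) :
    FiniteDimensional k (LinearMap.range (forgetSupport σ)) := by
  have := pathConnectedSpace_punctured D x₀
  have hne : Nonempty (punctured X D) := ⟨x₀⟩
  choose r hr hrt hrD using exists_ball_around D
  let N : ℝ → X → Set X := fun t x =>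
    (chartAt Plane x).symm '' Metric.ball (chartAt Plane x x) (t * r x)
  have hballs : ∀ {t : ℝ}, t ≤ 1 → ∀ x, Metric.ball (chartAt Plane x x) (t * r x) ⊆
      Metric.ball (chartAt Plane x x) (r x) := fun ht x =>
    Metric.ball_subset_ball (by nlinarith [hr x])
  have hNo : ∀ {t : ℝ}, t ≤ 1 → ∀ x, IsOpen (N t x) := fun ht x =>
    isOpen_chart_image _ Metric.isOpen_ball ((hballs ht x).trans (hrt x))
  -- Discs of half the radius already cover the compact surface `X`; the discs of full radius leave
  -- room around their overlaps. Each disc meets `D` at most in its centre.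
  obtain ⟨T, hT⟩ := CompactSpace.elim_nhds_subcover (N (1 / 2)) fun x =>
    (hNo (by norm_num) x).mem_nhds ((mem_chart_image ((hballs (by norm_num) x).trans (hrt x))).2
      ⟨mem_chart_source Plane x, Metric.mem_ball_self (by have := hr x; positivity)⟩)
  have hclosed : ∀ x, Metric.closedBall (chartAt Plane x x) (1 / 2 * r x) ⊆
      Metric.ball (chartAt Plane x x) (r x) := fun x =>
    Metric.closedBall_subset_ball (by linarith [hr x])
  refine finiteDimensional_range_forgetSupport (ι := T)
    (U := fun x => Subtype.val ⁻¹' N 1 x) (U' := fun x => Subtype.val ⁻¹' N (1 / 2) x)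
    (fun x => (hNo le_rfl x).preimage continuous_subtype_val)
    (fun x => (hNo (by norm_num) x).preimage continuous_subtype_val)
    (fun x => Set.preimage_mono (Set.image_mono (Metric.ball_subset_ball (by linarith [hr x]))))
    ?_ ?_ ?_
  · refine Set.eq_univ_of_forall fun y => ?_
    have hy : y.1 ∈ ⋃ x ∈ T, N (1 / 2) x := by rw [hT]; trivial
    obtain ⟨x, hx, hyx⟩ := Set.mem_iUnion₂.1 hy
    exact Set.mem_iUnion.2 ⟨⟨x, hx⟩, hyx⟩
  · rintro α ⟨⟨hα, hαc⟩, K, hK, hαK⟩ ⟨x, -⟩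
    set e := chartAt Plane x with he
    set e' := e.subtypeRestr hne with he'
    have hem : e' ∈ maximalAtlas 𝓘(ℝ, Plane) ∞ (punctured X D) :=
      StructureGroupoid.subtypeRestr_mem_maximalAtlas (chart_mem_atlas Plane x) hne
    have htar : ∀ v ∈ e.target, e.symm v ∉ D → v ∈ e'.target := fun v hv hD => by
      have := e.map_subtype_source hne (x := ⟨e.symm v, hD⟩) (e.map_target hv)
      rwa [e.right_inv hv] at this
    have hmem : ∀ (y : punctured X D) (S : Set Plane), S ⊆ e'.target → y.1 ∈ e.source →
        e y.1 ∈ S → y ∈ e'.symm '' S := fun y S hS hy hyS =>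
      (mem_chart_image hS).2 ⟨by simpa [he'] using hy, hyS⟩
    by_cases hx : x ∈ D
    · have hKx : x ∈ (Subtype.val '' K)ᶜ := by
        rintro ⟨y, -, rfl⟩
        exact y.2 hx
      obtain ⟨ε, hε, -, hεK⟩ := exists_ball_in_chart (mem_chart_source Plane x)
        (hK.image continuous_subtype_val).isClosed.isOpen_compl hKx
      have hsub : Metric.ball (e x) (r x) \ {e x} ⊆ e'.target := fun v hv =>
        htar v (hrt x hv.1) fun hD => hv.2 (by
          rw [Set.mem_singleton_iff, ← e.right_inv (hrt x hv.1)]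
          exact congrArg e (hrD x v hv.1 hD))
      obtain ⟨f, hf⟩ := exists_isPrimitiveOn_puncturedDisc hα hαc hem hε hsub
        fun v hv hvε p => hαK _ (fun h => hεK ⟨v, hvε, rfl⟩
          ⟨_, h, e.subtypeRestr_symm_apply hne (hsub hv)⟩) p
      refine ⟨f, hf.mono ?_⟩
      rintro y hy
      have hy' := (mem_chart_image ((hballs le_rfl x).trans (hrt x))).1 hy
      refine hmem y _ hsub hy'.1 ⟨hballs le_rfl x hy'.2, fun h => ?_⟩
      exact y.2 (by rwa [e.injOn hy'.1 (mem_chart_source Plane x) h])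
    · have hsub : Metric.ball (e x) (r x) ⊆ e'.target := fun v hv =>
        htar v (hrt x hv) fun hD => hx (by rwa [← hrD x v hv hD])
      have : CompleteSpace V := FiniteDimensional.complete k V
      obtain ⟨f, hf⟩ := exists_isPrimitiveOn hα hαc hem Metric.isOpen_ball (convex_ball _ _) hsub
      refine ⟨f, hf.mono ?_⟩
      rintro y hy
      have hy' := (mem_chart_image ((hballs le_rfl x).trans (hrt x))).1 hy
      exact hmem y _ hsub hy'.1 (hballs le_rfl x hy'.2)
  · rintro ⟨x, hx⟩ ⟨y, hy⟩ hab
    have hxy : x ≠ y := fun h => hab (Subtype.ext h)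
    have hc : ∀ x, IsCompact ((chartAt Plane x).symm ''
        Metric.closedBall (chartAt Plane x x) (1 / 2 * r x)) := fun x =>
      (isCompact_closedBall _ _).image_of_continuousOn
        ((chartAt Plane x).continuousOn_symm.mono ((hclosed x).trans (hrt x)))
    have hD : ∀ x, ∀ z ∈ (chartAt Plane x).symm '' Metric.closedBall (chartAt Plane x x)
        (1 / 2 * r x), z ∈ D → z = x := by
      rintro x _ ⟨v, hv, rfl⟩ h
      exact hrD x v (hclosed x hv) h
    refine ⟨_, Topology.IsInducing.subtypeVal.isCompact_preimage' ((hc x).inter (hc y))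
      fun z hz => ?_, ?_, ?_⟩
    · have hzD : z ∉ D := fun h => hxy ((hD x z hz.1 h).symm.trans (hD y z hz.2 h))
      exact ⟨⟨z, hzD⟩, rfl⟩
    · exact fun z hz => ⟨Set.image_mono Metric.ball_subset_closedBall hz.1,
        Set.image_mono Metric.ball_subset_closedBall hz.2⟩
    · refine fun z hz => ⟨Set.image_mono ?_ hz.1, Set.image_mono ?_ hz.2⟩
      · rw [one_mul]; exact hclosed x
      · rw [one_mul]; exact hclosed y

end Punctured

/-! ### Skew-symmetric maps of finite rank as bivectors -/

section Bivectors

variable {k : Type*} [Field k] {T T' : Type*} [AddCommGroup T] [Module k T] [AddCommGroup T']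
  [Module k T']

lemma contract_tmul (v w : T) (ξ : T →ₗ[k] k) : contract (v ⊗ₜ[k] w) ξ = ξ v • w := by
  simp [contract]

lemma contract_neg_sum {ι : Type*} (s : Finset ι) (v w : ι → T) (ξ : T →ₗ[k] k) :
    contract (-∑ i ∈ s, v i ⊗ₜ[k] w i) ξ = -∑ i ∈ s, ξ (v i) • w i := by
  simp [contract]

/-- A tensor is determined by its contractions with functionals that separate the points. -/
lemma eq_of_contract_eq {P : T' →ₗ[k] T →ₗ[k] k} (hP : ∀ v, (∀ α, P α v = 0) → v = 0)
    {Φ Ψ : T ⊗[k] T} (h : ∀ α, contract Φ (P α) = contract Ψ (P α)) : Φ = Ψ := by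
  classical
  let b := Module.Basis.ofVectorSpace k T
  refine (TensorProduct.equivFinsuppOfBasisRight (M := T) b).injective (Finsupp.ext fun i => ?_)
  -- Writing `Φ = ∑ vᵢ ⊗ bᵢ` with the basis in the second factor, `ξ(vᵢ)` is a coordinate of the
  -- contraction with `ξ`. The functionals `P α` separate points, so they determine every `vᵢ`.
  have key : ∀ (Φ : T ⊗[k] T) (ξ : T →ₗ[k] k),
      ξ (TensorProduct.equivFinsuppOfBasisRight b Φ i) = b.repr (contract Φ ξ) i := by
    intro Φ ξ
    induction Φ with
    | zero => simp [contract]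
    | tmul v w => simp [contract_tmul, mul_comm]
    | add x y hx hy => simp_all [contract]
  rw [← sub_eq_zero]
  exact hP _ fun α => by rw [map_sub, key, key, h, sub_self]

/-- Let `f : T' → T` be a linear map of finite rank which is skew-symmetric for a pairing of `T'`
and `T` that separates the points of `T`. Then `f` is defined by a bivector. -/
lemma exists_bivector [CharZero k] {P : T' →ₗ[k] T →ₗ[k] k} (hP : ∀ v, (∀ α, P α v = 0) → v = 0)
    {f : T' →ₗ[k] T} (hf : ∀ α β, P α (f β) = - P β (f α))
    [FiniteDimensional k (LinearMap.range f)] :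
    ∃ Φ ∈ wedgeSquare k T, ∀ α, contract Φ (P α) = f α := by
  classical
  let Q : LinearMap.range f →ₗ[k] Module.Dual k T' := P.flip ∘ₗ (LinearMap.range f).subtype
  have hQ : Function.Injective Q := by
    rw [← LinearMap.ker_eq_bot, LinearMap.ker_eq_bot']
    intro v hv
    exact Subtype.ext (hP v fun α => LinearMap.congr_fun hv α)
  -- The range of `f` is finite dimensional and injects into the dual of `T'`, so every functional
  -- on it is induced by an element of `T'`. This gives a family `α` dual to the basis `b`.
  have hQ' := (LinearMap.flip_surjective_iff₁ (B := Q)).2 hQ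
  let b := Module.finBasis k (LinearMap.range f)
  choose α hα using fun i => hQ' (b.coord i)
  have hα' : ∀ (i) (v : LinearMap.range f), P (α i) v = b.repr v i := fun i v =>
    LinearMap.congr_fun (hα i) v
  have hexp : ∀ v, f v = ∑ i, P (α i) (f v) • (b i : T) := by
    intro v
    have h1 := congrArg Subtype.val (b.sum_repr ⟨f v, v, rfl⟩)
    refine h1.symm.trans ?_
    simp only [AddSubmonoidClass.coe_finsetSum, Submodule.coe_smul]
    exact Finset.sum_congr rfl fun i _ => by rw [← hα' i]
  -- The sign comes from skew-symmetry: `f β = ∑ P(αⱼ)(f β) bⱼ = -∑ P(β)(f αⱼ) bⱼ`.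
  refine ⟨-∑ j, f (α j) ⊗ₜ[k] (b j : T), ?_, fun β => ?_⟩
  · have h1 : ∑ j, f (α j) ⊗ₜ[k] (b j : T) =
        ∑ j, ∑ i, P (α i) (f (α j)) • ((b i : T) ⊗ₜ[k] (b j : T)) :=
      Finset.sum_congr rfl fun j _ => by
        conv_lhs => rw [hexp (α j)]
        rw [TensorProduct.sum_tmul]
        exact Finset.sum_congr rfl fun i _ => (TensorProduct.smul_tmul' _ _ _)
    have h2 : ∑ j, f (α j) ⊗ₜ[k] (b j : T) =
        -∑ j, ∑ i, P (α i) (f (α j)) • ((b j : T) ⊗ₜ[k] (b i : T)) := by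
      rw [h1, Finset.sum_comm, ← Finset.sum_neg_distrib]
      refine Finset.sum_congr rfl fun j _ => ?_
      rw [← Finset.sum_neg_distrib]
      refine Finset.sum_congr rfl fun i _ => ?_
      rw [hf (α j) (α i), neg_smul]
    -- The coefficient matrix `P(αᵢ)(f αⱼ)` is skew-symmetric, so the sum is the average of its two
    -- expressions; dividing by two uses characteristic zero.
    have h3 : -∑ j, f (α j) ⊗ₜ[k] (b j : T) = (2⁻¹ : k) • ∑ j, ∑ i, P (α i) (f (α j)) •
        ((b j : T) ⊗ₜ[k] (b i : T) - (b i : T) ⊗ₜ[k] (b j : T)) := by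
      simp only [smul_sub, Finset.sum_sub_distrib]
      rw [← h1, ← neg_eq_iff_eq_neg.2 h2]
      module
    rw [h3]
    refine Submodule.smul_mem _ _ (Submodule.sum_mem _ fun j _ => Submodule.sum_mem _ fun i _ =>
      Submodule.smul_mem _ _ (Submodule.subset_span ⟨_, _, rfl⟩))
  · rw [contract_neg_sum, hexp β, ← Finset.sum_neg_distrib]
    exact Finset.sum_congr rfl fun i _ => by rw [hf β, neg_smul, neg_neg]

end Bivectors

/-! ### The pairing of cohomology groups -/

section Pairing

variable {k : Type*} [RCLike k] {V : Type*} [NormedAddCommGroup V] [NormedSpace ℝ V]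
  [NormedSpace k V] [IsScalarTower ℝ k V] [FiniteDimensional k V]
  {M : Type*} [TopologicalSpace M] [ChartedSpace Plane M] [IsManifold 𝓘(ℝ, Plane) ∞ M] {x₀ : M}
  {σ : FundamentalGroup M x₀ →* (V →L[k] V)} {B : LinearMap.BilinForm k V}
  [T2Space M] [SigmaCompactSpace M] [PathConnectedSpace M]

/-- The pairing of closed forms with compact support and closed forms. -/
def formPairing (hBs : B.IsSymm) (hB : IsInvariant B σ) :
    closedFormsCpt σ →ₗ[k] closedForms σ →ₗ[k] k :=
  LinearMap.mk₂ k (fun α β => integral (wedge B α.1 β.1))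
    (fun α α' β => by
      obtain ⟨K, hK, h0⟩ := α.2.2
      obtain ⟨K', hK', h0'⟩ := α'.2.2
      exact integral_wedge_add_left hB α.2.1.1 α'.2.1.1 (α + α').2.1.1 β.2.1 (hK.union hK')
        (fun y hy => Or.inl (h0 y fun h => hy (Or.inl h)))
        (fun y hy => Or.inl (h0' y fun h => hy (Or.inr h))))
    (fun c α β => integral_wedge_smul_left hB c α.2.1.1.2 (c • α).2.1.1.2 β.2.1.2)
    -- Additivity in the second argument is deduced from the first by antisymmetry; the compact set
    -- is now supplied by the right-hand form.
    (fun α β β' => by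
      obtain ⟨K, hK, h0⟩ := α.2.2
      have h1 := integral_wedge_antisymm hBs hB β.2.1.2 α.2.1.1.2
      have h2 := integral_wedge_antisymm hBs hB β'.2.1.2 α.2.1.1.2
      have h3 := integral_wedge_antisymm hBs hB (β + β').2.1.2 α.2.1.1.2
      have h4 := integral_wedge_add_left hB β.2.1 β'.2.1 (β + β').2.1 α.2.1.1 hK
        (fun y hy => Or.inr (h0 y hy)) (fun y hy => Or.inr (h0 y hy))
      rw [h3, h1, h2]
      exact (congrArg Neg.neg h4).trans (neg_add _ _))
    (fun c α β => by
      have h1 := integral_wedge_antisymm hBs hB β.2.1.2 α.2.1.1.2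
      have h3 := integral_wedge_antisymm hBs hB (c • β).2.1.2 α.2.1.1.2
      rw [h3, h1]
      have h4 := integral_wedge_smul_left hB c β.2.1.2 (c • β).2.1.2 α.2.1.1.2
      exact (congrArg Neg.neg h4).trans (mul_neg _ _).symm)

lemma formPairing_exactFormsCpt (hor : IsOrientedAtlas M) (hBs : B.IsSymm) (hB : IsInvariant B σ) :
    (exactFormsCpt σ).submoduleOf (closedFormsCpt σ) ≤
      LinearMap.ker (formPairing (k := k) hBs hB) := by
  rintro α ⟨f, hf, hfc, h⟩
  refine LinearMap.ext fun β => ?_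
  change integral (wedge B α.1 β.1) = 0
  rw [show α.1 = dSec f from h.unique (isDifferential_dSec f)]
  exact integral_wedge_dSec_left hor hB hf hfc β.2.1 β.2.2

lemma formPairing_exactForms (hor : IsOrientedAtlas M) (hBs : B.IsSymm) (hB : IsInvariant B σ) :
    (exactForms σ).submoduleOf (closedForms σ) ≤
      LinearMap.ker (formPairing (k := k) hBs hB).flip := by
  rintro β ⟨f, hf, h⟩
  refine LinearMap.ext fun α => ?_
  change integral (wedge B α.1 β.1) = 0
  rw [integral_wedge_antisymm hBs hB β.2.1.2 α.2.1.1.2,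
    show β.1 = dSec f from h.unique (isDifferential_dSec f),
    integral_wedge_dSec_right hor hB hf α.2.1.1 α.2.1.2 α.2.2, neg_zero]

/-- The pairing of `H¹_c` and `H¹`. -/
def cohomologyPairing (hor : IsOrientedAtlas M) (hBs : B.IsSymm) (hB : IsInvariant B σ) :
    H1c σ →ₗ[k] H1 σ →ₗ[k] k :=
  (formPairing hBs hB).liftQ₂ _ _ (formPairing_exactFormsCpt hor hBs hB)
    (formPairing_exactForms hor hBs hB)

lemma cohomologyPairing_mk (hor : IsOrientedAtlas M) (hBs : B.IsSymm) (hB : IsInvariant B σ)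
    (α : closedFormsCpt σ) (β : closedForms σ) :
    cohomologyPairing hor hBs hB (H1c.mk σ α) (H1.mk σ β) = integral (wedge B α.1 β.1) :=
  rfl

lemma cohomologyPairing_forgetSupport (hor : IsOrientedAtlas M) (hBs : B.IsSymm)
    (hB : IsInvariant B σ) (α β : H1c σ) :
    cohomologyPairing hor hBs hB α (forgetSupport σ β) =
      - cohomologyPairing hor hBs hB β (forgetSupport σ α) := by
  obtain ⟨α, rfl⟩ := Submodule.mkQ_surjective _ α
  obtain ⟨β, rfl⟩ := Submodule.mkQ_surjective _ β
  exact integral_wedge_antisymm hBs hB β.2.1.1.2 α.2.1.1.2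

/-- Poincaré duality for classes: the pairing with `H¹_c` separates the points of `H¹`. Both
existence and uniqueness of the bivector rest on this. -/
lemma eq_zero_of_cohomologyPairing_eq_zero (hor : IsOrientedAtlas M) (hBs : B.IsSymm)
    (hBn : B.Nondegenerate) (hB : IsInvariant B σ) (v : H1 σ)
    (h : ∀ α, cohomologyPairing hor hBs hB α v = 0) : v = 0 := by
  obtain ⟨β, rfl⟩ := Submodule.mkQ_surjective _ v
  exact (Submodule.Quotient.mk_eq_zero _).2
    (mem_exactForms_of_orthogonal hor hBs hBn hB β.2 fun α hα => h (H1c.mk σ ⟨α, hα⟩))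

end Pairing

end FlatSurface

end
-- The bivector of a punctured surface
open FlatSurface in
theorem lemma1
    -- the group `G` over `k = ℝ` or `ℂ`, with Lie algebra `F`, and the invariant form `B`
    {k : Type*} [RCLike k]
    {F : Type*} [NormedAddCommGroup F] [NormedSpace k F] [FiniteDimensional k F]
    [NormedSpace ℝ F] [IsScalarTower ℝ k F]
    {G : Type*} [TopologicalSpace G] [ChartedSpace F G] [Group G] [LieGroup 𝓘(k, F) ∞ G]
    (B : LinearMap.BilinForm k F) (hBsymm : B.IsSymm) (hBnondeg : B.Nondegenerate)
    (hBinv : ∀ (g : G) (u v : F), B (Ad k g u) (Ad k g v) = B u v)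
    -- the compact connected oriented surface `X` and the finite set `D` of punctures
    {X : Type*} [TopologicalSpace X] [T2Space X] [CompactSpace X] [ConnectedSpace X]
    [ChartedSpace Plane X] [IsManifold 𝓘(ℝ, Plane) ∞ X] (hX : IsOrientedAtlas X)
    (D : Finset X) (hD : D.Nonempty) (x₀ : punctured X D)
    (ρ : FundamentalGroup (punctured X D) x₀ →* G) :
    -- the pairing of forms induces a pairing of cohomology groups
    ∃ pairing : H1c ((Ad k).comp ρ) →ₗ[k] H1 ((Ad k).comp ρ) →ₗ[k] k,
      (∀ (α : closedFormsCpt ((Ad k).comp ρ)) (β : closedForms ((Ad k).comp ρ)),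
        pairing (H1c.mk _ α) (H1.mk _ β) = integral (wedge B α.1 β.1)) ∧
      -- skew-symmetry in terms of the pairing
      (∀ α β, pairing α (forgetSupport _ β) = - pairing β (forgetSupport _ α)) ∧
      -- there is exactly one `Φ` that defines the map `H¹_c → H¹`, and it lies in `⋀² H¹`
      ∃ Φ : H1 ((Ad k).comp ρ) ⊗[k] H1 ((Ad k).comp ρ),
        (∀ α, contract Φ (pairing α) = forgetSupport _ α) ∧
        (∀ Ψ : H1 ((Ad k).comp ρ) ⊗[k] H1 ((Ad k).comp ρ),
          (∀ α, contract Ψ (pairing α) = forgetSupport _ α) → Ψ = Φ) ∧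
        Φ ∈ wedgeSquare k (H1 ((Ad k).comp ρ)) := by
  have hpc := pathConnectedSpace_punctured D x₀
  have hor := isOrientedAtlas_punctured hX D
  -- The monodromy acts through `Ad`, so `G`-invariance of `B` is all that the topological argument
  -- needs to know about `G`.
  have hB : IsInvariant B ((Ad (F := F) k).comp ρ) := fun γ => hBinv (ρ γ)
  have hfin := finiteDimensional_range_forgetSupport_punctured D ((Ad (F := F) k).comp ρ)
  have hP := eq_zero_of_cohomologyPairing_eq_zero hor hBsymm hBnondeg hB
  have hskew := cohomologyPairing_forgetSupport hor hBsymm hB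
  obtain ⟨Φ, hΦ, h⟩ := exists_bivector hP hskew
  exact ⟨cohomologyPairing hor hBsymm hB, cohomologyPairing_mk hor hBsymm hB, hskew, Φ, h,
    fun Ψ hΨ => eq_of_contract_eq hP fun α => (hΨ α).trans (h α).symm, hΦ⟩
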